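/- Let $a_1,\ldots,a_{n-1}$ be nonnegative integers, not all zero, and let $\lambda$ be the corresponding dominant integral weight of $\mathfrak{sl}_n$ (coordinates $a_k$ in the basis of fundamental weights). Put $\lambda_i=a_i+\ldots+a_{n-1}$ for $1\le i\le n-1$ and $\lambda_n=0$, and identify $\lambda$ with $(\lambda_1,\ldots,\lambda_n)\in\mathbb Z^n$. The Weyl group $W=S_n$ acts on $\mathbb Z^n$ by $w\varepsilon_i=\varepsilon_{w(i)}$ and the positive roots are $\Phi^+=\{\varepsilon_i-\varepsilon_j: i<j\}$. For $\mu\in\mathbb Z^n$ put $e^\mu=x_1^{\mu_1}\cdots x_n^{\mu_n}$ with $x_n=1$, and $w(e^\mu)=e^{w\mu}$. Let $W_\lambda(t)=\sum_{w\in W,\,w\lambda=\lambda}t^{l(w)}$, where $l$ is the length function. The Gelfand–Tsetlin polytope $GT_\lambda$ is the set of real arrays $s=(s_{i,j})$, $0\le i\le n-1$, $1\le j\le n-i$, with $s_{0,j}=\lambda_j$ and $s_{i,j}\ge s_{i+1,j}\ge s_{i,j+1}$. For $s\in GT_\lambda$ let $p_s=\prod_{l=1}^{n-1}(1-t^l)^{d_l}\in\mathbb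 Z[t]$, where $d_l$ is the number of pairs $(i,x)$, $1\le i\le n-1$, $x\in\mathbb R$, such that $x$ occurs $l$ times in row $i$ and $l-1$ times in row $i-1$ of $s$. Since $p_s$ depends only on the minimal face of $GT_\lambda$ containing $s$, it defines a function $\varphi$ from the set of faces of $GT_\lambda$ to $\mathbb Z[t]$. For a vertex $v$ of $GT_\lambda$ let $C_v$ be the tangent cone at $v$ (with apex $v$). The faces of $C_v$ correspond to the faces of $GT_\lambda$ containing $v$, so $\varphi$ restricts to the faces of $C_v$. Let $\sigma_\varphi(C_v)\in\mathbb Z[t](\{t_{i,j}\})$ be the rational function represented by the formal Laurent series $S=\sum_{b}\varphi(f_b)\,e^b$, the sum being over all integer points $b$ of $C_v$, where $f_b$ is the minimal face of $C_v$ containing $b$ and $e^b=\prod t_{i,j}^{b_{i,j}}$; that is, $\sigma_\varphi(C_v)=(QS)/Q$ for any nonzero polynomial $Q$ for which $QS$ is a Laurent polynomial. Let $F$ be the specialization $t_{i,j}\mapsto x_i^{-1}x_{i+1}$, where $x_0=x_n=1$, with values in $\mathbb Z[t](x_1,\ldots,x_{n-1})$. Then for every vertex $v$ of $GT_\lambda$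 the rational function $\sigma_\varphi(C_v)$ exists and $F$ is well defined on it, and there is a distinguished subset of the vertices of $GT_\lambda$, parametrized bijectively by the elements of the orbit $W\lambda$, such that for the vertex $v$ corresponding to $\mu\in W\lambda$ $$F(\sigma_{\varphi}(C_v))=\frac1{W_\lambda(t)}\sum_{\substack{w\in W\\ w\lambda=\mu}} w\left(e^\lambda \prod_{\alpha\in\Phi^+}\frac{1-t e^{-\alpha}}{1-e^{-\alpha}}\right),$$ while $F(\sigma_{\varphi}(C_v))=0$ for every vertex $v$ outside this subset. -/

import Mathlib

namespace GTHL

noncomputable section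

/-! ### Faces, tangent cones and weighted integer point transforms -/

section Polyhedra

variable {ι : Type} [Fintype ι] {R : Type} [CommRing R] [IsDomain R]

/-- A face of `P`: a nonempty subset of `P` on which some linear functional attains its maximum
over `P` (the zero functional gives `P` itself). -/
def IsFace (P F : Set (ι → ℝ)) : Prop :=
  F.Nonempty ∧ IsExposed ℝ P F

/-- The minimal face of `P` containing `x`. -/
def minFace (P : Set (ι → ℝ)) (x : ι → ℝ) : Set (ι → ℝ) :=
  ⋂₀ {F | IsFace P F ∧ x ∈ F}

/-- The tangent cone `C_v` of `P` at `v`, with apex `v`. -/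
def tangentCone (P : Set (ι → ℝ)) (v : ι → ℝ) : Set (ι → ℝ) :=
  {y | ∃ x ∈ P, ∃ c : ℝ, 0 ≤ c ∧ y = v + c • (x - v)}

/-- The restriction to the faces of the tangent cone `C_v` of a function `φ` on the faces of `P`,
along the embedding `F ↦ F ∩ P` of the faces of `C_v` into the faces of `P`. -/
def coneWeight (P : Set (ι → ℝ)) (φ : Set (ι → ℝ) → R) : Set (ι → ℝ) → R :=
  fun F => φ (F ∩ P)

/-- The weighted generating function `S_φ(P)`, a formal Laurent series: the coefficient of `e^a` is
`φ` of the minimal face containing `a` if the integer point `a` lies in `P`, and `0` otherwise. -/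
def weightedSeries (P : Set (ι → ℝ)) (φ : Set (ι → ℝ) → R) : (ι → ℤ) → R :=
  fun a => P.indicator (fun x => φ (minFace P x)) (fun i => (a i : ℝ))

/-- The product of a polynomial and a formal Laurent series. -/
def mulSeries (Q : MvPolynomial ι R) (S : (ι → ℤ) → R) : (ι → ℤ) → R :=
  fun a => ∑ b ∈ Q.support, Q.coeff b * S (fun i => a i - (b i : ℤ))

/-- The rational function defined by a Laurent polynomial, given by its coefficients. -/
def laurentToFrac (p : (ι → ℤ) →₀ R) : FractionRing (MvPolynomial ι R) :=
  p.sum fun a c => algebraMap R (FractionRing (MvPolynomial ι R)) c *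
    ∏ i, (algebraMap (MvPolynomial ι R) (FractionRing (MvPolynomial ι R)) (MvPolynomial.X i)) ^ a i

/-- `σ` is the rational function `(Q S) / Q` represented by the formal Laurent series `S`, where
`Q ≠ 0` is any polynomial for which `Q S` is a Laurent polynomial. -/
def HasRationalForm (S : (ι → ℤ) → R) (σ : FractionRing (MvPolynomial ι R)) : Prop :=
  ∃ (Q : MvPolynomial ι R) (p : (ι → ℤ) →₀ R), Q ≠ 0 ∧ (∀ a, mulSeries Q S a = p a) ∧
    σ = laurentToFrac p / algebraMap (MvPolynomial ι R) (FractionRing (MvPolynomial ι R)) Q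

/-- `σ` is the weighted integer point transform `σ_φ(P)`. -/
def HasIPT (P : Set (ι → ℝ)) (φ : Set (ι → ℝ) → R) (σ : FractionRing (MvPolynomial ι R)) : Prop :=
  HasRationalForm (weightedSeries P φ) σ

/-- The specialization `X i ↦ y i` is well defined on the rational function `σ` (it can be written
with a denominator that does not vanish under the specialization), with result `r`. -/
def HasSpecialization {K : Type} [Field K] [Algebra R K] (y : ι → K)
    (σ : FractionRing (MvPolynomial ι R)) (r : K) : Prop :=
  ∃ p q : MvPolynomial ι R, MvPolynomial.aeval y q ≠ 0 ∧
    σ = algebraMap (MvPolynomial ι R) (FractionRing (MvPolynomial ι R)) p /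
      algebraMap (MvPolynomial ι R) (FractionRing (MvPolynomial ι R)) q ∧
    r = MvPolynomial.aeval y p / MvPolynomial.aeval y q

end Polyhedra

/-! ### Gelfand–Tsetlin patterns -/

/-- The positions `(i, j)` of a Gelfand–Tsetlin triangle with rows `0, …, n - 1`; row `i` has
`n - i` entries. Positions in a row are counted from `0` here, so `(i, j)` stands for what is
usually written `s_{i, j+1}`. -/
abbrev GTIndex (n : ℕ) : Type := {p : Fin n × Fin n // p.1.val + p.2.val < n}

/-- The row of a position. -/
def GTIndex.row {n : ℕ} (p : GTIndex n) : ℕ := p.1.1.val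

/-- The place of a position within its row, counted from `0`. -/
def GTIndex.col {n : ℕ} (p : GTIndex n) : ℕ := p.1.2.val

/-- The Gelfand–Tsetlin polytope with top row `l`, in the space with all triangle positions as
coordinates. The inequalities are `s_{i,j} ≥ s_{i+1,j} ≥ s_{i,j+1}`. -/
def gtPolytope {n : ℕ} (l : Fin n → ℤ) : Set (GTIndex n → ℝ) :=
  {s | (∀ p : GTIndex n, p.row = 0 → s p = l p.1.2) ∧
    (∀ p q : GTIndex n, q.row = p.row + 1 → q.col = p.col → s q ≤ s p) ∧
    (∀ p q : GTIndex n, q.row = p.row + 1 → p.col = q.col + 1 → s p ≤ s q)}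

/-- How many times the number `x` occurs in row `i` of the triangle `s`. -/
def rowMult {n : ℕ} (s : GTIndex n → ℝ) (i : ℕ) (x : ℝ) : ℕ :=
  Set.ncard {p : GTIndex n | p.row = i ∧ s p = x}

/-- The number `d_l` of pairs of a row `1 ≤ i ≤ n - 1` and a number `x` that occurs `l` times in
row `i` and `l - 1` times in row `i - 1` (for `l ≥ 1`). -/
def dStat {n : ℕ} (s : GTIndex n → ℝ) (l : ℕ) : ℕ :=
  Set.ncard {q : ℕ × ℝ | 1 ≤ q.1 ∧ q.1 ≤ n - 1 ∧ rowMult s q.1 q.2 = l ∧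
    rowMult s (q.1 - 1) q.2 = l - 1}

/-- The weight `p_s = ∏_{l=1}^{n-1} (1 - t^l)^{d_l}` of a triangle, in `ℤ[t]`. -/
def pWeight {n : ℕ} (s : GTIndex n → ℝ) : Polynomial ℤ :=
  ∏ l ∈ Finset.Icc 1 (n - 1), (1 - Polynomial.X ^ l) ^ dStat s l

open Classical in
/-- The weight function `φ` on the faces of the Gelfand–Tsetlin polytope: `φ F = p_s` for any point
`s` of the polytope whose minimal face is `F`. (The weight `p_s` depends only on which of the
defining inequalities are equalities at `s`, hence only on the minimal face of `s`.) -/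
def gtPhi {n : ℕ} (l : Fin n → ℤ) (F : Set (GTIndex n → ℝ)) : Polynomial ℤ :=
  if h : ∃ s ∈ gtPolytope l, minFace (gtPolytope l) s = F then pWeight h.choose else 0

/-! ### The specialization -/

/-- The field `ℤ[t](x_1, …, x_{n-1})`. -/
abbrev XField (n : ℕ) : Type := FractionRing (MvPolynomial (Fin (n - 1)) (Polynomial ℤ))

/-- The variable `t` in `ℤ[t](x_1, …, x_{n-1})`. -/
def tVar (n : ℕ) : XField n := algebraMap (Polynomial ℤ) (XField n) Polynomial.X

/-- `x_k` for `1 ≤ k ≤ n - 1`, and `1` for other `k`; in particular `x_0 = x_n = 1`. -/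
def xVar (n k : ℕ) : XField n :=
  if h : 1 ≤ k ∧ k ≤ n - 1 then
    algebraMap (MvPolynomial (Fin (n - 1)) (Polynomial ℤ)) (XField n)
      (MvPolynomial.X ⟨k - 1, by omega⟩)
  else 1

/-- The values `t_{i,j} ↦ x_i⁻¹ x_{i+1}` of the specialization. -/
def specF (n : ℕ) (p : GTIndex n) : XField n := (xVar n p.row)⁻¹ * xVar n (p.row + 1)

/-- The contribution `F(σ_φ(C_v))` of the point `v` of the Gelfand–Tsetlin polytope with top row `l`
is well defined and equal to `r`. -/
def HasContribution {n : ℕ} (l : Fin n → ℤ) (v : GTIndex n → ℝ) (r : XField n) : Prop :=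
  ∃ σ : FractionRing (MvPolynomial (GTIndex n) (Polynomial ℤ)),
    HasIPT (tangentCone (gtPolytope l) v) (coneWeight (gtPolytope l) (gtPhi l)) σ ∧
    HasSpecialization (specF n) σ r

/-! ### Weights, roots and the Weyl group of `𝔰𝔩_n` -/

/-- The coordinates `λ_i = a_i + … + a_{n-1}` (and `λ_n = 0`) of the dominant integral weight with
coordinates `a` in the basis of fundamental weights. -/
def lam {n : ℕ} (a : Fin (n - 1) → ℕ) : Fin n → ℤ :=
  fun i => ∑ k : Fin (n - 1), if i.val ≤ k.val then (a k : ℤ) else 0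

/-- The action of the Weyl group `S_n` on weights, `w ε_i = ε_{w i}`. -/
def weylAct {n : ℕ} (w : Equiv.Perm (Fin n)) (μ : Fin n → ℤ) : Fin n → ℤ :=
  fun i => μ (w⁻¹ i)

/-- The orbit `W μ`. -/
def weylOrbit {n : ℕ} (μ : Fin n → ℤ) : Set (Fin n → ℤ) :=
  Set.range fun w : Equiv.Perm (Fin n) => weylAct w μ

/-- The root `ε_i - ε_j`; the positive roots are those with `i < j`. -/
def root {n : ℕ} (i j : Fin n) : Fin n → ℤ := Pi.single i 1 - Pi.single j 1

/-- The length of an element of the Weyl group `S_n`: the number of positive roots that it makes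
negative. -/
def weylLength {n : ℕ} (w : Equiv.Perm (Fin n)) : ℕ :=
  Finset.card {p : Fin n × Fin n | p.1 < p.2 ∧ w p.2 < w p.1}

/-- The exponential `e^μ = x_1^{μ_1} ⋯ x_n^{μ_n}` with `x_n = 1`. -/
def expW {n : ℕ} (μ : Fin n → ℤ) : XField n := ∏ i : Fin n, xVar n (i.val + 1) ^ μ i

/-- The summand `w (e^l ∏_{α > 0} (1 - t e^{-α}) / (1 - e^{-α}))`. -/
def hlTerm {n : ℕ} (l : Fin n → ℤ) (w : Equiv.Perm (Fin n)) : XField n :=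
  expW (weylAct w l) * ∏ p : Fin n × Fin n with p.1 < p.2,
    (1 - tVar n * expW (-weylAct w (root p.1 p.2))) / (1 - expW (-weylAct w (root p.1 p.2)))

/-- The Poincaré polynomial `W_l(t) = ∑ t^{ℓ(w)}` of the stabilizer of `l`. -/
def stabPoincare {n : ℕ} (l : Fin n → ℤ) : XField n :=
  ∑ w : Equiv.Perm (Fin n) with weylAct w l = l, tVar n ^ weylLength w

/-- The part `W_l(t)⁻¹ ∑_{w l = μ} w (…)` of the Hall–Littlewood formula belonging to `μ`. -/
def hlPart {n : ℕ} (l μ : Fin n → ℤ) : XField n :=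
  (stabPoincare l)⁻¹ * ∑ w : Equiv.Perm (Fin n) with weylAct w l = μ, hlTerm l w

end

end GTHL

/-! Formal series are summed by regularization. `RSum g r` says that some element `Q` of a group
algebra with nonzero augmentation turns `g` into a finitely supported function of total `eps Q * r`.
Such a value is unique, invariant under translations, multiplicative for products and compatible
with iterated sums. If the terms of a series are first multiplied by the monomials of the
specialization `F`, the regularized sum is the value of `F` at the rational function that the series
represents (`exists_hasRationalForm_hasSpecialization`). Regularization is possible because the
weights depend only on the relative order of the coordinates: a cluster of coordinates far from all
others can be moved as a block without changing the weight, so the product of all `1 - e^A`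
annihilates the series outside a bounded box (`act_killer_finite`). These factors do not vanish
under `F`, because the `x_i` satisfy no multiplicative relation of degree 0.

Write an integer point of the tangent cone at an integral vertex `V` as `V + d`. Its face is the
face of `V + ε d` for small `ε > 0`, so only the lexicographic order of the pairs `(V, d)` matters.
Therefore the cone, the weight and the monomial factor over the values `c` of `V`
(`coneWeight_eq_prod`, `rsum_valueWeight`). The factor of `c` is a sum over patterns whose top row
consists of zeros. A step to the next row has `o` additional elements at the left and `r` at the
right, so the length changes by `o + r - 1`.

These pattern sums are found by exchanging steps. For fixed outer rows, the sum over the middle one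
of three rows is a product of transfer matrices over the integers, with two bits as the state. The
linear relation between the state vectors for the two orders of the variables is preserved at each
integer, which is a Yang–Baxter equation (`StateRel.step`). Comparing the states below and above all
entries shows that a step with `o + r > 0` followed by a shortening step can be exchanged with it at
the price of a scalar (`exchange`, `patternSum_exchange`). All other steps can thus be pushed behind
the shortening ones. A step with `o + r = 2` finally produces a geometric series over all of `ℤ`,
whose regularized sum is 0 (`patternSum_eq_zero`). A step with `o + r = 1` ends at the empty row and
contributes 1. Shortening steps alone leave one pattern below a constant row, of weight 1. So each
factor is 0 or a product of exchange scalars (`patternSum_replicate`).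

If some multiplicity in `V` grows from one row to the next, a step with `o + r = 2` occurs and the
contribution is 0. Otherwise each row arises from the previous one by deleting one number `m i`, and
`m` is a rearrangement of `λ`. Such triangles are vertices, they correspond to the orbit, and they
contribute `e^m` times the product of `(x_p - t x_q) / (x_p - x_q)` over the pairs with `m_p > m_q`.
The Hall–Littlewood part is the same product (`hlPart_eq`): in the sum over `w λ = μ`, the pairs on
which `λ` differs give a factor independent of `w`, and the sum of the remaining products is
`W_λ(t)` (`sum_blockProd`), by Lagrange interpolation. -/

namespace GTHL

noncomputable section

/-! ### Regularized sums over abelian groups -/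

section Action

variable {R : Type*} [CommRing R] {M N : Type*} [AddCommGroup M] [AddCommGroup N]

/-- The action of the group algebra of `M` on functions on `M` by translations. -/
def act : AddMonoidAlgebra R M →ₐ[R] Module.End R (M → R) :=
  AddMonoidAlgebra.lift R (Module.End R (M → R)) M
    { toFun := fun m => LinearMap.funLeft R R (fun a => a - m.toAdd)
      map_one' := by ext f a; simp [LinearMap.funLeft]
      map_mul' := fun x y => by
        ext f a
        simp [LinearMap.funLeft, sub_sub] }

/-- The augmentation of the group algebra. -/
def eps : AddMonoidAlgebra R M →ₐ[R] R := AddMonoidAlgebra.lift R R M 1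

theorem act_single (m : M) (c : R) (g : M → R) (a : M) :
    act (AddMonoidAlgebra.single m c) g a = c * g (a - m) := by
  simp [act, LinearMap.funLeft]

theorem eps_single (m : M) (c : R) : eps (AddMonoidAlgebra.single m c) = c := by
  simp [eps]

theorem act_mul (P Q : AddMonoidAlgebra R M) (g : M → R) : act (P * Q) g = act P (act Q g) := by
  rw [map_mul]; rfl

theorem act_comm (P Q : AddMonoidAlgebra R M) (g : M → R) :
    act P (act Q g) = act Q (act P g) := by
  rw [← act_mul, mul_comm, act_mul]

theorem act_add (P Q : AddMonoidAlgebra R M) (g : M → R) :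
    act (P + Q) g = act P g + act Q g := by
  rw [map_add]; rfl

/-- A translation does not change the total of a finitely supported function, so totals see only the
augmentation of `Q`. -/
theorem act_finite_finsum (Q : AddMonoidAlgebra R M) (p : M → R) (hp : p.support.Finite) :
    (act Q p).support.Finite ∧ ∑ᶠ a, act Q p a = eps Q * ∑ᶠ a, p a := by
  induction Q using AddMonoidAlgebra.induction_linear with
  | zero => simp
  | add f g hf hg =>
    rw [act_add, map_add, add_mul, ← hf.2, ← hg.2]
    refine ⟨(hf.1.union hg.1).subset (Function.support_add _ _), ?_⟩
    exact finsum_add_distrib hf.1 hg.1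
  | single m c =>
    have h : act (AddMonoidAlgebra.single m c) p = fun a => c * p (a - m) := by
      ext a; rw [act_single]
    have hfin : (Function.support fun a => p (a - m)).Finite := by
      have := hp.preimage (f := fun a => a - m) (fun x _ y _ hxy => by simpa using hxy)
      exact this
    rw [h, eps_single]
    refine ⟨hfin.subset fun a ha h0 => ha (by simp [h0]), ?_⟩
    rw [← mul_finsum' _ _ hfin]
    congr 1
    exact finsum_comp_equiv (Equiv.subRight m)

end Action

/-! ### Regularized sums: uniqueness, linearity, transport -/

section RSum

variable {K : Type*} [Field K] {M N : Type*} [AddCommGroup M] [AddCommGroup N]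

/-- `r` is the regularized sum of `g` computed with the help of `Q`. -/
def RSumBy (Q : AddMonoidAlgebra K M) (g : M → K) (r : K) : Prop :=
  (act Q g).support.Finite ∧ ∑ᶠ a, act Q g a = eps Q * r

/-- `r` is the regularized sum of `g` over `M`. -/
def RSum (g : M → K) (r : K) : Prop :=
  ∃ Q : AddMonoidAlgebra K M, eps Q ≠ 0 ∧ RSumBy Q g r

/-- Two regularizations, of one function or of two, are compared through the product of their
elements; this needs stability under multiples. -/
theorem RSumBy.mul {Q : AddMonoidAlgebra K M} {g : M → K} {r : K} (h : RSumBy Q g r)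
    (P : AddMonoidAlgebra K M) : RSumBy (P * Q) g r := by
  have := act_finite_finsum P _ h.1
  refine ⟨by rw [act_mul]; exact this.1, ?_⟩
  rw [act_mul, this.2, h.2, map_mul, mul_assoc]

/-- Computed with the product of both elements, the total is `eps (P * Q)` times either value, and
this nonzero scalar cancels. -/
theorem RSum.unique {g : M → K} {r s : K} (hr : RSum g r) (hs : RSum g s) : r = s := by
  obtain ⟨P, hP, h1⟩ := hr
  obtain ⟨Q, hQ, h2⟩ := hs
  have e1 := (h1.mul Q).2
  have e2 := (h2.mul P).2
  rw [mul_comm P Q, e1] at e2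
  exact mul_left_cancel₀ (by rw [map_mul]; exact mul_ne_zero hQ hP) e2

theorem rsumBy_exists {Q : AddMonoidAlgebra K M} {g : M → K} (hQ : eps Q ≠ 0)
    (h : (act Q g).support.Finite) : ∃ r, RSumBy Q g r :=
  ⟨(eps Q)⁻¹ * ∑ᶠ a, act Q g a, h, by rw [mul_inv_cancel_left₀ hQ]⟩

theorem RSum.add {f g : M → K} {r s : K} (hr : RSum f r) (hs : RSum g s) :
    RSum (f + g) (r + s) := by
  obtain ⟨P, hP, h1⟩ := hr
  obtain ⟨Q, hQ, h2⟩ := hs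
  have e1 := h1.mul Q
  have e2 := h2.mul P
  rw [mul_comm P Q] at e2
  refine ⟨Q * P, by rw [map_mul]; exact mul_ne_zero hQ hP, ?_, ?_⟩
  · rw [map_add]; exact (e1.1.union e2.1).subset (Function.support_add _ _)
  · rw [map_add, mul_add, ← e1.2, ← e2.2]; exact finsum_add_distrib e1.1 e2.1

theorem RSum.smul {g : M → K} {r : K} (h : RSum g r) (c : K) :
    RSum (fun a => c * g a) (c * r) := by
  obtain ⟨Q, hQ, h1, h2⟩ := h
  have e : act Q (fun a => c * g a) = c • act Q g := by
    rw [← map_smul]; rfl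
  refine ⟨Q, hQ, ?_, ?_⟩
  · rw [e]; exact h1.subset (Function.support_const_smul_subset c _)
  · rw [e]
    simp only [Pi.smul_apply, smul_eq_mul]
    rw [← mul_finsum, h2]; ring

theorem rsum_of_finite {g : M → K} (h : g.support.Finite) : RSum g (∑ᶠ a, g a) :=
  ⟨1, by simp, by simpa using h, by simp⟩

theorem rsum_zero : RSum (fun _ : M => (0 : K)) 0 := by
  simpa using rsum_of_finite (M := M) (g := fun _ => (0 : K)) (by simp)

theorem rsum_single [DecidableEq M] (m : M) (c : K) : RSum (fun a => if a = m then c else 0) c := by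
  have hs : (Function.support fun a => if a = m then c else 0) ⊆ ({m} : Set M) := by
    intro a ha; by_contra h; exact ha (if_neg h)
  have := rsum_of_finite (g := fun a => if a = m then c else 0) ((Set.finite_singleton m).subset hs)
  rwa [finsum_eq_single _ m (fun x hx => if_neg hx), if_pos rfl] at this

/-! #### Transport along homomorphisms -/

theorem eps_mapDomain (f : M →+ N) (Q : AddMonoidAlgebra K M) :
    eps (AddMonoidAlgebra.mapDomainAlgHom K K f Q) = eps Q := by
  induction Q using AddMonoidAlgebra.induction_linear with
  | zero => simp
  | add f g hf hg => rw [map_add, map_add, hf, hg, map_add]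
  | single m c => simp [eps]

theorem act_mapDomain_equiv (e : M ≃+ N) (Q : AddMonoidAlgebra K M) (g : N → K) (a : N) :
    act (AddMonoidAlgebra.mapDomainAlgHom K K (e : M →+ N) Q) g a = act Q (g ∘ e) (e.symm a) := by
  induction Q using AddMonoidAlgebra.induction_linear with
  | zero => simp
  | add f g hf hg => rw [map_add, act_add, act_add, Pi.add_apply, Pi.add_apply, hf, hg]
  | single m c =>
    simp only [AddMonoidAlgebra.mapDomainAlgHom_apply, AddMonoidAlgebra.mapDomain_single]
    simp [act_single]

theorem RSum.equiv {e : M ≃+ N} {g : N → K} {r : K} (h : RSum (g ∘ e) r) : RSum g r := by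
  obtain ⟨Q, hQ, h1, h2⟩ := h
  have e1 : act (AddMonoidAlgebra.mapDomainAlgHom K K (e : M →+ N) Q) g =
      act Q (g ∘ e) ∘ e.symm := by
    ext a; exact act_mapDomain_equiv e Q g a
  refine ⟨AddMonoidAlgebra.mapDomainAlgHom K K (e : M →+ N) Q, by rwa [eps_mapDomain], ?_, ?_⟩
  · rw [e1]
    exact h1.preimage (f := e.symm) e.symm.injective.injOn
  · rw [e1, eps_mapDomain, ← h2]
    exact finsum_comp_equiv e.symm.toEquiv

theorem rsum_equiv_iff (e : M ≃+ N) {g : N → K} {r : K} : RSum (g ∘ e) r ↔ RSum g r := by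
  refine ⟨RSum.equiv, fun h => RSum.equiv (e := e.symm) ?_⟩
  have : (g ∘ e) ∘ e.symm = g := by ext; simp
  rwa [this]

/-- A translation is the action of an element of augmentation 1 and commutes with the regularizer.
This moves the apex of a tangent cone to the origin. -/
theorem rsum_comp_add {g : M → K} {r : K} (m : M) (h : RSum g r) : RSum (fun a => g (a + m)) r := by
  have e1 : (fun a => g (a + m)) = act (AddMonoidAlgebra.single (-m) (1 : K)) g := by
    ext a; simp [act_single]
  obtain ⟨Q, hQ, h⟩ := h
  have := h.mul (AddMonoidAlgebra.single (-m) (1 : K))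
  refine ⟨Q, hQ, ?_, ?_⟩
  · rw [e1, act_comm, ← act_mul]; exact this.1
  · rw [e1, act_comm, ← act_mul, this.2, map_mul, eps_single, one_mul]

end RSum

/-! #### Products and iterated sums -/

section Prod

variable {K : Type*} [Field K] {M N : Type*} [AddCommGroup M] [AddCommGroup N]

theorem act_inr (Q : AddMonoidAlgebra K N) (g : M × N → K) (m : M) (n : N) :
    act (AddMonoidAlgebra.mapDomainAlgHom K K (AddMonoidHom.inr M N) Q) g (m, n) =
      act Q (fun n => g (m, n)) n := by
  induction Q using AddMonoidAlgebra.induction_linear with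
  | zero => simp
  | add f g hf hg => rw [map_add, act_add, act_add, Pi.add_apply, Pi.add_apply, hf, hg]
  | single a c =>
    simp only [AddMonoidAlgebra.mapDomainAlgHom_apply, AddMonoidAlgebra.mapDomain_single]
    simp [act_single]

/-- Summing along `N` forgets the `N`-part of each translation, so `Q` descends to its image under
the projection. -/
theorem act_fst_finsum (Q : AddMonoidAlgebra K (M × N)) (h : M × N → K)
    (hf : ∀ m, (Function.support fun n => h (m, n)).Finite) :
    (∀ m, (Function.support fun n => act Q h (m, n)).Finite) ∧
    ∀ m, ∑ᶠ n, act Q h (m, n) =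
      act (AddMonoidAlgebra.mapDomainAlgHom K K (AddMonoidHom.fst M N) Q)
        (fun m => ∑ᶠ n, h (m, n)) m := by
  induction Q using AddMonoidAlgebra.induction_linear with
  | zero => simp
  | add f g hf hg =>
    refine ⟨fun m => ?_, fun m => ?_⟩
    · rw [act_add]
      exact ((hf.1 m).union (hg.1 m)).subset (Function.support_add _ _)
    · rw [act_add, map_add, act_add, Pi.add_apply, ← hf.2, ← hg.2]
      exact finsum_add_distrib (hf.1 m) (hg.1 m)
  | single a c =>
    obtain ⟨a, b⟩ := a
    have hfin : ∀ m, (Function.support fun n => h (m - a, n - b)).Finite := fun m => by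
      have := (hf (m - a)).preimage (f := fun n => n - b) (fun x _ y _ hxy => by simpa using hxy)
      exact this
    refine ⟨fun m => (hfin m).subset fun n hn h0 => hn ?_, fun m => ?_⟩
    · simp only [act_single, Prod.mk_sub_mk]; exact mul_eq_zero_of_right _ h0
    · simp only [AddMonoidAlgebra.mapDomainAlgHom_apply, AddMonoidAlgebra.mapDomain_single,
        act_single, Prod.mk_sub_mk]
      rw [← mul_finsum]
      congr 1
      exact finsum_comp_equiv (f := fun n => h (m - a, n)) (Equiv.subRight b)

/-- Iterated regularized sums, the inner sums being computed uniformly. -/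
theorem RSum.fubini {g : M × N → K} {r : K} (hr : RSum g r) {G : M → K}
    {Q' : AddMonoidAlgebra K N} (hQ' : eps Q' ≠ 0)
    (h : ∀ m, RSumBy Q' (fun n => g (m, n)) (G m)) : RSum G r := by
  obtain ⟨Q, hQ, h1⟩ := hr
  -- As `Q'` regularizes every fibre, it can act as a single element of the large group algebra.
  -- This is why the fibres must share one `Q'`.
  set E := AddMonoidAlgebra.mapDomainAlgHom K K (AddMonoidHom.inr M N) Q' with hE
  set π := AddMonoidAlgebra.mapDomainAlgHom K K (AddMonoidHom.fst M N) Q with hπ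
  have hEg : ∀ m n, act E g (m, n) = act Q' (fun n => g (m, n)) n := fun m n => act_inr Q' g m n
  obtain ⟨f1, f2⟩ := act_fst_finsum Q (act E g) (fun m => by simp only [hEg]; exact (h m).1)
  have hI : (fun m => ∑ᶠ n, act E g (m, n)) = eps Q' • G := by
    ext m; simp only [hEg]; rw [(h m).2]; rfl
  rw [hI, map_smul] at f2
  have htot := h1.mul E
  rw [mul_comm, RSumBy, act_mul] at htot
  obtain ⟨t1, t2⟩ := htot
  -- Over an `m` outside the projection of the finite support, every summand of the inner sum
  -- vanishes.
  have hsup : (act π G).support.Finite := by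
    refine (t1.image Prod.fst).subset fun m hm => ?_
    by_contra hcon
    apply hm
    have h0 : ∀ n, act Q (act E g) (m, n) = 0 := fun n => by
      by_contra hne
      exact hcon ⟨(m, n), hne, rfl⟩
    have := f2 m
    simp only [h0, finsum_zero, Pi.smul_apply, smul_eq_mul] at this
    exact (mul_eq_zero.mp this.symm).resolve_left hQ'
  refine ⟨π, by rwa [hπ, eps_mapDomain], hsup, ?_⟩
  have e1 : ∑ᶠ a, act Q (act E g) a = ∑ᶠ m, ∑ᶠ n, act Q (act E g) (m, n) :=
    finsum_curry _ t1
  rw [t2] at e1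
  simp only [f2, Pi.smul_apply, smul_eq_mul] at e1
  rw [← mul_finsum, map_mul, eps_mapDomain] at e1
  apply mul_left_cancel₀ hQ'
  rw [← e1, hπ, eps_mapDomain]; ring

end Prod

/-! ### Products of regularized sums -/

section Pi

variable {K : Type*} [Field K] {C : Type*} [Fintype C] [DecidableEq C] {M : C → Type*}
  [∀ c, AddCommGroup (M c)]

theorem act_pi_single (c : C) (Q : AddMonoidAlgebra K (M c)) (G : ∀ c, M c → K) :
    act (AddMonoidAlgebra.mapDomainAlgHom K K (AddMonoidHom.single M c) Q)
      (fun m => ∏ c, G c (m c)) =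
      fun m => ∏ c', Function.update G c (act Q (G c)) c' (m c') := by
  ext m
  have key : ∀ F : M c → K, ∏ c', Function.update G c F c' (m c') =
      F (m c) * ∏ c' ∈ Finset.univ.erase c, G c' (m c') := by
    intro F
    rw [← Finset.mul_prod_erase _ _ (Finset.mem_univ c), Function.update_self]
    congr 1
    exact Finset.prod_congr rfl fun c' hc' => by
      rw [Function.update_of_ne (Finset.ne_of_mem_erase hc')]
  rw [key]
  induction Q using AddMonoidAlgebra.induction_linear with
  | zero => simp
  | add f g hf hg => rw [map_add, act_add, act_add, Pi.add_apply, Pi.add_apply, hf, hg, add_mul]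
  | single a b =>
    simp only [AddMonoidAlgebra.mapDomainAlgHom_apply, AddMonoidAlgebra.mapDomain_single,
      act_single]
    rw [← Finset.mul_prod_erase _ _ (Finset.mem_univ c), mul_assoc]
    congr 1
    congr 1
    · simp
    · exact Finset.prod_congr rfl fun c' hc' => by
        simp [Finset.ne_of_mem_erase hc']

/-- Each regularizer acts in its own coordinate and changes only its own factor. Their product
therefore acts factor by factor, and a finite sum of products over a box is a product of sums. -/
theorem RSum.pi {G : ∀ c, M c → K} {r : C → K} (h : ∀ c, RSum (G c) (r c)) :
    RSum (fun m : ∀ c, M c => ∏ c, G c (m c)) (∏ c, r c) := by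
  choose Q hQ h1 using h
  have key : ∀ s : Finset C,
      act (∏ c ∈ s, AddMonoidAlgebra.mapDomainAlgHom K K (AddMonoidHom.single M c) (Q c))
        (fun m => ∏ c, G c (m c)) =
      fun m => ∏ c, (if c ∈ s then act (Q c) (G c) else G c) (m c) := by
    intro s
    induction s using Finset.induction_on with
    | empty => ext m; simp
    | insert a s ha ih =>
      rw [Finset.prod_insert ha, act_mul, ih, act_pi_single]
      ext m
      refine Finset.prod_congr rfl fun c _ => ?_
      by_cases hca : c = a
      · subst hca; simp [ha]
      · rw [Function.update_of_ne hca]; simp [hca]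
  have hu := key Finset.univ
  simp only [Finset.mem_univ, if_true] at hu
  have hfin : (Function.support fun m : ∀ c, M c => ∏ c, act (Q c) (G c) (m c)).Finite := by
    refine (Set.Finite.pi fun c => (h1 c).1).subset fun m hm c _ hc => hm ?_
    exact Finset.prod_eq_zero (Finset.mem_univ c) hc
  refine ⟨∏ c, AddMonoidAlgebra.mapDomainAlgHom K K (AddMonoidHom.single M c) (Q c), ?_, ?_, ?_⟩
  · rw [map_prod]
    exact Finset.prod_ne_zero_iff.mpr fun c _ => by rw [eps_mapDomain]; exact hQ c
  · rw [hu]; exact hfin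
  · rw [hu, map_prod, ← Finset.prod_mul_distrib]
    simp only [eps_mapDomain]
    simp only [← (h1 _).2]
    have e : ∀ c, ∑ᶠ a, act (Q c) (G c) a = ∑ a ∈ (h1 c).1.toFinset, act (Q c) (G c) a := fun c =>
      finsum_eq_sum_of_support_subset _ (by simp)
    simp only [e]
    rw [Finset.prod_univ_sum]
    apply finsum_eq_sum_of_support_subset
    intro m hm
    rw [Finset.mem_coe, Fintype.mem_piFinset]
    intro c
    rw [Set.Finite.mem_toFinset]
    intro hc
    exact hm (Finset.prod_eq_zero (Finset.mem_univ c) hc)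

theorem RSum.prod {N₁ N₂ : Type*} [AddCommGroup N₁] [AddCommGroup N₂] {f : N₁ → K} {g : N₂ → K}
    {r s : K} (hf : RSum f r) (hg : RSum g s) :
    RSum (fun p : N₁ × N₂ => f p.1 * g p.2) (r * s) := by
  obtain ⟨P, hP, f1, f2⟩ := hf
  obtain ⟨Q, hQ, g1, g2⟩ := hg
  have hl : ∀ (P : AddMonoidAlgebra K N₁) (f : N₁ → K) (g : N₂ → K),
      act (AddMonoidAlgebra.mapDomainAlgHom K K (AddMonoidHom.inl N₁ N₂) P)
        (fun p => f p.1 * g p.2) = fun p => act P f p.1 * g p.2 := by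
    intro P f g
    ext p
    induction P using AddMonoidAlgebra.induction_linear with
    | zero => simp
    | add f g hf hg => rw [map_add, act_add, act_add, Pi.add_apply, Pi.add_apply, hf, hg, add_mul]
    | single a c =>
      simp only [AddMonoidAlgebra.mapDomainAlgHom_apply, AddMonoidAlgebra.mapDomain_single]
      simp [act_single, mul_assoc]
  have hr : ∀ (f : N₁ → K),
      act (AddMonoidAlgebra.mapDomainAlgHom K K (AddMonoidHom.inr N₁ N₂) Q)
        (fun p => f p.1 * g p.2) = fun p => f p.1 * act Q g p.2 := by
    intro f
    ext ⟨m, n⟩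
    rw [act_inr]
    have : (fun n => f m * g n) = f m • g := rfl
    rw [this, map_smul]; rfl
  have hact := hr (act P f)
  rw [← hl, ← act_mul] at hact
  refine ⟨AddMonoidAlgebra.mapDomainAlgHom K K (AddMonoidHom.inr N₁ N₂) Q *
    AddMonoidAlgebra.mapDomainAlgHom K K (AddMonoidHom.inl N₁ N₂) P, ?_, ?_, ?_⟩
  rotate_left 2
  · rw [hact, map_mul, eps_mapDomain, eps_mapDomain]
    have e1 : ∑ᶠ p : N₁ × N₂, act P f p.1 * act Q g p.2 =
        ∑ p ∈ f1.toFinset ×ˢ g1.toFinset, act P f p.1 * act Q g p.2 := by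
      apply finsum_eq_sum_of_support_subset
      intro p hp
      simp only [Function.mem_support, ne_eq, mul_eq_zero, not_or] at hp
      simpa using hp
    rw [e1, Finset.sum_product, ← Finset.sum_mul_sum, ← finsum_eq_sum_of_support_subset _ (by simp),
      ← finsum_eq_sum_of_support_subset _ (by simp), f2, g2]
    ring
  · rw [map_mul, eps_mapDomain, eps_mapDomain]; exact mul_ne_zero hQ hP
  · rw [hact]
    refine (f1.prod g1).subset fun p hp => ?_
    simp only [Function.mem_support, ne_eq, mul_eq_zero, not_or] at hp
    exact hp

end Pi

end

end GTHL

namespace GTHL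

noncomputable section

/-! ### Functions depending only on the order of the coordinates -/

section OrderInvariant

variable {ι : Type*} [DecidableEq ι] {R : Type*} [CommRing R]

/-- The indicator vector of a set of coordinates. -/
def ind (A : Finset ι) : ι → ℤ := fun i => if i ∈ A then 1 else 0

/-- `f d` depends only on the order of the coordinates of `d` among themselves and with respect to
the integers of absolute value at most `m`. -/
def OrderInvariant (m : ℤ) (f : (ι → ℤ) → R) : Prop :=
  ∀ φ : ℤ → ℤ, StrictMono φ → (∀ x, |x| ≤ m → φ x = x) → ∀ d, f (φ ∘ d) = f d

/-- The product of `1 - e^A` over the nonempty sets `A` of coordinates in `S`. -/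
def killer (R : Type*) [CommRing R] (S : Finset ι) : AddMonoidAlgebra R (ι → ℤ) :=
  ∏ A ∈ S.powerset.erase ∅, (1 - AddMonoidAlgebra.single (ind A) 1)

theorem act_one_sub_single (m : ι → ℤ) (f : (ι → ℤ) → R) (d : ι → ℤ) :
    act (1 - AddMonoidAlgebra.single m 1) f d = f d - f (d - m) := by
  have : act (1 - AddMonoidAlgebra.single m (1 : R)) f =
      f - act (AddMonoidAlgebra.single m (1 : R)) f := by
    rw [map_sub, map_one]; rfl
  rw [this, Pi.sub_apply, act_single, one_mul]

/-- Expanding the product, `f` is evaluated at `d` minus at most `T.card` indicator vectors. The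
sets `U k` are regions with a margin for `k` such moves. -/
theorem act_prod_eq_zero (T : Finset (Finset ι)) (f : (ι → ℤ) → R) (U : ℕ → Set (ι → ℤ))
    (h0 : ∀ d ∈ U 0, f d = 0) (h1 : ∀ k, ∀ d ∈ U (k + 1), d ∈ U k)
    (h2 : ∀ k, ∀ d ∈ U (k + 1), ∀ B ∈ T, d - ind B ∈ U k) :
    ∀ d ∈ U T.card, act (∏ B ∈ T, (1 - AddMonoidAlgebra.single (ind B) 1)) f d = 0 := by
  induction T using Finset.induction_on with
  | empty => intro d hd; simpa using h0 d hd
  | insert B T hB ih =>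
    intro d hd
    rw [Finset.card_insert_of_notMem hB] at hd
    have ih' := ih fun k d hd B hB => h2 k d hd B (Finset.mem_insert_of_mem hB)
    rw [Finset.prod_insert hB, act_mul, act_one_sub_single, ih' d (h1 _ d hd),
      ih' _ (h2 _ d hd B (Finset.mem_insert_self _ _)), sub_zero]

theorem killer_eq_mul {S A : Finset ι} (hA : A ⊆ S) (hne : A ≠ ∅) :
    killer R S = (∏ B ∈ (S.powerset.erase ∅).erase A, (1 - AddMonoidAlgebra.single (ind B) 1)) *
      (1 - AddMonoidAlgebra.single (ind A) 1) := by
  rw [killer, Finset.prod_erase_mul]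
  exact Finset.mem_erase.mpr ⟨hne, Finset.mem_powerset.mpr hA⟩

theorem ind_nonneg (A : Finset ι) (i : ι) : 0 ≤ ind A i := by unfold ind; split_ifs <;> simp

theorem ind_le_one (A : Finset ι) (i : ι) : ind A i ≤ 1 := by unfold ind; split_ifs <;> simp

variable {m : ℤ} {f : (ι → ℤ) → R} {S : Finset ι}

/-- Moving the whole high cluster `A` by one unit is a monotone relabelling that fixes `[-m, m]`, so
the factor `1 - e^A` alone gives 0. The other factors shift coordinates by at most one each, and the
gap is wide enough to survive all of them. -/
theorem act_killer_eq_zero_of_gap_above (hf : OrderInvariant m f) {A : Finset ι} (hA : A ⊆ S)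
    (hne : A ≠ ∅) {θ : ℤ} (hθ : m < θ) {d : ι → ℤ}
    (h1 : ∀ i ∈ A, θ + 1 + (S.powerset.card : ℤ) ≤ d i) (h2 : ∀ i ∉ A, d i < θ) :
    act (killer R S) f d = 0 := by
  rw [killer_eq_mul hA hne, act_mul]
  set T := (S.powerset.erase ∅).erase A
  refine act_prod_eq_zero T _
    (fun k => {d | (∀ i ∈ A, θ + 1 + k ≤ d i) ∧ ∀ i ∉ A, d i < θ}) ?_ ?_ ?_ d ⟨fun i hi => ?_, h2⟩
  · rintro d ⟨h1, h2⟩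
    rw [act_one_sub_single, sub_eq_zero]
    have : d = (fun x => if θ ≤ x then x + 1 else x) ∘ (d - ind A) := by
      ext i
      by_cases hi : i ∈ A
      · have := h1 i hi
        simp only [Function.comp, Pi.sub_apply, ind, if_pos hi]
        rw [if_pos (by push_cast at this; linarith)]; ring
      · have := h2 i hi
        simp only [Function.comp, Pi.sub_apply, ind, if_neg hi]
        rw [if_neg (by linarith)]; ring
    conv_lhs => rw [this]
    refine hf _ ?_ ?_ _
    · intro x y hxy
      dsimp only
      split_ifs <;> omega
    · intro x hx
      have := abs_le.mp hx
      rw [if_neg (by linarith)]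
  · rintro k d ⟨h1, h2⟩
    exact ⟨fun i hi => by have := h1 i hi; push_cast at this; linarith, h2⟩
  · rintro k d ⟨h1, h2⟩ B -
    refine ⟨fun i hi => ?_, fun i hi => ?_⟩
    · have := h1 i hi
      have := ind_le_one B i
      push_cast at *; simp only [Pi.sub_apply]; linarith
    · have := h2 i hi
      have := ind_nonneg B i
      simp only [Pi.sub_apply]; linarith
  · have := h1 i hi
    have hT : T.card ≤ S.powerset.card :=
      (Finset.card_le_card (Finset.erase_subset _ _)).trans
        (Finset.card_le_card (Finset.erase_subset _ _))
    have : (T.card : ℤ) ≤ S.powerset.card := by exact_mod_cast hT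
    linarith

/-- Mirror image of the previous argument: here subtracting the indicator vector moves the low
cluster away from the rest, so the relabelling is applied to `d` itself. -/
theorem act_killer_eq_zero_of_gap_below (hf : OrderInvariant m f) {A : Finset ι} (hA : A ⊆ S)
    (hne : A ≠ ∅) {θ : ℤ} (hθ : θ < -m) {d : ι → ℤ}
    (h1 : ∀ i ∈ A, d i ≤ θ) (h2 : ∀ i ∉ A, θ + (S.powerset.card : ℤ) < d i) :
    act (killer R S) f d = 0 := by
  rw [killer_eq_mul hA hne, act_mul]
  set T := (S.powerset.erase ∅).erase A
  refine act_prod_eq_zero T _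
    (fun k => {d | (∀ i ∈ A, d i ≤ θ) ∧ ∀ i ∉ A, θ + k < d i}) ?_ ?_ ?_ d ⟨h1, fun i hi => ?_⟩
  · rintro d ⟨h1, h2⟩
    rw [act_one_sub_single, sub_eq_zero]
    have : d - ind A = (fun x => if x ≤ θ then x - 1 else x) ∘ d := by
      ext i
      by_cases hi : i ∈ A
      · have := h1 i hi
        simp only [Function.comp, Pi.sub_apply, ind, if_pos hi]
        rw [if_pos this]
      · have := h2 i hi
        simp only [Function.comp, Pi.sub_apply, ind, if_neg hi]
        rw [if_neg (by push_cast at this; linarith)]; ring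
    rw [this]
    refine (hf _ ?_ ?_ _).symm
    · intro x y hxy
      dsimp only
      split_ifs <;> omega
    · intro x hx
      have := abs_le.mp hx
      rw [if_neg (by linarith)]
  · rintro k d ⟨h1, h2⟩
    exact ⟨h1, fun i hi => by have := h2 i hi; push_cast at this; linarith⟩
  · rintro k d ⟨h1, h2⟩ B -
    refine ⟨fun i hi => ?_, fun i hi => ?_⟩
    · have := h1 i hi
      have := ind_nonneg B i
      simp only [Pi.sub_apply]; linarith
    · have := h2 i hi
      have := ind_le_one B i
      push_cast at *; simp only [Pi.sub_apply]; linarith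
  · have := h2 i hi
    have hT : T.card ≤ S.powerset.card :=
      (Finset.card_le_card (Finset.erase_subset _ _)).trans
        (Finset.card_le_card (Finset.erase_subset _ _))
    have : (T.card : ℤ) ≤ S.powerset.card := by exact_mod_cast hT
    linarith

/-- No factor of the product moves a coordinate outside `S`, so a nonzero coordinate there stays
nonzero. -/
theorem act_killer_eq_zero_of_pinned (hS : ∀ d, f d ≠ 0 → ∀ i ∉ S, d i = 0) {d : ι → ℤ} {i : ι}
    (hi : i ∉ S) (hd : d i ≠ 0) : act (killer R S) f d = 0 := by
  refine act_prod_eq_zero _ _ (fun _ => {d | d i ≠ 0}) ?_ (fun _ _ h => h) ?_ d hd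
  · intro d hd
    by_contra h
    exact hd (hS d h i hi)
  · intro k d hd B hB
    have : i ∉ B := fun h => hi (Finset.mem_powerset.mp (Finset.mem_of_mem_erase hB) h)
    simpa [ind, this] using hd

/-- Among `card ι + 1` disjoint windows of integers, one contains no coordinate. -/
theorem exists_free_window [Fintype ι] (d : ι → ℤ) (a G : ℤ) :
    ∃ j : ℕ, j ≤ Fintype.card ι ∧ ∀ i, ¬ (a + j * G ≤ d i ∧ d i < a + j * G + G) := by
  by_contra hcon
  push Not at hcon
  choose p hp using fun j : Fin (Fintype.card ι + 1) => hcon j (by omega)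
  obtain ⟨x, y, hxy, he⟩ := Fintype.exists_ne_map_eq_of_card_lt p (by simp)
  wlog hlt : x < y generalizing x y
  · exact this y x hxy.symm he.symm (lt_of_le_of_ne (not_lt.mp hlt) hxy.symm)
  have h1 := hp x
  have h2 := hp y
  rw [← he] at h2
  have h3 : ((x : ℕ) : ℤ) + 1 ≤ ((y : ℕ) : ℤ) := by exact_mod_cast hlt
  have hG : 0 < G := by linarith
  nlinarith

/-- A point with a far coordinate has, by the pigeonhole principle, a window free of coordinates
between `[-m, m]` and that coordinate. The coordinates beyond the window form a cluster to which the
gap lemmas apply. -/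
theorem act_killer_finite [Fintype ι] (hm : 0 ≤ m) (hf : OrderInvariant m f)
    (hS : ∀ d, f d ≠ 0 → ∀ i ∉ S, d i = 0) : (act (killer R S) f).support.Finite := by
  set c : ℤ := (S.powerset.card : ℤ) with hc
  have hc0 : 0 ≤ c := by positivity
  set G : ℤ := c + 2 with hG
  -- Room for `card ι + 1` consecutive windows of width `G` above `m`. The width exceeds the gap
  -- required for the remaining factors.
  set L : ℤ := m + 1 + (Fintype.card ι) * G + G with hL
  refine (Set.finite_Icc (fun _ : ι => -L) (fun _ => L)).subset fun d hd => ?_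
  by_contra hcon
  have hpin : ∀ i ∉ S, d i = 0 := fun i hi => by
    by_contra h
    exact hd (act_killer_eq_zero_of_pinned hS hi h)
  have : ∃ i, L < d i ∨ d i < -L := by
    by_contra h
    push Not at h
    exact hcon ⟨fun i => (h i).2, fun i => (h i).1⟩
  obtain ⟨i, hi | hi⟩ := this
  · obtain ⟨j, hj, hw⟩ := exists_free_window d (m + 1) G
    have hjG : (j : ℤ) * G ≤ Fintype.card ι * G :=
      mul_le_mul_of_nonneg_right (by exact_mod_cast hj) (by linarith)
    have hj0 : 0 ≤ (j : ℤ) * G := by positivity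
    refine hd (act_killer_eq_zero_of_gap_above (A := Finset.univ.filter
      fun p => m + 1 + j * G + G ≤ d p) (θ := m + 1 + j * G) hf ?_ ?_ (by linarith) ?_ ?_)
    · intro p hp
      rw [Finset.mem_filter] at hp
      by_contra h
      have := hpin p h
      linarith [hp.2]
    · exact Finset.ne_empty_of_mem (a := i) (by simp; linarith)
    · intro p hp
      rw [Finset.mem_filter] at hp
      linarith [hp.2]
    · intro p hp
      simp only [Finset.mem_filter, Finset.mem_univ, true_and, not_le] at hp
      by_contra h
      exact hw p ⟨not_lt.mp h, hp⟩
  · obtain ⟨j, hj, hw⟩ := exists_free_window (fun p => - d p) (m + 1) G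
    have hjG : (j : ℤ) * G ≤ Fintype.card ι * G :=
      mul_le_mul_of_nonneg_right (by exact_mod_cast hj) (by linarith)
    have hj0 : 0 ≤ (j : ℤ) * G := by positivity
    refine hd (act_killer_eq_zero_of_gap_below (A := Finset.univ.filter
      fun p => d p ≤ -(m + 1 + j * G + G)) (θ := -(m + 1 + j * G + G)) hf ?_ ?_ (by linarith) ?_ ?_)
    · intro p hp
      rw [Finset.mem_filter] at hp
      by_contra h
      have := hpin p h
      linarith [hp.2]
    · exact Finset.ne_empty_of_mem (a := i) (by simp; linarith)
    · intro p hp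
      rw [Finset.mem_filter] at hp
      linarith [hp.2]
    · intro p hp
      simp only [Finset.mem_filter, Finset.mem_univ, true_and, not_le] at hp
      by_contra h
      exact hw p ⟨by linarith, by linarith⟩

end OrderInvariant

/-! ### Twisting by a character -/

section Twist

variable {R K : Type*} [CommRing R] [Field K] [Algebra R K] {M : Type*} [AddCommGroup M]

/-- The twist of an element of the group algebra by a character. -/
def twist (χ : Multiplicative M →* K) : AddMonoidAlgebra R M →ₐ[R] AddMonoidAlgebra K M :=
  AddMonoidAlgebra.lift R (AddMonoidAlgebra K M) M
    { toFun := fun m => AddMonoidAlgebra.single m.toAdd (χ m)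
      map_one' := by rw [map_one χ]; rfl
      map_mul' := fun x y => by
        rw [map_mul χ, AddMonoidAlgebra.single_mul_single, toAdd_mul] }

theorem twist_single (χ : Multiplicative M →* K) (m : M) (c : R) :
    twist χ (AddMonoidAlgebra.single m c) =
      AddMonoidAlgebra.single m (algebraMap R K c * χ (Multiplicative.ofAdd m)) := by
  simp [twist, Algebra.smul_def]

/-- A character is multiplicative, so twisting both the element and the function twists the result.
Finiteness shown for bare weights thus passes to weights times monomials. -/
theorem act_twist (χ : Multiplicative M →* K) (Q : AddMonoidAlgebra R M) (f : M → R) (a : M) :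
    act (twist χ Q) (fun b => algebraMap R K (f b) * χ (Multiplicative.ofAdd b)) a =
      algebraMap R K (act Q f a) * χ (Multiplicative.ofAdd a) := by
  induction Q using AddMonoidAlgebra.induction_linear with
  | zero => simp
  | add f g hf hg =>
    rw [map_add, act_add, act_add, Pi.add_apply, Pi.add_apply, hf, hg, map_add, add_mul]
  | single m c =>
    rw [twist_single, act_single, act_single, map_mul]
    have : χ (Multiplicative.ofAdd a) =
        χ (Multiplicative.ofAdd m) * χ (Multiplicative.ofAdd (a - m)) := by
      rw [← map_mul, ← ofAdd_add]; congr 2; abel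
    rw [this]; ring

theorem act_twist_finite {χ : Multiplicative M →* K} {Q : AddMonoidAlgebra R M} {f : M → R}
    (h : (act Q f).support.Finite) :
    (act (twist χ Q)
      (fun b => algebraMap R K (f b) * χ (Multiplicative.ofAdd b))).support.Finite := by
  refine h.subset fun a ha h0 => ha ?_
  rw [act_twist, h0, map_zero, zero_mul]

theorem eps_twist_killer {ι : Type*} [DecidableEq ι] (χ : Multiplicative (ι → ℤ) →* K)
    (S : Finset ι) : eps (twist χ (killer R S)) =
      ∏ A ∈ S.powerset.erase ∅, (1 - χ (Multiplicative.ofAdd (ind A))) := by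
  simp only [killer, map_prod]
  refine Finset.prod_congr rfl fun A _ => ?_
  rw [map_sub, map_one, twist_single, map_sub, map_one, eps_single]
  simp

/-- The augmentation of the twisted product is the specialized denominator, a product of the numbers
`1 - χ(e^A)`. -/
theorem eps_twist_killer_ne_zero {ι : Type*} [DecidableEq ι] {χ : Multiplicative (ι → ℤ) →* K}
    {S : Finset ι} (h : ∀ A ⊆ S, A ≠ ∅ → χ (Multiplicative.ofAdd (ind A)) ≠ 1) :
    eps (twist χ (killer R S)) ≠ 0 := by
  rw [eps_twist_killer]
  refine Finset.prod_ne_zero_iff.mpr fun A hA => sub_ne_zero.mpr (Ne.symm (h A ?_ ?_))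
  · exact Finset.mem_powerset.mp (Finset.mem_of_mem_erase hA)
  · exact Finset.ne_of_mem_erase hA

end Twist

end

end GTHL

namespace GTHL

noncomputable section

/-! ### Regularized sums over multisets of integers -/

section MultisetSums

variable {K : Type*} [Field K]

/-- The multiset of the entries of a vector. -/
def entries {k : ℕ} (z : Fin k → ℤ) : Multiset ℤ := Finset.univ.val.map z

theorem card_entries {k : ℕ} (z : Fin k → ℤ) : (entries z).card = k := by simp [entries]

theorem mem_entries {k : ℕ} {z : Fin k → ℤ} {e : ℤ} : e ∈ entries z ↔ ∃ i, z i = e := by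
  simp [entries]

open Classical in
/-- The regularized sum of `F` over the multisets of integers of cardinality `k`. -/
def MultisetSum (k : ℕ) (F : Multiset ℤ → K) (v : K) : Prop :=
  RSum (fun z : Fin k → ℤ => if Antitone z then F (entries z) else 0) v

/-- The regularized sum of `F` over all finite multisets of integers, only finitely many
cardinalities contributing. -/
def AllMultisetSum (F : Multiset ℤ → K) (v : K) : Prop :=
  ∃ V : ℕ →₀ K, (∀ k, MultisetSum k F (V k)) ∧ v = V.sum fun _ x => x

theorem MultisetSum.congr {k : ℕ} {F G : Multiset ℤ → K} {v : K} (h : MultisetSum k F v)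
    (hFG : ∀ z : Multiset ℤ, z.card = k → F z = G z) : MultisetSum k G v := by
  classical
  unfold MultisetSum at *
  convert h using 3 with z
  rw [hFG _ (card_entries z)]

theorem MultisetSum.unique {k : ℕ} {F : Multiset ℤ → K} {v w : K} (h : MultisetSum k F v)
    (h' : MultisetSum k F w) : v = w := RSum.unique h h'

theorem multisetSum_zero {k : ℕ} {F : Multiset ℤ → K} (h : ∀ z : Multiset ℤ, z.card = k → F z = 0) :
    MultisetSum k F 0 :=
  MultisetSum.congr (F := fun _ => 0) (by simpa [MultisetSum] using rsum_zero)
    fun z hz => (h z hz).symm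

theorem MultisetSum.smul {k : ℕ} {F : Multiset ℤ → K} {v : K} (h : MultisetSum k F v) (c : K) :
    MultisetSum k (fun z => c * F z) (c * v) := by
  classical
  have := RSum.smul h c
  unfold MultisetSum
  convert this using 3 with z
  rw [mul_ite, mul_zero]

theorem MultisetSum.add {k : ℕ} {F G : Multiset ℤ → K} {v w : K} (h : MultisetSum k F v)
    (h' : MultisetSum k G w) : MultisetSum k (fun z => F z + G z) (v + w) := by
  classical
  have := RSum.add h h'
  unfold MultisetSum
  convert this using 2 with z
  simp only [Pi.add_apply]
  split_ifs <;> simp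

theorem AllMultisetSum.add {F G : Multiset ℤ → K} {v w : K} (h : AllMultisetSum F v)
    (h' : AllMultisetSum G w) : AllMultisetSum (fun z => F z + G z) (v + w) := by
  obtain ⟨V, hV, rfl⟩ := h
  obtain ⟨W, hW, rfl⟩ := h'
  refine ⟨V + W, fun k => (hV k).add (hW k), ?_⟩
  rw [Finsupp.sum_add_index] <;> simp

theorem AllMultisetSum.smul {F : Multiset ℤ → K} {v : K} (h : AllMultisetSum F v) (c : K) :
    AllMultisetSum (fun z => c * F z) (c * v) := by
  obtain ⟨V, hV, rfl⟩ := h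
  refine ⟨c • V, fun k => (hV k).smul c, ?_⟩
  rw [Finsupp.sum_smul_index (by simp), Finsupp.mul_sum]

theorem AllMultisetSum.congr {F G : Multiset ℤ → K} {v : K} (h : AllMultisetSum F v)
    (hFG : ∀ z, F z = G z) : AllMultisetSum G v := by
  rwa [← funext hFG]

theorem allMultisetSum_zero : AllMultisetSum (fun _ => (0 : K)) 0 :=
  ⟨0, fun _ => multisetSum_zero fun _ _ => rfl, by simp⟩

theorem AllMultisetSum.sum {α : Type*} (s : Finset α) {F : α → Multiset ℤ → K} {v : α → K}
    (h : ∀ i ∈ s, AllMultisetSum (F i) (v i)) :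
    AllMultisetSum (fun z => ∑ i ∈ s, F i z) (∑ i ∈ s, v i) := by
  classical
  induction s using Finset.induction_on with
  | empty => simpa using allMultisetSum_zero
  | insert i s hi ih =>
    simp only [Finset.sum_insert hi]
    exact (h i (Finset.mem_insert_self _ _)).add
      (ih fun j hj => h j (Finset.mem_insert_of_mem hj))

theorem MultisetSum.all {k : ℕ} {F : Multiset ℤ → K} {v : K} (h : MultisetSum k F v)
    (h0 : ∀ z : Multiset ℤ, z.card ≠ k → F z = 0) : AllMultisetSum F v := by
  classical
  refine ⟨Finsupp.single k v, fun k' => ?_, by simp⟩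
  by_cases hk : k' = k
  · subst hk; simpa using h
  · rw [Finsupp.single_eq_of_ne hk]
    exact multisetSum_zero fun z hz => h0 z (by omega)

theorem AllMultisetSum.fixed {k : ℕ} {F : Multiset ℤ → K} {v : K} (h : AllMultisetSum F v)
    (h0 : ∀ z : Multiset ℤ, z.card ≠ k → F z = 0) : MultisetSum k F v := by
  obtain ⟨V, hV, rfl⟩ := h
  have : ∀ k', k' ≠ k → V k' = 0 := fun k' hk =>
    (hV k').unique (multisetSum_zero fun z hz => h0 z (by omega))
  have e : (V.sum fun _ x => x) = V k := by
    rw [Finsupp.sum, Finset.sum_eq_single k (fun b _ hb => this b hb)]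
    intro hk; simpa using hk
  rw [e]; exact hV k

/-- Sorting gives the only weakly decreasing vector with a given multiset of entries, so the sum has
one term. -/
theorem multisetSum_singleton (m : Multiset ℤ) (c : K) :
    MultisetSum m.card (fun z => if z = m then c else 0) c := by
  classical
  obtain ⟨l, rfl⟩ : ∃ l : List ℤ, (l : Multiset ℤ) = m := ⟨_, Quotient.out_eq m⟩
  set l' := (l : Multiset ℤ).sort (· ≥ ·) with hl'
  have hlen : l'.length = Multiset.card (l : Multiset ℤ) := by simp [hl']
  have hs : l'.Pairwise (· ≥ ·) := Multiset.pairwise_sort _ _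
  set z₀ : Fin (Multiset.card (l : Multiset ℤ)) → ℤ := fun i => l'.get (Fin.cast hlen.symm i)
  have hanti : Antitone z₀ := by
    intro i j hij
    rcases hij.eq_or_lt with rfl | hlt
    · exact le_rfl
    · exact List.pairwise_iff_get.mp hs _ _ (Fin.lt_def.mpr hlt)
  have key : ∀ z : Fin (Multiset.card (l : Multiset ℤ)) → ℤ,
      (Antitone z ∧ entries z = (l : Multiset ℤ)) ↔ z = z₀ := by
    intro z
    have hez : entries z = (List.ofFn z : Multiset ℤ) := by
      rw [entries, Fin.univ_val_map]
    have hez₀ : List.ofFn z₀ = l' := by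
      have h1 : z₀ = (fun i : Fin l'.length => l'.get i) ∘ Fin.cast hlen.symm := rfl
      rw [h1]
      apply List.ext_get
      · simp [hlen]
      · intro n h1 h2
        simp only [List.get_ofFn]
        rfl
    constructor
    · rintro ⟨h1, h2⟩
      apply List.ofFn_injective
      rw [hez₀]
      have hp : (List.ofFn z).Perm l' := by
        rw [← Multiset.coe_eq_coe, ← hez, h2, hl', Multiset.sort_eq]
      refine hp.eq_of_pairwise' (r := (· ≥ ·)) ?_ hs
      rw [List.pairwise_ofFn]
      exact fun i j hij => h1 hij.le
    · rintro rfl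
      refine ⟨hanti, ?_⟩
      have hez0 : entries z₀ = (List.ofFn z₀ : Multiset ℤ) := by
        rw [entries, Fin.univ_val_map]
      rw [hez0, hez₀, hl', Multiset.sort_eq]
  unfold MultisetSum
  have := rsum_single z₀ c
  convert this using 2 with z
  by_cases hz : z = z₀
  · have h := (key z).mpr hz
    rw [if_pos h.1, if_pos hz]
    exact if_pos h.2
  · rw [if_neg hz]
    by_cases h1 : Antitone z
    · rw [if_pos h1]
      exact if_neg fun h2 => hz ((key z).mp ⟨h1, h2⟩)
    · exact if_neg h1

theorem entries_append {r k : ℕ} (u : Fin r → ℤ) (z : Fin k → ℤ) :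
    entries (Fin.append u z) = entries u + entries z := by
  simp only [entries, Fin.univ_val_map]
  rw [List.ofFn_fin_append, Multiset.coe_add]

theorem antitone_append_iff {r k : ℕ} {u : Fin r → ℤ} {z : Fin k → ℤ} :
    Antitone (Fin.append u z) ↔ Antitone u ∧ Antitone z ∧ ∀ i j, z j ≤ u i := by
  constructor
  · intro h
    refine ⟨fun i j hij => ?_, fun i j hij => ?_, fun i j => ?_⟩
    · have := h (a := Fin.castAdd k i) (b := Fin.castAdd k j) (Fin.le_def.mpr hij)
      simpa using this
    · have := h (a := Fin.natAdd r i) (b := Fin.natAdd r j) (by simpa using hij)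
      simpa using this
    · have := h (a := Fin.castAdd k i) (b := Fin.natAdd r j) (Fin.le_def.mpr (by simp; omega))
      simpa using this
  · rintro ⟨h1, h2, h3⟩ i j hij
    induction i using Fin.addCases with
    | left i =>
      induction j using Fin.addCases with
      | left j => simpa using h1 (Fin.le_def.mpr (Fin.le_def.mp hij))
      | right j => simpa using h3 i j
    | right i =>
      induction j using Fin.addCases with
      | left j =>
        exfalso
        have := Fin.le_def.mp hij
        simp at this
        omega
      | right j => simpa using h2 (by simpa using hij)

/-- Concatenation of vectors as an additive equivalence. -/
def appendAddEquiv (r k : ℕ) : (Fin r → ℤ) × (Fin k → ℤ) ≃+ (Fin (r + k) → ℤ) :=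
  { Fin.appendEquiv r k with
    map_add' := fun p q => by
      ext i
      induction i using Fin.addCases with
      | left i => simp [Fin.appendEquiv]
      | right i => simp [Fin.appendEquiv] }

theorem appendAddEquiv_apply (r k : ℕ) (p : (Fin r → ℤ) × (Fin k → ℤ)) :
    appendAddEquiv r k p = Fin.append p.1 p.2 := rfl

open Classical in
/-- Regularized sums factor when the entries above and below a threshold are independent. -/
theorem AllMultisetSum.split {j : ℤ} {r : ℕ} {G H : Multiset ℤ → K} {g h : K}
    (hG0 : ∀ u : Multiset ℤ, u.card ≠ r → G u = 0)
    (hG : MultisetSum r (fun u => if ∀ e ∈ u, j ≤ e then G u else 0) g)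
    (hH : AllMultisetSum (fun z => if ∀ e ∈ z, e < j then H z else 0) h) :
    AllMultisetSum (fun z => G (z.filter (j ≤ ·)) * H (z.filter (· < j))) (g * h) := by
  obtain ⟨V, hV, rfl⟩ := hH
  refine ⟨(g • V).mapDomain (r + ·), fun k => ?_, ?_⟩
  · by_cases hk : r ≤ k
    · obtain ⟨k, rfl⟩ := Nat.exists_eq_add_of_le hk
      rw [Finsupp.mapDomain_apply (add_right_injective r), Finsupp.smul_apply, smul_eq_mul]
      have := RSum.prod hG (hV k)
      unfold MultisetSum
      rw [← rsum_equiv_iff (appendAddEquiv r k)]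
      convert this using 2 with p
      obtain ⟨u, z⟩ := p
      simp only [Function.comp, appendAddEquiv_apply, antitone_append_iff, entries_append,
        Multiset.filter_add]
      by_cases hu : Antitone u
      swap
      · simp [hu]
      by_cases hz : Antitone z
      swap
      · simp [hz]
      simp only [hu, hz, true_and, if_true]
      by_cases h1 : ∀ e ∈ entries u, j ≤ e
      · by_cases h2 : ∀ e ∈ entries z, e < j
        · have h3 : ∀ i j, z j ≤ u i := fun i i' =>
            ((h2 _ (mem_entries.mpr ⟨i', rfl⟩)).trans_le (h1 _ (mem_entries.mpr ⟨i, rfl⟩))).le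
          rw [if_pos h3, if_pos h1, if_pos h2, Multiset.filter_eq_self.mpr h1,
            Multiset.filter_eq_self.mpr h2, Multiset.filter_eq_nil.mpr, Multiset.filter_eq_nil.mpr]
          · simp
          · exact fun e he => not_lt.mpr (h1 e he)
          · exact fun e he => not_le.mpr (h2 e he)
        -- An entry of `z` at or above `j` joins the `r` entries of `u`, so the upper part is too
        -- large and `G` vanishes.
        · rw [if_neg h2, mul_zero, ite_eq_right_iff]
          intro _
          rw [hG0, zero_mul]
          rw [Multiset.card_add, Multiset.filter_eq_self.mpr h1, card_entries]
          push Not at h2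
          obtain ⟨e, he, hje⟩ := h2
          have : 0 < (Multiset.filter (j ≤ ·) (entries z)).card :=
            Multiset.card_pos_iff_exists_mem.mpr ⟨e, Multiset.mem_filter.mpr ⟨he, hje⟩⟩
          omega
      -- If an entry of `u` is below `j`, all of `z` lies below `j` too, and the upper part has
      -- fewer than `r` elements.
      · rw [if_neg h1, zero_mul, ite_eq_right_iff]
        intro h3
        rw [hG0, zero_mul]
        push Not at h1
        obtain ⟨e, he, hje⟩ := h1
        obtain ⟨i, rfl⟩ := mem_entries.mp he
        rw [Multiset.card_add, (Multiset.filter_eq_nil (s := entries z)).mpr]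
        · have h4 : (Multiset.filter (j ≤ ·) (entries u)).card < (entries u).card := by
            rw [← Multiset.countP_eq_card_filter]
            refine lt_of_le_of_ne (Multiset.countP_le_card _ _) fun h => ?_
            exact not_le.mpr hje (Multiset.countP_eq_card.mp h _ he)
          rw [card_entries] at h4
          simp; omega
        · intro e he
          obtain ⟨i', rfl⟩ := mem_entries.mp he
          exact not_le.mpr ((h3 i i').trans_lt hje)
    · rw [Finsupp.mapDomain_of_notMem_range]
      · refine multisetSum_zero fun z hz => ?_
        rw [hG0, zero_mul]
        have := Multiset.card_le_card (Multiset.filter_le (j ≤ ·) z)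
        omega
      · rintro ⟨k', hk'⟩; simp at hk'; omega
  · rw [Finsupp.sum_mapDomain_index (by simp) (by simp), Finsupp.sum_smul_index (by simp),
      Finsupp.mul_sum]

open Classical in
/-- Decomposition of a regularized sum according to the multiplicity of the largest entry. -/
theorem AllMultisetSum.peel {j : ℤ} {F : Multiset ℤ → K} (s : Finset ℕ) {V : ℕ → K}
    (hF : ∀ z, (∃ e ∈ z, j < e) → F z = 0) (hs : ∀ z : Multiset ℤ, z.count j ∉ s → F z = 0)
    (h : ∀ r ∈ s, AllMultisetSum
      (fun z => if ∀ e ∈ z, e < j then F (Multiset.replicate r j + z) else 0) (V r)) :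
    AllMultisetSum F (∑ r ∈ s, V r) := by
  have h1 : ∀ r ∈ s, AllMultisetSum (fun z : Multiset ℤ =>
      (if z.filter (j ≤ ·) = Multiset.replicate r j then (1 : K) else 0) *
        F (Multiset.replicate r j + z.filter (· < j))) (1 * V r) := by
    intro r hr
    -- The part at or above `j` is forced to be `r` copies of `j`; its sum is the one-term sum 1.
    refine AllMultisetSum.split (r := r) (G := fun u => if u = Multiset.replicate r j then 1 else 0)
      (H := fun z => F (Multiset.replicate r j + z)) ?_ ?_ (h r hr)
    · intro u hu
      refine if_neg fun h => hu ?_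
      rw [h, Multiset.card_replicate]
    · have := multisetSum_singleton (Multiset.replicate r j) (1 : K)
      rw [Multiset.card_replicate] at this
      refine this.congr fun z _ => ?_
      by_cases hz : z = Multiset.replicate r j
      · have : ∀ e ∈ z, j ≤ e := fun e he => by
          rw [hz] at he; exact (Multiset.eq_of_mem_replicate he).ge
        rw [if_pos this]
      · simp [hz]
  have h2 := AllMultisetSum.sum s h1
  simp only [one_mul] at h2
  refine h2.congr fun z => ?_
  by_cases hz : ∃ e ∈ z, j < e
  · rw [hF z hz]
    obtain ⟨e, he, hje⟩ := hz
    refine Finset.sum_eq_zero fun r _ => ?_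
    rw [if_neg, zero_mul]
    intro h
    have : e ∈ Multiset.replicate r j := by
      rw [← h]; exact Multiset.mem_filter.mpr ⟨he, hje.le⟩
    exact hje.ne' (Multiset.eq_of_mem_replicate this)
  · push Not at hz
    have e1 : z.filter (j ≤ ·) = Multiset.replicate (z.count j) j := by
      rw [Multiset.eq_replicate, ← Multiset.countP_eq_card_filter]
      refine ⟨?_, fun b hb => ?_⟩
      · rw [Multiset.count]
        exact Multiset.countP_congr rfl fun x hx => by
          have := hz x hx
          exact propext ⟨fun h => le_antisymm h this, fun h => h.le⟩
      · rw [Multiset.mem_filter] at hb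
        exact le_antisymm (hz b hb.1) hb.2
    have e2 : Multiset.replicate (z.count j) j + z.filter (· < j) = z := by
      rw [← e1]
      conv_rhs => rw [← Multiset.filter_add_not (j ≤ ·) z]
      simp
    have e3 : ∀ r, (Multiset.replicate (z.count j) j = Multiset.replicate r j) ↔ z.count j = r := by
      intro r
      refine ⟨fun h => ?_, fun h => by rw [h]⟩
      simpa using congrArg Multiset.card h
    simp only [e1, e3, ite_mul, one_mul, zero_mul]
    rw [Finset.sum_ite_eq]
    split_ifs with hc
    · rw [e2]
    · exact (hs z hc).symm

/-! #### Geometric sums -/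

/-- The element `1 - q e^1` telescopes the series to its first term. -/
theorem rsum_geometric_ge {q : K} (hq0 : q ≠ 0) (hq : q ≠ 1) (J : ℤ) :
    RSum (fun i : ℤ => if J ≤ i then q ^ i else 0) (q ^ J / (1 - q)) := by
  have h : act ((1 : AddMonoidAlgebra K ℤ) - AddMonoidAlgebra.single 1 q)
      (fun i : ℤ => if J ≤ i then q ^ i else 0) = fun i => if i = J then q ^ J else 0 := by
    have : act ((1 : AddMonoidAlgebra K ℤ) - AddMonoidAlgebra.single 1 q)
        (fun i : ℤ => if J ≤ i then q ^ i else 0) =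
        (fun i : ℤ => if J ≤ i then q ^ i else 0) - act (AddMonoidAlgebra.single 1 q)
        (fun i : ℤ => if J ≤ i then q ^ i else 0) := by
      rw [map_sub, map_one]; rfl
    rw [this]
    ext i
    rw [Pi.sub_apply, act_single]
    rcases lt_trichotomy i J with hi | hi | hi
    · rw [if_neg (by omega), if_neg (by omega), if_neg (by omega)]; simp
    · subst hi; simp
    · rw [if_pos (by omega), if_pos (by omega), if_neg (by omega), zpow_sub_one₀ hq0]
      field_simp; ring
  have h1 := rsum_single J (q ^ J)
  have hs : (Function.support fun i => if i = J then q ^ J else 0).Finite :=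
    (Set.finite_singleton J).subset fun a ha => by by_contra h; exact ha (if_neg h)
  refine ⟨1 - AddMonoidAlgebra.single 1 q, ?_, ?_, ?_⟩
  · rw [map_sub, map_one, eps_single]; exact sub_ne_zero.mpr hq.symm
  · rw [h]; exact hs
  · rw [h, map_sub, map_one, eps_single, mul_div_cancel₀ _ (sub_ne_zero.mpr hq.symm)]
    exact (rsum_of_finite hs).unique h1

/-- Here `1 - q e^1` telescopes everything to 0. This is the source of the vanishing of
contributions. -/
theorem rsum_geometric_all {q : K} (hq0 : q ≠ 0) (hq : q ≠ 1) :
    RSum (fun i : ℤ => q ^ i) 0 := by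
  have h : act ((1 : AddMonoidAlgebra K ℤ) - AddMonoidAlgebra.single 1 q)
      (fun i : ℤ => q ^ i) = fun i => 0 := by
    have : act ((1 : AddMonoidAlgebra K ℤ) - AddMonoidAlgebra.single 1 q)
        (fun i : ℤ => q ^ i) =
        (fun i : ℤ => q ^ i) - act (AddMonoidAlgebra.single 1 q) (fun i : ℤ => q ^ i) := by
      rw [map_sub, map_one]; rfl
    rw [this]
    ext i
    rw [Pi.sub_apply, act_single, zpow_sub_one₀ hq0]
    field_simp; ring
  refine ⟨1 - AddMonoidAlgebra.single 1 q, ?_, ?_, ?_⟩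
  · rw [map_sub, map_one, eps_single]; exact sub_ne_zero.mpr hq.symm
  · rw [h]; simp
  · rw [h]; simp

theorem rsum_geometric_lt {q : K} (hq0 : q ≠ 0) (hq : q ≠ 1) (J : ℤ) :
    RSum (fun i : ℤ => if i < J then q ^ i else 0) (q ^ J / (q - 1)) := by
  have h := (rsum_geometric_all hq0 hq).add ((rsum_geometric_ge hq0 hq J).smul (-1))
  convert h using 1
  · ext i
    simp only [Pi.add_apply]
    by_cases hi : i < J
    · rw [if_pos hi, if_neg (by omega)]; ring
    · rw [if_neg hi, if_pos (by omega)]; ring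
  · rw [← neg_sub q 1, div_neg]; ring

theorem multisetSum_one {F : Multiset ℤ → K} {v : K} (h : RSum (fun i : ℤ => F {i}) v) :
    MultisetSum 1 F v := by
  classical
  unfold MultisetSum
  rw [← rsum_equiv_iff (AddEquiv.funUnique (Fin 1) ℤ).symm]
  convert h using 2 with i
  have : Antitone ((AddEquiv.funUnique (Fin 1) ℤ).symm i) := fun a b _ => by simp
  rw [Function.comp, if_pos this]
  simp [entries]

end MultisetSums

end

end GTHL

namespace GTHL

noncomputable section

/-! ### The weights of interlacing multisets -/

section Weights

variable {R : Type*} [CommRing R]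

/-- The number of elements of `z` that are at least `x`. -/
def countGE (z : Multiset ℤ) (x : ℤ) : ℕ := z.countP (x ≤ ·)

/-- The weight of a number occurring `m` times in a row and `r` times in the next one. -/
def siteWeight (t : R) (m r : ℕ) : R := if r = m + 1 then 1 - t ^ r else 1

/-- Interlacing of consecutive rows; `o = 1` if the lower row has an additional element at the
left. -/
def Interlace (o : ℕ) (y z : Multiset ℤ) : Prop :=
  ∀ x, countGE z x ≤ countGE y x + o ∧ countGE y x + o ≤ countGE z x + 1

open Classical in
/-- The weight of a pair of consecutive rows. -/
def rowWeight (t : R) (o : ℕ) (y z : Multiset ℤ) : R :=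
  if Interlace o y z then ∏ x ∈ z.toFinset, siteWeight t (y.count x) (z.count x) else 0

theorem countGE_add (y z : Multiset ℤ) (x : ℤ) : countGE (y + z) x = countGE y x + countGE z x :=
  Multiset.countP_add _ _ _

theorem countGE_eq_zero {z : Multiset ℤ} {x : ℤ} (h : ∀ e ∈ z, e < x) : countGE z x = 0 :=
  Multiset.countP_eq_zero.mpr fun e he => not_le.mpr (h e he)

theorem countGE_eq_card {z : Multiset ℤ} {x : ℤ} (h : ∀ e ∈ z, x ≤ e) : countGE z x = z.card :=
  Multiset.countP_eq_card.mpr h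

theorem countGE_replicate (m : ℕ) (j x : ℤ) :
    countGE (Multiset.replicate m j) x = if x ≤ j then m else 0 := by
  split_ifs with h
  · rw [countGE_eq_card, Multiset.card_replicate]
    exact fun e he => (Multiset.eq_of_mem_replicate he) ▸ h
  · exact countGE_eq_zero fun e he => by rw [Multiset.eq_of_mem_replicate he]; omega

theorem countGE_le_card (z : Multiset ℤ) (x : ℤ) : countGE z x ≤ z.card :=
  Multiset.countP_le_card _ _

theorem exists_lt_forall_mem (z : Multiset ℤ) : ∃ B : ℤ, ∀ e ∈ z, e < B := by
  induction z using Multiset.induction_on with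
  | empty => exact ⟨0, by simp⟩
  | cons a s ih =>
    obtain ⟨B, hB⟩ := ih
    refine ⟨max B (a + 1), fun e he => ?_⟩
    rcases Multiset.mem_cons.mp he with rfl | he
    · exact lt_max_of_lt_right (by omega)
    · exact lt_max_of_lt_left (hB e he)

theorem exists_le_forall_mem (z : Multiset ℤ) : ∃ B : ℤ, ∀ e ∈ z, B ≤ e := by
  obtain ⟨B, hB⟩ := exists_lt_forall_mem (z.map (- ·))
  refine ⟨-B, fun e he => ?_⟩
  have := hB (-e) (Multiset.mem_map_of_mem _ he)
  linarith

theorem Interlace.le_one {o : ℕ} {y z : Multiset ℤ} (h : Interlace o y z) : o ≤ 1 := by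
  obtain ⟨B, hB⟩ := exists_lt_forall_mem (y + z)
  have := (h B).2
  rw [countGE_eq_zero fun e he => hB e (Multiset.mem_add.mpr (Or.inl he)),
    countGE_eq_zero fun e he => hB e (Multiset.mem_add.mpr (Or.inr he))] at this
  omega

/-- Once the top value `j` with multiplicities `m` and `r` is removed, the counts differ by the new
offset `m + o - r`. The offset is thus the state of a scan from high to low values. -/
theorem interlace_replicate_add {o m r : ℕ} {j : ℤ} {y z : Multiset ℤ} (hy : ∀ e ∈ y, e < j)
    (hz : ∀ e ∈ z, e < j) :
    Interlace o (Multiset.replicate m j + y) (Multiset.replicate r j + z) ↔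
      o ≤ 1 ∧ r ≤ m + o ∧ Interlace (m + o - r) y z := by
  have hy0 : ∀ x, j ≤ x → countGE y x = 0 := fun x hx =>
    countGE_eq_zero fun e he => (hy e he).trans_le hx
  have hz0 : ∀ x, j ≤ x → countGE z x = 0 := fun x hx =>
    countGE_eq_zero fun e he => (hz e he).trans_le hx
  constructor
  · intro h
    have h1 := h.le_one
    have h2 := h j
    simp only [countGE_add, countGE_replicate, le_refl, if_true, hy0 j le_rfl, hz0 j le_rfl] at h2
    refine ⟨h1, by omega, fun x => ?_⟩
    by_cases hx : x ≤ j
    · have := h x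
      simp only [countGE_add, countGE_replicate, if_pos hx] at this
      omega
    · rw [hy0 x (by omega), hz0 x (by omega)]
      omega
  · rintro ⟨h1, h2, h3⟩ x
    simp only [countGE_add, countGE_replicate]
    split_ifs with hx
    · have := h3 x
      omega
    · rw [hy0 x (by omega), hz0 x (by omega)]
      omega

theorem siteWeight_zero (t : R) (m : ℕ) : siteWeight t m 0 = 1 := if_neg (by omega)

/-- Turns the row weight into a product over the integers scanned downwards: the value `j`
contributes its site weight and updates the offset. -/
theorem rowWeight_replicate_add (t : R) {o m r : ℕ} {j : ℤ} {y z : Multiset ℤ}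
    (hy : ∀ e ∈ y, e < j) (hz : ∀ e ∈ z, e < j) :
    rowWeight t o (Multiset.replicate m j + y) (Multiset.replicate r j + z) =
      if o ≤ 1 ∧ r ≤ m + o then siteWeight t m r * rowWeight t (m + o - r) y z else 0 := by
  have hyj : y.count j = 0 := Multiset.count_eq_zero.mpr fun h => lt_irrefl _ (hy j h)
  have hzj : z.count j = 0 := Multiset.count_eq_zero.mpr fun h => lt_irrefl _ (hz j h)
  have hprod : ∏ x ∈ (Multiset.replicate r j + z).toFinset,
      siteWeight t ((Multiset.replicate m j + y).count x) ((Multiset.replicate r j + z).count x) =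
      siteWeight t m r * ∏ x ∈ z.toFinset, siteWeight t (y.count x) (z.count x) := by
    have e1 : ∀ x ∈ z.toFinset,
        siteWeight t ((Multiset.replicate m j + y).count x)
          ((Multiset.replicate r j + z).count x) = siteWeight t (y.count x) (z.count x) := by
      intro x hx
      have : j ≠ x := (hz x (Multiset.mem_toFinset.mp hx)).ne'
      simp [Multiset.count_replicate, this]
    rcases Nat.eq_zero_or_pos r with rfl | hr
    · rw [siteWeight_zero, one_mul, Multiset.replicate_zero, zero_add]
      simp only [Multiset.replicate_zero, zero_add] at e1
      exact Finset.prod_congr rfl e1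
    · have : (Multiset.replicate r j + z).toFinset = insert j z.toFinset := by
        rw [Multiset.toFinset_add, Multiset.toFinset_replicate, if_neg (by omega)]; rfl
      rw [this, Finset.prod_insert (by simpa using fun h => lt_irrefl _ (hz j h)),
        Finset.prod_congr rfl e1]
      simp [hyj, hzj]
  unfold rowWeight
  rw [interlace_replicate_add hy hz, hprod]
  by_cases h1 : o ≤ 1 ∧ r ≤ m + o
  · by_cases h2 : Interlace (m + o - r) y z
    · rw [if_pos ⟨h1.1, h1.2, h2⟩, if_pos h1, if_pos h2]
    · rw [if_neg (fun h => h2 h.2.2), if_pos h1, if_neg h2, mul_zero]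
  · rw [if_neg (fun h => h1 ⟨h.1, h.2.1⟩), if_neg h1]

theorem rowWeight_zero_zero (t : R) {o : ℕ} (ho : o ≤ 1) : rowWeight t o 0 0 = 1 := by
  rw [rowWeight, if_pos]
  · simp
  · intro x; simp [countGE]; omega

end Weights

/-! ### Two consecutive rows -/

section TwoRows

variable {K : Type*} [Field K]

open Classical in
/-- The summand of the sum over the middle one of three consecutive rows. The rows are considered
below a threshold; `f` and `g` describe the state at the threshold, `f'` and `g'` the state at the
bottom. -/
def twoRow (t a b : K) (f g f' g' : ℕ) (y w z : Multiset ℤ) : K :=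
  if f + y.card = z.card + f' ∧ g + z.card = w.card + g' then
    rowWeight t f y z * rowWeight t g z w * (a ^ (y.sum - z.sum) * b ^ (z.sum - w.sum)) else 0

/-- The transfer matrix of a number occurring `m` times in the upper and `p` times in the lower
one of three consecutive rows. -/
def transfer (t : K) (m p f g f' g' : ℕ) : K :=
  if f' ≤ m + f ∧ g + (m + f - f') = g' + p then
    siteWeight t m (m + f - f') * siteWeight t (m + f - f') p else 0

/-- One step of the transfer matrix recursion. -/
def transferStep (t a b : K) (m p : ℕ) (U : ℕ → ℕ → K) (f g : ℕ) : K :=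
  a ^ f * b ^ g * ∑ f' ∈ Finset.range 2, ∑ g' ∈ Finset.range 2, transfer t m p f g f' g' * U f' g'

/-- The relation between the state vectors of the two orders of a pair of steps. -/
structure StateRel (t a b c : K) (U U' : ℕ → ℕ → K) : Prop where
  r00 : U 0 0 = c * ((b - t * a) * U' 0 0)
  r11 : U 1 1 = c * ((b - t * a) * U' 1 1)
  r01 : U 0 1 = c * ((1 - t) * b * U' 0 1 + (b - a) * U' 1 0)
  r10 : U 1 0 = c * (t * (b - a) * U' 0 1 + (1 - t) * a * U' 1 0)

theorem siteWeight_self (t : K) (m : ℕ) : siteWeight t m m = 1 := if_neg (by omega)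
theorem siteWeight_succ (t : K) (m : ℕ) : siteWeight t m (m + 1) = 1 - t ^ (m + 1) := if_pos rfl
theorem siteWeight_of_le (t : K) {m r : ℕ} (h : r ≤ m) : siteWeight t m r = 1 := if_neg (by omega)

theorem transfer_of (t : K) {m p f g f' g' r : ℕ} (h1 : r + f' = m + f) (h2 : g + r = g' + p) :
    transfer t m p f g f' g' = siteWeight t m r * siteWeight t r p := by
  have : m + f - f' = r := by omega
  rw [transfer, this, if_pos ⟨by omega, h2⟩]

theorem transfer_of_ne (t : K) {m p f g f' g' : ℕ} (h : f + g + m ≠ f' + g' + p) :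
    transfer t m p f g f' g' = 0 := if_neg (by omega)

/-- The Yang–Baxter equation. -/
theorem StateRel.step {t a b c : K} {U U' : ℕ → ℕ → K} (h : StateRel t a b c U U') (m p : ℕ) :
    StateRel t a b c (transferStep t a b m p U) (transferStep t b a m p U') := by
  obtain ⟨h00, h11, h01, h10⟩ := h
  -- Nonzero transfer entries satisfy `f + g + m = f' + g' + p` with all states in `{0, 1}`, so `p -
  -- m` lies between `-2` and `2`. In each case the few nonzero entries make the four relations
  -- polynomial identities.
  by_cases hp : p = m
  · subst hp
    have t00 : transfer t p p 0 0 0 0 = 1 := by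
      rw [transfer_of t (r := p) (by omega) (by omega), siteWeight_self, one_mul]
    have t11 : transfer t p p 1 1 1 1 = 1 := by
      rw [transfer_of t (r := p) (by omega) (by omega), siteWeight_self, one_mul]
    have t0101 : transfer t p p 0 1 0 1 = 1 := by
      rw [transfer_of t (r := p) (by omega) (by omega), siteWeight_self, one_mul]
    have t1010 : transfer t p p 1 0 1 0 = 1 := by
      rw [transfer_of t (r := p) (by omega) (by omega), siteWeight_self, one_mul]
    have t1001 : transfer t p p 1 0 0 1 = 1 - t ^ (p + 1) := by
      rw [transfer_of t (r := p + 1) (by omega) (by omega), siteWeight_succ,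
        siteWeight_of_le t (by omega), mul_one]
    -- The middle multiplicity would be `p - 1`. For `p = 0` there is none, and the formula still
    -- holds because `1 - t ^ 0 = 0`.
    have t0110 : transfer t p p 0 1 1 0 = 1 - t ^ p := by
      rcases p with _ | p
      · rw [transfer, if_neg (by omega)]; simp
      · rw [transfer_of t (r := p) (by omega) (by omega), siteWeight_succ,
          siteWeight_of_le t (by omega), one_mul]
    constructor <;>
    simp (discharger := omega) only [transferStep, Finset.sum_range_succ, Finset.sum_range_zero,
      t00, t11, t0101, t1010, t1001, t0110, transfer_of_ne, h00, h11, h01, h10] <;> ring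
  by_cases hp : m = p + 1
  · subst hp
    have t0001 : transfer t (p + 1) p 0 0 0 1 = 1 := by
      rw [transfer_of t (r := p + 1) (by omega) (by omega), siteWeight_self,
        siteWeight_of_le t (by omega), one_mul]
    have t0010 : transfer t (p + 1) p 0 0 1 0 = 1 := by
      rw [transfer_of t (r := p) (by omega) (by omega), siteWeight_self,
        siteWeight_of_le t (by omega), one_mul]
    have t0111 : transfer t (p + 1) p 0 1 1 1 = 1 := by
      rw [transfer_of t (r := p) (by omega) (by omega), siteWeight_self,
        siteWeight_of_le t (by omega), one_mul]
    have t1011 : transfer t (p + 1) p 1 0 1 1 = 1 := by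
      rw [transfer_of t (r := p + 1) (by omega) (by omega), siteWeight_self,
        siteWeight_of_le t (by omega), one_mul]
    constructor <;>
    simp (discharger := omega) only [transferStep, Finset.sum_range_succ, Finset.sum_range_zero,
      t0001, t0010, t0111, t1011, transfer_of_ne, h00, h11, h01, h10] <;> ring
  by_cases hp : p = m + 1
  · subst hp
    have t0100 : transfer t m (m + 1) 0 1 0 0 = 1 - t ^ (m + 1) := by
      rw [transfer_of t (r := m) (by omega) (by omega), siteWeight_self, siteWeight_succ, one_mul]
    have t1000 : transfer t m (m + 1) 1 0 0 0 = 1 - t ^ (m + 1) := by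
      rw [transfer_of t (r := m + 1) (by omega) (by omega), siteWeight_self, siteWeight_succ,
        mul_one]
    have t1101 : transfer t m (m + 1) 1 1 0 1 = 1 - t ^ (m + 1) := by
      rw [transfer_of t (r := m + 1) (by omega) (by omega), siteWeight_self, siteWeight_succ,
        mul_one]
    have t1110 : transfer t m (m + 1) 1 1 1 0 = 1 - t ^ (m + 1) := by
      rw [transfer_of t (r := m) (by omega) (by omega), siteWeight_self, siteWeight_succ, one_mul]
    constructor <;>
    simp (discharger := omega) only [transferStep, Finset.sum_range_succ, Finset.sum_range_zero,
      t0100, t1000, t1101, t1110, transfer_of_ne, h00, h11, h01, h10] <;> ring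
  by_cases hp : m = p + 2
  · subst hp
    have t0011 : transfer t (p + 2) p 0 0 1 1 = 1 := by
      rw [transfer_of t (r := p + 1) (by omega) (by omega), siteWeight_of_le t (by omega),
        siteWeight_of_le t (by omega), one_mul]
    constructor <;>
    simp (discharger := omega) only [transferStep, Finset.sum_range_succ, Finset.sum_range_zero,
      t0011, transfer_of_ne, h00, h11, h01, h10] <;> ring
  by_cases hp : p = m + 2
  · subst hp
    have t1100 : transfer t m (m + 2) 1 1 0 0 = (1 - t ^ (m + 1)) * (1 - t ^ (m + 2)) := by
      rw [transfer_of t (r := m + 1) (by omega) (by omega), siteWeight_succ, siteWeight_succ]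
    constructor <;>
    simp (discharger := omega) only [transferStep, Finset.sum_range_succ, Finset.sum_range_zero,
      t1100, transfer_of_ne, h00, h11, h01, h10] <;> ring
  constructor <;>
  simp (discharger := omega) only [transferStep, Finset.sum_range_succ, Finset.sum_range_zero,
    transfer_of_ne] <;> ring

end TwoRows

end

end GTHL

namespace GTHL

noncomputable section

/-! ### Exchanging two consecutive steps -/

section Exchange

variable {K : Type*} [Field K]

theorem filter_lt_succ (y : Multiset ℤ) (j : ℤ) :
    y.filter (· < j + 1) = Multiset.replicate (y.count j) j + y.filter (· < j) := by
  ext x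
  rw [Multiset.count_add, Multiset.count_replicate, Multiset.count_filter, Multiset.count_filter]
  rcases lt_trichotomy x j with h | h | h
  · rw [if_pos (by omega), if_neg (by omega), if_pos h, zero_add]
  · subst h; simp
  · rw [if_neg (by omega), if_neg (by omega), if_neg (by omega)]

theorem rowWeight_of_one_lt (t : K) {o : ℕ} (ho : 1 < o) (y z : Multiset ℤ) :
    rowWeight t o y z = 0 := if_neg fun h => absurd h.le_one (by omega)

theorem twoRow_of_one_lt (t a b : K) {f g f' g' : ℕ} (h : 1 < f ∨ 1 < g) (y w z : Multiset ℤ) :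
    twoRow t a b f g f' g' y w z = 0 := by
  unfold twoRow
  split_ifs
  · rcases h with h | h <;> simp [rowWeight_of_one_lt t h]
  · rfl

/-- Peeling the value `j` off all three rows changes the state `(f, g)` to `(m + f - r, r + g - p)`;
the bottom state is untouched. -/
theorem twoRow_replicate_add (t : K) {a b : K} (ha : a ≠ 0) (hb : b ≠ 0) {f g f' g' m p r : ℕ}
    {j : ℤ} {y w z : Multiset ℤ} (hy : ∀ e ∈ y, e < j) (hw : ∀ e ∈ w, e < j)
    (hz : ∀ e ∈ z, e < j) :
    twoRow t a b f g f' g' (Multiset.replicate m j + y) (Multiset.replicate p j + w)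
      (Multiset.replicate r j + z) =
    if (f ≤ 1 ∧ r ≤ m + f) ∧ g ≤ 1 ∧ p ≤ r + g then
      siteWeight t m r * siteWeight t r p * (a ^ (j * (m - r)) * b ^ (j * (r - p))) *
        twoRow t a b (m + f - r) (r + g - p) f' g' y w z else 0 := by
  unfold twoRow
  rw [rowWeight_replicate_add t hy hz, rowWeight_replicate_add t hz hw]
  by_cases h1 : (f ≤ 1 ∧ r ≤ m + f) ∧ g ≤ 1 ∧ p ≤ r + g
  · obtain ⟨h1, h2⟩ := h1
    rw [if_pos h1, if_pos h2, if_pos (c := (f ≤ 1 ∧ r ≤ m + f) ∧ g ≤ 1 ∧ p ≤ r + g) ⟨h1, h2⟩]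
    simp only [Multiset.card_add, Multiset.card_replicate, Multiset.sum_add,
      Multiset.sum_replicate, nsmul_eq_mul]
    by_cases h3 : m + f - r + y.card = z.card + f' ∧ r + g - p + z.card = w.card + g'
    · have h4 : f + (m + y.card) = r + z.card + f' ∧ g + (r + z.card) = p + w.card + g' := by
        omega
      rw [if_pos h3, if_pos h4]
      have e1 : (m : ℤ) * j + y.sum - (r * j + z.sum) = j * (m - r) + (y.sum - z.sum) := by ring
      have e2 : (r : ℤ) * j + z.sum - (p * j + w.sum) = j * (r - p) + (z.sum - w.sum) := by ring
      rw [e1, e2, zpow_add₀ ha, zpow_add₀ hb]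
      ring
    · have h4 : ¬ (f + (m + y.card) = r + z.card + f' ∧ g + (r + z.card) = p + w.card + g') := by
        omega
      rw [if_neg h3, if_neg h4, mul_zero]
  · rw [if_neg h1, ite_eq_right_iff]
    intro _
    by_cases h2 : f ≤ 1 ∧ r ≤ m + f
    · rw [if_neg (c := g ≤ 1 ∧ p ≤ r + g) fun h => h1 ⟨h2, h⟩]; ring
    · rw [if_neg h2]; ring

open Classical in
/-- The state vector `U` collects the sums over the middle row below `j`. -/
def HalfSum (t a b : K) (f' g' : ℕ) (y w : Multiset ℤ) (j : ℤ) (U : ℕ → ℕ → K) : Prop :=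
  ∀ f ≤ 1, ∀ g ≤ 1, AllMultisetSum
    (fun z => if ∀ e ∈ z, e < j then
      twoRow t a b f g f' g' (y.filter (· < j)) (w.filter (· < j)) z else 0)
    (a ^ (-(j * f)) * b ^ (-(j * g)) * U f g)

/-- Indexes the possible multiplicities `r = N - i` by the new state `i`. For `N = 0` the truncated
interval has one element, matching the excluded state `i = 1`. -/
theorem sum_Icc_eq_sum_range_two (N : ℕ) (V : ℕ → K) :
    ∑ r ∈ Finset.Icc (N - 1) N, V r =
      ∑ i ∈ Finset.range 2, if i ≤ N then V (N - i) else 0 := by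
  rcases N with _ | N
  · simp
  · have : Finset.Icc N (N + 1) = {N, N + 1} := by
      ext x; simp; omega
    simp [Finset.sum_range_succ, this, add_comm]

/-- Split by the multiplicity `r` of `j` in the middle row: only `r = m + f` and `r = m + f - 1`
leave an offset in `{0, 1}`. The powers of `a` and `b` in the normalization absorb those produced at
`j`, so the recursion for the state vector does not involve `j`. -/
theorem HalfSum.step {t a b : K} (ha : a ≠ 0) (hb : b ≠ 0) {f' g' : ℕ} {y w : Multiset ℤ} {j : ℤ}
    {U : ℕ → ℕ → K} (h : HalfSum t a b f' g' y w j U) :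
    HalfSum t a b f' g' y w (j + 1) (transferStep t a b (y.count j) (w.count j) U) := by
  classical
  intro f hf g hg
  set m := y.count j
  set p := w.count j
  set y' := y.filter (· < j) with hy'
  set w' := w.filter (· < j) with hw'
  have hy : ∀ e ∈ y', e < j := fun e he => (Multiset.mem_filter.mp he).2
  have hw : ∀ e ∈ w', e < j := fun e he => (Multiset.mem_filter.mp he).2
  rw [filter_lt_succ, filter_lt_succ]
  set V : ℕ → K := fun r => a ^ (-(j * f)) * b ^ (-(j * g)) *
    ∑ i ∈ Finset.range 2, transfer t m p f g (m + f - r) i * U (m + f - r) i with hV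
  have hsum : a ^ (-((j + 1) * f)) * b ^ (-((j + 1) * g)) * transferStep t a b m p U f g =
      ∑ r ∈ Finset.Icc (m + f - 1) (m + f), V r := by
    rw [sum_Icc_eq_sum_range_two, transferStep, ← mul_assoc]
    have e1 : a ^ (-((j + 1) * f)) * b ^ (-((j + 1) * g)) * (a ^ f * b ^ g) =
        a ^ (-(j * f)) * b ^ (-(j * g)) := by
      rw [← zpow_natCast a f, ← zpow_natCast b g, mul_mul_mul_comm, ← zpow_add₀ ha, ← zpow_add₀ hb]
      congr 2 <;> ring
    rw [e1, Finset.mul_sum]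
    refine Finset.sum_congr rfl fun i _ => ?_
    split_ifs with hi
    · rw [hV]; dsimp only; rw [Nat.sub_sub_self hi]
    · rw [Finset.sum_eq_zero, mul_zero]
      intro k _
      rw [transfer, if_neg (by omega), zero_mul]
  rw [hsum]
  apply AllMultisetSum.peel (j := j)
  · rintro z ⟨e, he, hje⟩
    exact if_neg fun h => absurd (h e he) (by omega)
  · intro z hz
    rw [ite_eq_right_iff]
    intro hzj
    have hz1 : z = Multiset.replicate (z.count j) j + z.filter (· < j) := by
      rw [← filter_lt_succ, Multiset.filter_eq_self.mpr hzj]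
    rw [hz1, twoRow_replicate_add t ha hb hy hw fun e he => (Multiset.mem_filter.mp he).2,
      ite_eq_right_iff]
    intro hc
    rw [twoRow_of_one_lt, mul_zero]
    rw [Finset.mem_Icc] at hz
    omega
  · intro r hr
    rw [Finset.mem_Icc] at hr
    have hfun : ∀ z : Multiset ℤ, (if ∀ e ∈ z, e < j then
        if ∀ e ∈ Multiset.replicate r j + z, e < j + 1 then
          twoRow t a b f g f' g' (Multiset.replicate m j + y') (Multiset.replicate p j + w')
            (Multiset.replicate r j + z) else 0 else 0) =
        if (f ≤ 1 ∧ r ≤ m + f) ∧ g ≤ 1 ∧ p ≤ r + g then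
          siteWeight t m r * siteWeight t r p * (a ^ (j * (m - r : ℤ)) * b ^ (j * (r - p : ℤ))) *
          (if ∀ e ∈ z, e < j then
            twoRow t a b (m + f - r) (r + g - p) f' g' y' w' z else 0) else 0 := by
      intro z
      by_cases hz : ∀ e ∈ z, e < j
      · rw [if_pos hz, if_pos hz, if_pos, twoRow_replicate_add t ha hb hy hw hz]
        intro e he
        rcases Multiset.mem_add.mp he with he | he
        · rw [Multiset.eq_of_mem_replicate he]; omega
        · have := hz e he; omega
      · rw [if_neg hz, if_neg hz, mul_zero, ite_self]
    by_cases hc : p ≤ r + g ∧ r + g - p ≤ 1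
    · have hs := (h (m + f - r) (by omega) (r + g - p) hc.2).smul
        (siteWeight t m r * siteWeight t r p * (a ^ (j * (m - r : ℤ)) * b ^ (j * (r - p : ℤ))))
      have hval : V r = siteWeight t m r * siteWeight t r p *
          (a ^ (j * (m - r : ℤ)) * b ^ (j * (r - p : ℤ))) *
          (a ^ (-(j * (m + f - r : ℕ))) * b ^ (-(j * (r + g - p : ℕ))) *
            U (m + f - r) (r + g - p)) := by
        simp only [hV]
        rw [Finset.sum_eq_single (r + g - p)]
        · rw [transfer_of t (r := r) (by omega) (by omega)]
          have e1 : a ^ (-(j * f)) =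
              a ^ (j * (m - r : ℤ)) * a ^ (-(j * (m + f - r : ℕ))) := by
            rw [← zpow_add₀ ha, Nat.cast_sub hr.2]; congr 1; push_cast; ring
          have e2 : b ^ (-(j * g)) =
              b ^ (j * (r - p : ℤ)) * b ^ (-(j * (r + g - p : ℕ))) := by
            rw [← zpow_add₀ hb, Nat.cast_sub hc.1]; congr 1; push_cast; ring
          rw [e1, e2]; ring
        · intro i _ hi
          rw [transfer, if_neg (by omega), zero_mul]
        · intro hi
          exact absurd (Finset.mem_range.mpr (by omega)) hi
      rw [hval]
      refine hs.congr fun z => ?_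
      rw [hfun z]
      exact (if_pos ⟨⟨hf, hr.2⟩, hg, hc.1⟩).symm
    · have hval : V r = 0 := by
        simp only [hV]
        rw [Finset.sum_eq_zero, mul_zero]
        intro i hi
        rw [Finset.mem_range] at hi
        rw [transfer, if_neg (by omega), zero_mul]
      rw [hval]
      refine allMultisetSum_zero.congr fun z => ?_
      rw [hfun z, eq_comm, ite_eq_right_iff]
      intro hcc
      rw [twoRow_of_one_lt t a b (by omega), ite_self, mul_zero]

/-! #### Initial values -/

theorem twoRow_zero_zero_of_eq (t a b : K) {f g : ℕ} (hf : f ≤ 1) (hg : g ≤ 1) (z : Multiset ℤ) :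
    twoRow t a b f g f g 0 0 z = if z = 0 then 1 else 0 := by
  unfold twoRow
  by_cases hz : z = 0
  · subst hz
    simp [rowWeight_zero_zero t hf, rowWeight_zero_zero t hg]
  · rw [if_neg, if_neg hz]
    have := Multiset.card_pos.mpr hz
    simp; omega

theorem interlace_one_singleton (i : ℤ) : Interlace 1 0 {i} := by
  intro x
  have := countGE_le_card {i} x
  simp [countGE] at *; omega

theorem interlace_singleton_zero (i : ℤ) : Interlace 0 {i} 0 := by
  intro x
  have := countGE_le_card {i} x
  simp [countGE] at *; omega

/-- Between two empty outer rows the middle row may consist of one free entry `i`, with weight `1 -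
t` and monomial `(b / a) ^ i`. -/
theorem twoRow_zero_zero_geometric (t : K) {a b : K} (ha : a ≠ 0) (z : Multiset ℤ) :
    twoRow t a b 1 0 0 1 0 0 z = if z.card = 1 then (1 - t) * (b / a) ^ z.sum else 0 := by
  by_cases hz : z.card = 1
  · obtain ⟨i, rfl⟩ := Multiset.card_eq_one.mp hz
    rw [if_pos hz, twoRow, if_pos (by simp), rowWeight, if_pos (interlace_one_singleton i),
      rowWeight, if_pos (interlace_singleton_zero i)]
    simp only [Multiset.toFinset_singleton, Finset.prod_singleton, Multiset.count_zero,
      Multiset.count_singleton_self, Multiset.toFinset_zero, Finset.prod_empty,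
      Multiset.sum_singleton, Multiset.sum_zero]
    rw [siteWeight_succ t 0, zero_sub, sub_zero, div_zpow, zpow_neg]
    field_simp
    ring
  · rw [if_neg hz, twoRow, if_neg]
    simp; omega

/-- With empty outer rows the balance of lengths reads `f - f' = z.card = g' - g`, which leaves only
the two excluded cases. -/
theorem twoRow_zero_zero_of_ne (t a b : K) {f g f' g' : ℕ} (hf : f ≤ 1) (hg' : g' ≤ 1)
    (h1 : ¬ (f = f' ∧ g = g')) (h2 : ¬ (f = 1 ∧ g = 0 ∧ f' = 0 ∧ g' = 1)) (z : Multiset ℤ) :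
    twoRow t a b f g f' g' 0 0 z = 0 := by
  rw [twoRow, if_neg]
  simp; omega

open Classical in
theorem base_of_eq (t a b : K) {f g : ℕ} (hf : f ≤ 1) (hg : g ≤ 1) (B : ℤ) :
    AllMultisetSum (fun z => if ∀ e ∈ z, e < B then twoRow t a b f g f g 0 0 z else 0) 1 := by
  have := multisetSum_singleton (K := K) 0 1
  refine (this.all fun z hz => if_neg fun h => hz (by rw [h])).congr fun z => ?_
  rw [twoRow_zero_zero_of_eq t a b hf hg]
  by_cases hz : z = 0
  · subst hz; simp
  · simp [hz]

open Classical in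
theorem base_geometric (t : K) {a b : K} (ha : a ≠ 0) (hb : b ≠ 0) (hab : a ≠ b) (B : ℤ) :
    AllMultisetSum (fun z => if ∀ e ∈ z, e < B then twoRow t a b 1 0 0 1 0 0 z else 0)
      ((1 - t) * ((b / a) ^ B / (b / a - 1))) := by
  have hq : b / a ≠ 1 := fun h => hab ((div_eq_one_iff_eq ha).mp h).symm
  have h1 := (rsum_geometric_lt (div_ne_zero hb ha) hq B).smul (1 - t)
  have h2 : MultisetSum 1 (fun z => if ∀ e ∈ z, e < B then twoRow t a b 1 0 0 1 0 0 z else 0)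
      ((1 - t) * ((b / a) ^ B / (b / a - 1))) := by
    apply multisetSum_one
    convert h1 using 2 with i
    rw [twoRow_zero_zero_geometric t ha]
    simp
  refine h2.all fun z hz => ?_
  rw [twoRow_zero_zero_geometric t ha, if_neg hz, ite_self]

open Classical in
theorem base_of_ne (t a b : K) {f g f' g' : ℕ} (hf : f ≤ 1) (hg' : g' ≤ 1)
    (h1 : ¬ (f = f' ∧ g = g')) (h2 : ¬ (f = 1 ∧ g = 0 ∧ f' = 0 ∧ g' = 1)) (B : ℤ) :
    AllMultisetSum (fun z => if ∀ e ∈ z, e < B then twoRow t a b f g f' g' 0 0 z else 0) 0 := by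
  refine allMultisetSum_zero.congr fun z => ?_
  rw [twoRow_zero_zero_of_ne t a b hf hg' h1 h2, ite_self]

/-- Below all entries of the outer rows the truncated rows are empty; this is where the recursion
over the threshold starts. -/
theorem halfSum_of_filter_eq_zero {t a b : K} {f' g' : ℕ} {y w : Multiset ℤ} {B : ℤ}
    (hy : ∀ e ∈ y, B ≤ e) (hw : ∀ e ∈ w, B ≤ e) {U : ℕ → ℕ → K}
    (h : open Classical in ∀ f ≤ 1, ∀ g ≤ 1, AllMultisetSum
      (fun z => if ∀ e ∈ z, e < B then twoRow t a b f g f' g' 0 0 z else 0)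
      (a ^ (-(B * f)) * b ^ (-(B * g)) * U f g)) : HalfSum t a b f' g' y w B U := by
  have hy0 : y.filter (· < B) = 0 := Multiset.filter_eq_nil.mpr fun e he => not_lt.mpr (hy e he)
  have hw0 : w.filter (· < B) = 0 := Multiset.filter_eq_nil.mpr fun e he => not_lt.mpr (hw e he)
  intro f hf g hg
  rw [hy0, hw0]
  exact h f hf g hg

/-- Iterating the Yang–Baxter equation. -/
theorem exists_stateRel {t a b c : K} (ha : a ≠ 0) (hb : b ≠ 0) {f' g' : ℕ} {y w : Multiset ℤ}
    {B : ℤ} (h : ∃ U U', StateRel t a b c U U' ∧ HalfSum t a b f' g' y w B U ∧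
      HalfSum t b a g' f' y w B U') {j : ℤ} (hj : B ≤ j) :
    ∃ U U', StateRel t a b c U U' ∧ HalfSum t a b f' g' y w j U ∧
      HalfSum t b a g' f' y w j U' := by
  induction j, hj using Int.leInduction with
  | base => exact h
  | succ j hj ih =>
    obtain ⟨U, U', h1, h2, h3⟩ := ih
    exact ⟨_, _, h1.step (y.count j) (w.count j), h2.step ha hb, h3.step hb ha⟩

/-- Only the state `(1, 1)` occurs at the bottom, with the same value `a ^ B * b ^ B` in both
orders, so its relation forces the constant `(b - t * a)⁻¹`. -/
theorem exists_stateRel_base_one_one {t a b : K} (ha : a ≠ 0) (hb : b ≠ 0) (hκ : b ≠ t * a)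
    {y w : Multiset ℤ} {B : ℤ} (hy : ∀ e ∈ y, B ≤ e) (hw : ∀ e ∈ w, B ≤ e) :
    ∃ U U', StateRel t a b (b - t * a)⁻¹ U U' ∧ HalfSum t a b 1 1 y w B U ∧
      HalfSum t b a 1 1 y w B U' := by
  have key : ∀ a b : K, a ≠ 0 → b ≠ 0 → HalfSum t a b 1 1 y w B
      (fun f g => if f = 1 ∧ g = 1 then a ^ B * b ^ B else 0) := by
    intro a b ha hb
    refine halfSum_of_filter_eq_zero hy hw fun f hf g hg => ?_
    by_cases h : f = 1 ∧ g = 1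
    · obtain ⟨rfl, rfl⟩ := h
      convert base_of_eq t a b le_rfl le_rfl B using 1
      simp only [and_self, if_true, Nat.cast_one, mul_one, zpow_neg]
      have := zpow_ne_zero B ha
      have := zpow_ne_zero B hb
      field_simp
    · rw [if_neg h, mul_zero]
      exact base_of_ne t a b hf le_rfl h (by omega) B
  refine ⟨_, _, ?_, key a b ha hb, key b a hb ha⟩
  have := sub_ne_zero.mpr hκ
  constructor <;> simp
  field_simp

/-- In the first order a single middle entry below `B` may turn `(1, 0)` into `(0, 1)`, giving a
geometric series as a second component. In the other order only the empty middle row survives. -/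
theorem exists_stateRel_base_zero_one {t a b : K} (ha : a ≠ 0) (hb : b ≠ 0) (hab : a ≠ b)
    {y w : Multiset ℤ} {B : ℤ} (hy : ∀ e ∈ y, B ≤ e) (hw : ∀ e ∈ w, B ≤ e) :
    ∃ U U', StateRel t a b (b - a)⁻¹ U U' ∧ HalfSum t a b 0 1 y w B U ∧
      HalfSum t b a 1 0 y w B U' := by
  have hba : b - a ≠ 0 := sub_ne_zero.mpr hab.symm
  refine ⟨fun f g => if f = 0 ∧ g = 1 then b ^ B else
    if f = 1 ∧ g = 0 then (1 - t) * a * b ^ B / (b - a) else 0,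
    fun f g => if f = 1 ∧ g = 0 then b ^ B else 0, ?_, ?_, ?_⟩
  · constructor <;> simp
    · field_simp
    · field_simp
  · refine halfSum_of_filter_eq_zero hy hw fun f hf g hg => ?_
    by_cases h : f = 0 ∧ g = 1
    · obtain ⟨rfl, rfl⟩ := h
      convert base_of_eq t a b (zero_le_one) le_rfl B using 1
      simp only [and_self, if_true, Nat.cast_one, mul_one, zpow_neg]
      have := zpow_ne_zero B hb
      simp [this]
    rw [if_neg h]
    by_cases h' : f = 1 ∧ g = 0
    · obtain ⟨rfl, rfl⟩ := h'
      convert base_geometric t ha hb hab B using 1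
      simp only [and_self, if_true, Nat.cast_one, mul_one, zpow_neg, div_zpow]
      have := zpow_ne_zero B ha
      have e : b / a - 1 = (b - a) / a := by field_simp
      rw [e]
      simp
      field_simp
    · rw [if_neg h', mul_zero]
      exact base_of_ne t a b hf le_rfl h (by omega) B
  · refine halfSum_of_filter_eq_zero hy hw fun f hf g hg => ?_
    by_cases h' : f = 1 ∧ g = 0
    · obtain ⟨rfl, rfl⟩ := h'
      convert base_of_eq t b a le_rfl (zero_le_one) B using 1
      have := zpow_ne_zero B hb
      simp [this]
    · rw [if_neg h', mul_zero]
      exact base_of_ne t b a hf (zero_le_one) h' (by omega) B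

/-! #### Final values -/

/-- With no additional element at the left, interlacing forbids middle entries above all of `y`, so
the truncated sum is the full sum. -/
theorem HalfSum.total_zero {t a b : K} {f' g' g : ℕ} (hg : g ≤ 1) {y w : Multiset ℤ} {J : ℤ}
    (hy : ∀ e ∈ y, e < J) (hw : ∀ e ∈ w, e < J) {U : ℕ → ℕ → K}
    (h : HalfSum t a b f' g' y w J U) :
    AllMultisetSum (twoRow t a b 0 g f' g' y w) (b ^ (-(J * g)) * U 0 g) := by
  classical
  have h0 := h 0 zero_le_one g hg
  rw [Multiset.filter_eq_self.mpr hy, Multiset.filter_eq_self.mpr hw] at h0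
  simp only [Nat.cast_zero, mul_zero, neg_zero, zpow_zero, one_mul] at h0
  refine h0.congr fun z => ?_
  rw [ite_eq_left_iff]
  intro hz
  push Not at hz
  obtain ⟨e, he, hje⟩ := hz
  rw [twoRow, eq_comm, ite_eq_right_iff]
  intro _
  rw [rowWeight, if_neg, zero_mul, zero_mul]
  intro hI
  have h1 := (hI J).1
  rw [countGE_eq_zero hy] at h1
  have : 0 < countGE z J := Multiset.countP_pos.mpr ⟨e, he, hje⟩
  omega

/-- With `f = 1` at most one middle entry lies at or above `J`. Such an entry turns `(1, 0)` into
`(0, 1)`, so the geometric series over it multiplies the component `U 0 1`. -/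
theorem HalfSum.total_one {t a b : K} (ha : a ≠ 0) (hb : b ≠ 0) (hab : a ≠ b) {f' g' : ℕ}
    {y w : Multiset ℤ} {J : ℤ} (hy : ∀ e ∈ y, e < J) (hw : ∀ e ∈ w, e < J) {U : ℕ → ℕ → K}
    (h : HalfSum t a b f' g' y w J U) :
    AllMultisetSum (twoRow t a b 1 0 f' g' y w)
      (a ^ (-J) * (U 1 0 + (1 - t) * a / (a - b) * U 0 1)) := by
  classical
  have h10 := h 1 le_rfl 0 zero_le_one
  have h01 := h 0 zero_le_one 1 le_rfl
  rw [Multiset.filter_eq_self.mpr hy, Multiset.filter_eq_self.mpr hw] at h10 h01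
  have hq : b / a ≠ 1 := fun h => hab ((div_eq_one_iff_eq ha).mp h).symm
  have hgeo : MultisetSum 1 (fun u => if ∀ e ∈ u, J ≤ e then
      (if u.card = 1 then (1 - t) * (b / a) ^ u.sum else 0) else 0)
      ((1 - t) * ((b / a) ^ J / (1 - b / a))) := by
    apply multisetSum_one
    convert (rsum_geometric_ge (div_ne_zero hb ha) hq J).smul (1 - t) using 2 with i
    simp
  have hsplit := AllMultisetSum.split (j := J) (r := 1) (H := twoRow t a b 0 1 f' g' y w)
    (fun u hu => if_neg hu) hgeo h01
  have hval : a ^ (-J) * (U 1 0 + (1 - t) * a / (a - b) * U 0 1) =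
      (a ^ (-(J * (1 : ℕ))) * b ^ (-(J * (0 : ℕ))) * U 1 0) +
      ((1 - t) * ((b / a) ^ J / (1 - b / a))) *
        (a ^ (-(J * (0 : ℕ))) * b ^ (-(J * (1 : ℕ))) * U 0 1) := by
    have h1 := zpow_ne_zero J ha
    have h2 := zpow_ne_zero J hb
    have h3 : a - b ≠ 0 := sub_ne_zero.mpr hab
    have e : 1 - b / a = (a - b) / a := by field_simp
    simp only [Nat.cast_one, Nat.cast_zero, mul_one, mul_zero, neg_zero, zpow_zero, zpow_neg,
      div_zpow, one_mul]
    rw [e]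
    field_simp
  rw [hval]
  refine (h10.add hsplit).congr fun z => ?_
  by_cases hz : ∀ e ∈ z, e < J
  · rw [if_pos hz, (Multiset.filter_eq_nil (s := z)).mpr fun e he => not_le.mpr (hz e he)]
    simp
  · rw [if_neg hz, zero_add]
    by_cases hc : (z.filter (J ≤ ·)).card = 1
    · obtain ⟨i, hi⟩ := Multiset.card_eq_one.mp hc
      have hJi : J ≤ i := by
        have : i ∈ z.filter (J ≤ ·) := by rw [hi]; simp
        exact (Multiset.mem_filter.mp this).2
      have hzz : z = Multiset.replicate 1 i + z.filter (· < J) := by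
        rw [Multiset.replicate_one, ← hi]
        conv_lhs => rw [← Multiset.filter_add_not (J ≤ ·) z]
        simp
      have hlt : ∀ e ∈ z.filter (· < J), e < i := fun e he =>
        (Multiset.mem_filter.mp he).2.trans_le hJi
      have hrep := twoRow_replicate_add t ha hb (f := 1) (g := 0) (f' := f') (g' := g') (m := 0)
        (p := 0) (r := 1) (j := i) (y := y) (w := w) (fun e he => (hy e he).trans_le hJi)
        (fun e he => (hw e he).trans_le hJi) hlt
      simp only [Multiset.replicate_zero, zero_add, ← hzz] at hrep
      rw [hrep, if_pos hc, hi, siteWeight_succ t 0, siteWeight_zero]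
      simp [div_zpow]
      left
      left
      field_simp
    · rw [if_neg hc, zero_mul, twoRow, eq_comm, ite_eq_right_iff]
      intro _
      rw [rowWeight, if_neg, zero_mul, zero_mul]
      intro hI
      have h1 := (hI J).1
      rw [countGE_eq_zero hy, countGE, Multiset.countP_eq_card_filter] at h1
      push Not at hz
      obtain ⟨e, he, hje⟩ := hz
      have : 0 < (z.filter (J ≤ ·)).card :=
        Multiset.card_pos_iff_exists_mem.mpr ⟨e, Multiset.mem_filter.mpr ⟨he, hje⟩⟩
      omega

/-- The factor by which a step with `o` additional elements at the left and `r` at the right is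
exchanged with a subsequent shortening step. -/
def exchangeFactor (t a b : K) (o r : ℕ) : K :=
  if o = 0 then (b - t * a) / (b - a) else
    if r = 0 then (a - t * b) / (a - b) else -((b - t * a) * (a - t * b)) / (b - a) ^ 2

/-- Start the relation between the two orders below all entries, carry it above all entries by the
Yang–Baxter recursion, and read off the total sums there. The bottom states are `1` minus the
numbers of additional elements at the right; they determine which initial relation is used. -/
theorem exchange {t a b : K} (ha : a ≠ 0) (hb : b ≠ 0) (hab : a ≠ b) (hκ : b ≠ t * a) {o r : ℕ}
    (ho : o ≤ 1) (hr : r ≤ 1) (hor : o + r ≠ 0) (y w : Multiset ℤ) :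
    ∃ v, AllMultisetSum (twoRow t a b o 0 (1 - r) 1 y w) (exchangeFactor t a b o r * v) ∧
      AllMultisetSum (twoRow t b a 0 o 1 (1 - r) y w) v := by
  obtain ⟨B, hB⟩ := exists_le_forall_mem (y + w)
  obtain ⟨J, hJ⟩ := exists_lt_forall_mem (y + w)
  have hyB : ∀ e ∈ y, B ≤ e := fun e he => hB e (Multiset.mem_add.mpr (Or.inl he))
  have hwB : ∀ e ∈ w, B ≤ e := fun e he => hB e (Multiset.mem_add.mpr (Or.inr he))
  have hyJ : ∀ e ∈ y, e < max B J := fun e he =>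
    lt_max_of_lt_right (hJ e (Multiset.mem_add.mpr (Or.inl he)))
  have hwJ : ∀ e ∈ w, e < max B J := fun e he =>
    lt_max_of_lt_right (hJ e (Multiset.mem_add.mpr (Or.inr he)))
  have hba : b - a ≠ 0 := sub_ne_zero.mpr hab.symm
  have hab' : a - b ≠ 0 := sub_ne_zero.mpr hab
  have hκ' : b - t * a ≠ 0 := sub_ne_zero.mpr hκ
  have hJB : B ≤ max B J := le_max_left _ _
  interval_cases o
  · obtain rfl : r = 1 := by omega
    obtain ⟨U, U', hrel, h1, h2⟩ := exists_stateRel ha hb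
      (exists_stateRel_base_zero_one (t := t) ha hb hab hyB hwB) hJB
    refine ⟨_, ?_, h2.total_zero zero_le_one hyJ hwJ⟩
    convert h1.total_zero zero_le_one hyJ hwJ using 1
    rw [hrel.r00, exchangeFactor, if_pos rfl]
    simp
    ring
  · interval_cases r
    · obtain ⟨U, U', hrel, h1, h2⟩ := exists_stateRel ha hb
        (exists_stateRel_base_one_one (t := t) ha hb hκ hyB hwB) hJB
      refine ⟨_, ?_, h2.total_zero le_rfl hyJ hwJ⟩
      convert h1.total_one ha hb hab hyJ hwJ using 1
      -- The terms with `U' 1 0` cancel, and the coefficient of `U' 0 1` factors as `(b - t a)(a - t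
      -- b) / (a - b)` times the constant of the relation.
      rw [hrel.r10, hrel.r01, exchangeFactor, if_neg (by omega), if_pos rfl]
      simp only [Nat.cast_one, mul_one]
      have hκ2 : b - a * t ≠ 0 := by rwa [mul_comm a t]
      field_simp
      ring
    · obtain ⟨U, U', hrel, h1, h2⟩ := exists_stateRel ha hb
        (exists_stateRel_base_zero_one (t := t) ha hb hab hyB hwB) hJB
      refine ⟨_, ?_, h2.total_zero le_rfl hyJ hwJ⟩
      convert h1.total_one ha hb hab hyJ hwJ using 1
      rw [hrel.r10, hrel.r01, exchangeFactor, if_neg (by omega), if_neg (by omega)]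
      simp only [Nat.cast_one, mul_one]
      have e : a - b = -(b - a) := by ring
      rw [e]
      field_simp
      ring

end Exchange

end

end GTHL

namespace GTHL

noncomputable section

/-! ### Patterns with prescribed row lengths -/

/-! ### Invariance of the weights under monotone relabelling -/

section Relabel

variable {R : Type*} [CommRing R]

/-- A strictly increasing map of the integers is unbounded in both directions, so the preimage of a
half-line is a half-line. Hence the counting form of interlacing can be tested on the original
values. -/
theorem StrictMono.exists_int_le_iff {φ : ℤ → ℤ} (hφ : StrictMono φ) (x' : ℤ) :
    ∃ x, ∀ e, x' ≤ φ e ↔ x ≤ e := by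
  have h1 : ∀ n : ℕ, φ 0 + n ≤ φ n := by
    intro n
    induction n with
    | zero => simp
    | succ n ih =>
      have := hφ (show (n : ℤ) < ((n + 1 : ℕ) : ℤ) by push_cast; omega)
      push_cast at *; omega
  have h2 : ∀ n : ℕ, φ (-n) ≤ φ 0 - n := by
    intro n
    induction n with
    | zero => simp
    | succ n ih =>
      have := hφ (show (-((n + 1 : ℕ) : ℤ)) < -(n : ℤ) by push_cast; omega)
      push_cast at *; omega
  obtain ⟨x, hx1, hx2⟩ := Int.exists_least_of_bdd (P := fun e => x' ≤ φ e)
    ⟨-((φ 0 - x').toNat + 1 : ℕ), fun z hz => by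
      by_contra hlt
      have h3 := h2 ((φ 0 - x').toNat + 1)
      have h4 := hφ (not_le.mp hlt)
      have := Int.self_le_toNat (φ 0 - x')
      push_cast at *; omega⟩
    ⟨((x' - φ 0).toNat : ℕ), by
      have h3 := h1 (x' - φ 0).toNat
      have := Int.self_le_toNat (x' - φ 0)
      omega⟩
  exact ⟨x, fun e => ⟨hx2 e, fun h => hx1.trans (hφ.monotone h)⟩⟩

theorem countGE_map {φ : ℤ → ℤ} {x' x : ℤ} (h : ∀ e, x' ≤ φ e ↔ x ≤ e) (y : Multiset ℤ) :
    countGE (y.map φ) x' = countGE y x := by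
  rw [countGE, Multiset.countP_map, ← Multiset.countP_eq_card_filter, countGE]
  exact Multiset.countP_congr rfl fun e _ => by rw [h]

theorem interlace_map {φ : ℤ → ℤ} (hφ : StrictMono φ) {o : ℕ} {y z : Multiset ℤ} :
    Interlace o (y.map φ) (z.map φ) ↔ Interlace o y z := by
  constructor
  · intro h x
    have := h (φ x)
    rwa [countGE_map (fun e => hφ.le_iff_le), countGE_map (fun e => hφ.le_iff_le)] at this
  · intro h x'
    obtain ⟨x, hx⟩ := StrictMono.exists_int_le_iff hφ x'
    rw [countGE_map hx, countGE_map hx]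
    exact h x

theorem rowWeight_map (t : R) {φ : ℤ → ℤ} (hφ : StrictMono φ) (o : ℕ) (y z : Multiset ℤ) :
    rowWeight t o (y.map φ) (z.map φ) = rowWeight t o y z := by
  classical
  unfold rowWeight
  rw [interlace_map hφ]
  congr 1
  rw [Multiset.toFinset_map, Finset.prod_image hφ.injective.injOn]
  refine Finset.prod_congr rfl fun x _ => ?_
  rw [Multiset.count_map_eq_count' _ _ hφ.injective, Multiset.count_map_eq_count' _ _ hφ.injective]

theorem map_eq_self_of_bound {φ : ℤ → ℤ} {m : ℤ} (hfix : ∀ x, |x| ≤ m → φ x = x) {y : Multiset ℤ}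
    (hy : ∀ e ∈ y, |e| ≤ m) : y.map φ = y := by
  conv_rhs => rw [← Multiset.map_id y]
  exact Multiset.map_congr rfl fun e he => hfix e (hy e he)

theorem exists_abs_bound (y : Multiset ℤ) : ∃ m : ℤ, 0 ≤ m ∧ ∀ e ∈ y, |e| ≤ m := by
  obtain ⟨A, hA⟩ := exists_lt_forall_mem y
  obtain ⟨B, hB⟩ := exists_le_forall_mem y
  refine ⟨max |A| |B|, le_max_of_le_left (abs_nonneg _), fun e he => ?_⟩
  rw [abs_le]
  have h1 := hA e he
  have h2 := hB e he
  have h3 := le_abs_self A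
  have h4 := neg_abs_le B
  have h5 := le_max_left |A| |B|
  have h6 := le_max_right |A| |B|
  constructor <;> linarith

theorem entries_comp {k : ℕ} (φ : ℤ → ℤ) (z : Fin k → ℤ) : entries (φ ∘ z) = (entries z).map φ := by
  rw [entries, entries, Multiset.map_map]

theorem antitone_comp_iff {k : ℕ} {φ : ℤ → ℤ} (hφ : StrictMono φ) {z : Fin k → ℤ} :
    Antitone (φ ∘ z) ↔ Antitone z :=
  ⟨fun h _ _ hij => hφ.le_iff_le.mp (h hij), fun h _ _ hij => hφ.monotone (h hij)⟩

end Relabel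

/-- A step from a row of a pattern to the next one: the numbers of additional elements at the left
and at the right, and the variable of the step. -/
structure Step (K : Type*) where
  /-- the number of additional elements at the left -/
  o : ℕ
  /-- the number of additional elements at the right -/
  r : ℕ
  /-- the variable -/
  x : K

/-! ### Pattern sums: existence and recursion -/

section Patterns

variable {K : Type*} [Field K]

/-- The length of the next row. -/
def Step.next (s : Step K) (k : ℕ) : ℕ := k + s.o + s.r - 1

/-- The positions below the top row in a pattern with top row of length `k`. -/
def Idx : ℕ → List (Step K) → Type
  | _, [] => Fin 0
  | k, s :: l => Fin (s.next k) ⊕ Idx (s.next k) l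

instance idxFintype : ∀ (k : ℕ) (l : List (Step K)), Fintype (Idx k l)
  | _, [] => inferInstanceAs (Fintype (Fin 0))
  | k, s :: l =>
    have := idxFintype (s.next k) l
    inferInstanceAs (Fintype (Fin (s.next k) ⊕ Idx (s.next k) l))

instance idxDecidableEq : ∀ (k : ℕ) (l : List (Step K)), DecidableEq (Idx k l)
  | _, [] => inferInstanceAs (DecidableEq (Fin 0))
  | k, s :: l =>
    have := idxDecidableEq (s.next k) l
    inferInstanceAs (DecidableEq (Fin (s.next k) ⊕ Idx (s.next k) l))

open Classical in
/-- The product of the weights of the rows of a pattern with top row `y`. -/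
def patternWeight (t : K) : ∀ (k : ℕ) (l : List (Step K)), Multiset ℤ → (Idx k l → ℤ) → K
  | _, [], _, _ => 1
  | k, s :: l, y, b =>
    (if Antitone (fun i => b (Sum.inl i)) then
      rowWeight t s.o y (entries fun i => b (Sum.inl i)) else 0) *
    patternWeight t (s.next k) l (entries fun i => b (Sum.inl i)) (fun i => b (Sum.inr i))

/-- The monomial of a pattern whose top row has sum `c`. -/
def patternMonomial : ∀ (k : ℕ) (l : List (Step K)), ℤ → (Idx k l → ℤ) → K
  | _, [], _, _ => 1
  | k, s :: l, c, b =>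
    s.x ^ (c - ∑ i, b (Sum.inl i)) *
    patternMonomial (s.next k) l (∑ i, b (Sum.inl i)) (fun i => b (Sum.inr i))

/-- The summand of the sum over patterns. -/
def patternTerm (t : K) (k : ℕ) (l : List (Step K)) (y : Multiset ℤ) (b : Idx k l → ℤ) : K :=
  patternWeight t k l y b * patternMonomial k l y.sum b

theorem patternWeight_map (t : K) {φ : ℤ → ℤ} (hφ : StrictMono φ) (k : ℕ) (l : List (Step K))
    (y : Multiset ℤ) (b : Idx k l → ℤ) :
    patternWeight t k l (y.map φ) (φ ∘ b) = patternWeight t k l y b := by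
  induction l generalizing k y with
  | nil => rfl
  | cons s l ih =>
    have e : entries (fun i => (φ ∘ b) (Sum.inl i)) = (entries fun i => b (Sum.inl i)).map φ :=
      entries_comp φ _
    have e2 : Antitone (fun i => (φ ∘ b) (Sum.inl i)) ↔ Antitone (fun i => b (Sum.inl i)) :=
      antitone_comp_iff hφ
    simp only [patternWeight]
    rw [e, rowWeight_map t hφ]
    have e3 := ih (s.next k) (entries fun i => b (Sum.inl i)) (fun i => b (Sum.inr i))
    have e4 : (fun i => (φ ∘ b) (Sum.inr i)) = φ ∘ fun i => b (Sum.inr i) := rfl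
    rw [e4, e3]
    by_cases h : Antitone (fun i => b (Sum.inl i))
    · rw [if_pos h, if_pos (e2.mpr h)]
    · rw [if_neg h, if_neg fun h' => h (e2.mp h')]

/-- A relabelling that fixes `[-m, m]` fixes the top row entry by entry, so only the pattern below
is relabelled. -/
theorem patternWeight_orderInvariant (t : K) (k : ℕ) (l : List (Step K)) {y : Multiset ℤ} {m : ℤ}
    (hy : ∀ e ∈ y, |e| ≤ m) : OrderInvariant m (patternWeight t k l y) := by
  intro φ hφ hfix b
  conv_lhs => rw [← map_eq_self_of_bound hfix hy]
  exact patternWeight_map t hφ k l y b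

theorem patternMonomial_add {l : List (Step K)} (hx : ∀ s ∈ l, s.x ≠ 0) (k : ℕ) (c c' : ℤ)
    (b b' : Idx k l → ℤ) : patternMonomial k l (c + c') (b + b') =
      patternMonomial k l c b * patternMonomial k l c' b' := by
  induction l generalizing k c c' with
  | nil => simp [patternMonomial]
  | cons s l ih =>
    simp only [patternMonomial]
    have e : ∑ i, (b + b') (Sum.inl i) = ∑ i, b (Sum.inl i) + ∑ i, b' (Sum.inl i) :=
      Finset.sum_add_distrib
    have e2 := ih (fun s hs => hx s (List.mem_cons_of_mem _ hs)) (s.next k)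
      (∑ i, b (Sum.inl i)) (∑ i, b' (Sum.inl i)) (fun i => b (Sum.inr i)) (fun i => b' (Sum.inr i))
    have e3 : (fun i => (b + b') (Sum.inr i)) =
      (fun i => b (Sum.inr i)) + fun i => b' (Sum.inr i) := rfl
    rw [e, e3, e2, add_sub_add_comm, zpow_add₀ (hx s List.mem_cons_self)]
    ring

theorem patternMonomial_zero (l : List (Step K)) (k : ℕ) :
    patternMonomial k l 0 (0 : Idx k l → ℤ) = 1 := by
  induction l generalizing k with
  | nil => rfl
  | cons s l ih =>
    have h := ih (s.next k)
    have e3 : (fun i => (0 : Idx k (s :: l) → ℤ) (Sum.inr i)) = (0 : Idx (s.next k) l → ℤ) := rfl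
    have e4 : ∑ i, (0 : Idx k (s :: l) → ℤ) (Sum.inl i) = 0 := Finset.sum_const_zero
    simp only [patternMonomial]
    rw [e3, e4, h]
    simp

/-- The monomial of a pattern as a character. -/
def patternChar {l : List (Step K)} (hx : ∀ s ∈ l, s.x ≠ 0) (k : ℕ) :
    Multiplicative (Idx k l → ℤ) →* K where
  toFun b := patternMonomial k l 0 b.toAdd
  map_one' := patternMonomial_zero l k
  map_mul' b b' := by
    rw [toAdd_mul, ← patternMonomial_add hx, add_zero]

theorem patternMonomial_eq {l : List (Step K)} (hx : ∀ s ∈ l, s.x ≠ 0) (k : ℕ) (c : ℤ)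
    (b : Idx k l → ℤ) : patternMonomial k l c b =
      patternMonomial k l c 0 * patternChar hx k (Multiplicative.ofAdd b) := by
  have := patternMonomial_add hx k c 0 0 b
  rw [add_zero, zero_add] at this
  exact this

/-- Validity of a list of steps: all rows have the right lengths, the last row being empty. -/
def ValidSteps : ℕ → List (Step K) → Prop
  | k, [] => k = 0
  | k, s :: l => s.o ≤ 1 ∧ s.r ≤ 1 ∧ 1 ≤ k + s.o + s.r ∧ ValidSteps (s.next k) l

/-- A set of nonzero numbers without multiplicative relations of degree `0` and without pairs of
elements with quotient `t`. -/
structure Generic (t : K) (X : Finset K) : Prop where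
  ne_zero : ∀ x ∈ X, x ≠ 0
  ne_mul : ∀ x ∈ X, ∀ y ∈ X, x ≠ y → y ≠ t * x
  indep : ∀ e : K → ℤ, ∑ x ∈ X, e x = 0 → ∏ x ∈ X, x ^ e x = 1 → ∀ x ∈ X, e x = 0

/-- Valid lists of steps with different variables in the set `X`. -/
structure Admissible (X : Finset K) (k : ℕ) (l : List (Step K)) : Prop where
  valid : ValidSteps k l
  nodup : (l.map Step.x).Nodup
  mem : ∀ s ∈ l, s.x ∈ X

theorem Admissible.tail {X : Finset K} {k : ℕ} {s : Step K} {l : List (Step K)}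
    (h : Admissible X k (s :: l)) : Admissible X (s.next k) l :=
  ⟨h.valid.2.2.2, (List.nodup_cons.mp h.nodup).2, fun s hs => h.mem s (List.mem_cons_of_mem _ hs)⟩

/-- The exponent of a step's variable is the drop of the row sum. The drops telescope to the sum of
the top row, because the last row is empty. If all drops vanish, every row of a nonnegative pattern
below a row of sum 0 has sum 0, hence is zero. -/
theorem exists_exponent {X : Finset K} {k : ℕ} {l : List (Step K)}
    (hl : Admissible X k l) (c : ℤ) (hc : k = 0 → c = 0) (b : Idx k l → ℤ) :
    ∃ e : K → ℤ, (∀ x, x ∉ l.map Step.x → e x = 0) ∧ ∑ x ∈ X, e x = c ∧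
      patternMonomial k l c b = ∏ x ∈ X, x ^ e x ∧
      ((∀ x ∈ X, e x = 0) → c = 0 → 0 ≤ b → b = 0) := by
  classical
  induction l generalizing k c with
  | nil =>
    refine ⟨fun _ => 0, fun _ _ => rfl, ?_, by simp [patternMonomial], fun _ _ _ => ?_⟩
    · rw [hc hl.valid]; simp
    · ext i; exact i.elim0
  | cons s l ih =>
    obtain ⟨e, h1, h2, h3, h4⟩ := ih hl.tail (∑ i, b (Sum.inl i)) (fun h => by
      have : IsEmpty (Fin (s.next k)) := by rw [h]; infer_instance
      simp) (fun i => b (Sum.inr i))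
    have hs : s.x ∉ l.map Step.x := (List.nodup_cons.mp hl.nodup).1
    have hsX : s.x ∈ X := hl.mem s List.mem_cons_self
    refine ⟨Function.update e s.x (c - ∑ i, b (Sum.inl i)), fun x hx => ?_, ?_, ?_, fun h5 h6 h7 => ?_⟩
    · rw [List.map_cons, List.mem_cons, not_or] at hx
      rw [Function.update_of_ne hx.1, h1 x hx.2]
    · rw [Finset.sum_update_of_mem hsX, ← Finset.erase_eq]
      have : ∑ x ∈ X.erase s.x, e x = ∑ x ∈ X, e x := by
        rw [← Finset.add_sum_erase _ _ hsX, h1 _ hs, zero_add]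
      rw [this, h2]; ring
    · simp only [patternMonomial]
      rw [h3, ← Finset.mul_prod_erase _ _ hsX, ← Finset.mul_prod_erase _ _ hsX,
        Function.update_self, h1 _ hs, zpow_zero, one_mul]
      congr 1
      exact Finset.prod_congr rfl fun x hx => by
        rw [Function.update_of_ne (Finset.ne_of_mem_erase hx)]
    · have h8 := h5 _ hsX
      rw [Function.update_self, h6, zero_sub, neg_eq_zero] at h8
      have h9 : ∀ i, b (Sum.inl i) = 0 := fun i =>
        (Finset.sum_eq_zero_iff_of_nonneg fun i _ => h7 (Sum.inl i)).mp h8 i (Finset.mem_univ _)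
      have h10 := h4 (fun x hx => by
        by_cases hxs : x = s.x
        · rw [hxs, h1 _ hs]
        · have := h5 x hx
          rwa [Function.update_of_ne hxs] at this) h8 (fun i => h7 (Sum.inr i))
      ext i
      rcases i with i | i
      · exact h9 i
      · exact congrFun h10 i

variable {t : K} {X : Finset K}

theorem Admissible.ne_zero (hX : Generic t X) {k : ℕ} {l : List (Step K)}
    (hl : Admissible X k l) : ∀ s ∈ l, s.x ≠ 0 := fun s hs => hX.ne_zero _ (hl.mem s hs)

/-- The monomial of an indicator vector has degree 0, so if it were 1, genericity would make all
drops of row sums vanish, and `A` would be empty. -/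
theorem patternChar_ind_ne_one (hX : Generic t X) {k : ℕ} {l : List (Step K)}
    (hl : Admissible X k l) {A : Finset (Idx k l)} (hA : A ≠ ∅) :
    patternChar (hl.ne_zero hX) k (Multiplicative.ofAdd (ind A)) ≠ 1 := by
  intro h
  obtain ⟨e, -, h2, h3, h4⟩ := exists_exponent hl 0 (fun _ => rfl) (ind A)
  have h5 : patternMonomial k l 0 (ind A) = 1 := h
  have h6 := h4 (hX.indep e h2 (by rw [← h3, h5])) rfl (ind_nonneg A)
  obtain ⟨i, hi⟩ := Finset.nonempty_iff_ne_empty.mpr hA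
  have := congrFun h6 i
  simp [ind, hi] at this

/-- The bound on the entries of `y` enters only the proof of finiteness, not the regularizer. One
`Q` therefore serves all top rows, as `RSum.fubini` demands. -/
theorem exists_rsumBy_patternTerm (hX : Generic t X) {k : ℕ} {l : List (Step K)}
    (hl : Admissible X k l) : ∃ Q : AddMonoidAlgebra K (Idx k l → ℤ), eps Q ≠ 0 ∧
      ∀ y, ∃ v, RSumBy Q (patternTerm t k l y) v := by
  refine ⟨twist (patternChar (hl.ne_zero hX) k) (killer K Finset.univ),
    eps_twist_killer_ne_zero fun A _ hA => patternChar_ind_ne_one hX hl hA, fun y => ?_⟩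
  refine rsumBy_exists
    (eps_twist_killer_ne_zero fun A _ hA => patternChar_ind_ne_one hX hl hA) ?_
  obtain ⟨m, hm, hy⟩ := exists_abs_bound y
  have h1 := act_twist_finite (K := K) (χ := patternChar (hl.ne_zero hX) k)
    (act_killer_finite hm (patternWeight_orderInvariant t k l hy) (S := Finset.univ)
      (fun d _ i hi => absurd (Finset.mem_univ i) hi))
  have h2 : patternTerm t k l y = patternMonomial k l y.sum 0 • fun b =>
      algebraMap K K (patternWeight t k l y b) *
        patternChar (hl.ne_zero hX) k (Multiplicative.ofAdd b) := by
    ext b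
    rw [Pi.smul_apply, patternTerm, patternMonomial_eq (hl.ne_zero hX), smul_eq_mul,
      Algebra.algebraMap_self, RingHom.id_apply]
    ring
  rw [h2, map_smul]
  exact h1.subset (Function.support_const_smul_subset _ _)

open Classical in
/-- The regularized sum over all patterns with top row `y`. -/
def patternSum (t : K) (k : ℕ) (l : List (Step K)) (y : Multiset ℤ) : K :=
  if h : ∃ v, RSum (patternTerm t k l y) v then h.choose else 0

theorem RSum.patternSum_eq {k : ℕ} {l : List (Step K)} {y : Multiset ℤ} {v : K}
    (h : RSum (patternTerm t k l y) v) : patternSum t k l y = v := by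
  have h' : ∃ v, RSum (patternTerm t k l y) v := ⟨v, h⟩
  rw [patternSum, dif_pos h']
  exact h'.choose_spec.unique h

theorem rsum_patternSum (hX : Generic t X) {k : ℕ} {l : List (Step K)}
    (hl : Admissible X k l) (y : Multiset ℤ) :
    RSum (patternTerm t k l y) (patternSum t k l y) := by
  obtain ⟨Q, hQ, h⟩ := exists_rsumBy_patternTerm hX hl
  obtain ⟨v, hv⟩ := h y
  have : RSum (patternTerm t k l y) v := ⟨Q, hQ, hv⟩
  rwa [this.patternSum_eq]

theorem exists_rsumBy_patternSum (hX : Generic t X) {k : ℕ} {l : List (Step K)}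
    (hl : Admissible X k l) : ∃ Q : AddMonoidAlgebra K (Idx k l → ℤ), eps Q ≠ 0 ∧
      ∀ y, RSumBy Q (patternTerm t k l y) (patternSum t k l y) := by
  obtain ⟨Q, hQ, h⟩ := exists_rsumBy_patternTerm hX hl
  refine ⟨Q, hQ, fun y => ?_⟩
  obtain ⟨v, hv⟩ := h y
  have : RSum (patternTerm t k l y) v := ⟨Q, hQ, hv⟩
  rwa [this.patternSum_eq]

theorem sum_entries {k : ℕ} (z : Fin k → ℤ) : (entries z).sum = ∑ i, z i := rfl

theorem RSumBy.smul {M : Type*} [AddCommGroup M] {Q : AddMonoidAlgebra K M} {g : M → K} {r : K}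
    (h : RSumBy Q g r) (c : K) : RSumBy Q (fun a => c * g a) (c * r) := by
  obtain ⟨h1, h2⟩ := h
  have e : act Q (fun a => c * g a) = c • act Q g := by rw [← map_smul]; rfl
  refine ⟨?_, ?_⟩
  · rw [e]; exact h1.subset (Function.support_const_smul_subset c _)
  · rw [e]
    simp only [Pi.smul_apply, smul_eq_mul]
    rw [← mul_finsum, h2]; ring

/-- Splitting the coordinates into two groups. -/
def sumAddEquiv (α β : Type*) : (α ⊕ β → ℤ) ≃+ (α → ℤ) × (β → ℤ) :=
  { Equiv.sumArrowEquivProdArrow α β ℤ with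
    map_add' := fun _ _ => rfl }

theorem patternTerm_cons (k : ℕ) (s : Step K) (l : List (Step K)) (y : Multiset ℤ)
    (b : Idx k (s :: l) → ℤ) : open Classical in patternTerm t k (s :: l) y b =
      (if Antitone (fun i => b (Sum.inl i)) then
        rowWeight t s.o y (entries fun i => b (Sum.inl i)) *
          s.x ^ (y.sum - (entries fun i => b (Sum.inl i)).sum) else 0) *
      patternTerm t (s.next k) l (entries fun i => b (Sum.inl i)) (fun i => b (Sum.inr i)) := by
  classical
  simp only [patternTerm, patternWeight, patternMonomial, sum_entries]
  split_ifs <;> ring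

/-- The recursion for the sum over patterns. -/
theorem multisetSum_patternSum_cons (hX : Generic t X) {k : ℕ} {s : Step K} {l : List (Step K)}
    (hl : Admissible X k (s :: l)) (y : Multiset ℤ) :
    MultisetSum (s.next k)
      (fun z => rowWeight t s.o y z * s.x ^ (y.sum - z.sum) * patternSum t (s.next k) l z)
      (patternSum t k (s :: l) y) := by
  classical
  obtain ⟨Q, hQ, h⟩ := exists_rsumBy_patternSum hX hl.tail
  have h1 : RSum (fun p : (Fin (s.next k) → ℤ) × (Idx (s.next k) l → ℤ) =>
      patternTerm t k (s :: l) y ((sumAddEquiv (Fin (s.next k)) (Idx (s.next k) l)).symm p))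
      (patternSum t k (s :: l) y) :=
    (rsum_equiv_iff (sumAddEquiv (Fin (s.next k)) (Idx (s.next k) l)).symm).mpr
      (rsum_patternSum hX hl y)
  refine RSum.fubini h1 hQ fun z => ?_
  have h2 := (h (entries z)).smul (if Antitone z then
    rowWeight t s.o y (entries z) * s.x ^ (y.sum - (entries z).sum) else 0)
  convert h2 using 1
  · ext b
    exact patternTerm_cons k s l y _
  · split_ifs <;> ring

/-- Allows the tail of a list of steps to be rewritten: a scalar valid for every next row comes out
of the sum over that row. -/
theorem patternSum_cons_congr (hX : Generic t X) {k : ℕ} {s : Step K} {l l' : List (Step K)}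
    (hl : Admissible X k (s :: l)) (hl' : Admissible X k (s :: l')) {c : K}
    (h : ∀ z : Multiset ℤ, z.card = s.next k →
      patternSum t (s.next k) l z = c * patternSum t (s.next k) l' z) (y : Multiset ℤ) :
    patternSum t k (s :: l) y = c * patternSum t k (s :: l') y := by
  refine (multisetSum_patternSum_cons hX hl y).unique
    (((multisetSum_patternSum_cons hX hl' y).smul c).congr fun z hz => ?_)
  rw [h z hz]; ring

theorem patternSum_nil (y : Multiset ℤ) : patternSum t 0 [] y = 1 := by
  apply RSum.patternSum_eq
  have : patternTerm t 0 ([] : List (Step K)) y = fun b => if b = 0 then 1 else 0 := by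
    ext b
    rw [if_pos (by ext i; exact i.elim0)]
    simp [patternTerm, patternWeight, patternMonomial]
  rw [this]
  exact rsum_single 0 1

end Patterns

end

end GTHL

namespace GTHL

noncomputable section

/-! ### Rewriting the list of steps -/

section Rewriting

variable {K : Type*} [Field K] {t : K} {X : Finset K}

/-- The character `z ↦ q ^ ∑ z`. -/
def sumChar {q : K} (hq : q ≠ 0) (k : ℕ) : Multiplicative (Fin k → ℤ) →* K where
  toFun z := q ^ ∑ i, z.toAdd i
  map_one' := by simp
  map_mul' z z' := by
    rw [← zpow_add₀ hq, ← Finset.sum_add_distrib]; rfl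

/-- For a character depending only on the sum of the entries, the denominators are `1 - q ^ A.card`.
The regularizer is again independent of the function and of `m`. -/
theorem exists_rsumBy_zpow_sum {q : K} (hq : q ≠ 0) (hq1 : ∀ m : ℕ, m ≠ 0 → q ^ m ≠ 1) (k : ℕ) :
    ∃ Q : AddMonoidAlgebra K (Fin k → ℤ), eps Q ≠ 0 ∧ ∀ (m : ℤ) (f : (Fin k → ℤ) → K), 0 ≤ m →
      OrderInvariant m f → ∃ v, RSumBy Q (fun z => f z * q ^ ∑ i, z i) v := by
  have h0 : eps (twist (sumChar hq k) (killer K Finset.univ)) ≠ 0 := by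
    refine eps_twist_killer_ne_zero fun A _ hA h => hq1 A.card (Finset.card_ne_zero.mpr
      (Finset.nonempty_iff_ne_empty.mpr hA)) ?_
    have h1 : q ^ ∑ i, ind A i = 1 := h
    have h2 : ∑ i, ind A i = (A.card : ℤ) := by simp [ind]
    rwa [h2, zpow_natCast] at h1
  refine ⟨_, h0, fun m f hm hf => rsumBy_exists h0 ?_⟩
  exact act_twist_finite (K := K) (χ := sumChar hq k) (act_killer_finite hm hf (S := Finset.univ)
      (fun d _ i hi => absurd (Finset.mem_univ i) hi))

/-- The exponents `m` at `b` and `-m` at `a` would give a nontrivial relation of degree 0. -/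
theorem Generic.pow_ne_one (hX : Generic t X) {a b : K} (ha : a ∈ X) (hb : b ∈ X) (hab : a ≠ b)
    {m : ℕ} (hm : m ≠ 0) : (b / a) ^ m ≠ 1 := by
  classical
  intro h
  have := hX.indep (Function.update (Function.update (fun _ => 0) a (-m)) b m) ?_ ?_ b hb
  · rw [Function.update_self] at this
    exact hm (by exact_mod_cast this)
  · rw [Finset.sum_update_of_mem hb, ← Finset.erase_eq,
      Finset.sum_update_of_mem (Finset.mem_erase.mpr ⟨hab, ha⟩)]
    simp
  · rw [← Finset.mul_prod_erase _ _ hb, ← Finset.mul_prod_erase _ _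
      (Finset.mem_erase.mpr ⟨hab, ha⟩), Finset.prod_eq_one, Function.update_self,
      Function.update_of_ne hab, Function.update_self, mul_one, ← h, div_pow, zpow_neg,
      zpow_natCast, zpow_natCast, div_eq_mul_inv]
    intro x hx
    obtain ⟨h1, h2, -⟩ := by simpa using hx
    rw [Function.update_of_ne h2, Function.update_of_ne h1, zpow_zero]

/-- The recursion for the sum over patterns with the first two steps combined. -/
theorem rsum_patternSum_two_steps (hX : Generic t X) {k k₂ : ℕ} {s₁ s₂ : Step K}
    {l : List (Step K)} (hl : Admissible X k (s₁ :: s₂ :: l)) (hk : s₂.next (s₁.next k) = k₂)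
    (y : Multiset ℤ) {v : Multiset ℤ → K}
    (hv : ∀ w : Multiset ℤ, w.card = k₂ → MultisetSum (s₁.next k) (fun z =>
      rowWeight t s₁.o y z * rowWeight t s₂.o z w *
        (s₁.x ^ (y.sum - z.sum) * s₂.x ^ (z.sum - w.sum))) (v w)) :
    open Classical in RSum (fun c : Fin k₂ ⊕ Idx k₂ l → ℤ =>
      (if Antitone (fun i => c (Sum.inl i)) then v (entries fun i => c (Sum.inl i)) else 0) *
        patternTerm t k₂ l (entries fun i => c (Sum.inl i)) (fun i => c (Sum.inr i)))
      (patternSum t k (s₁ :: s₂ :: l) y) := by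
  classical
  subst hk
  have m1 : s₁.x ∈ X := hl.mem _ List.mem_cons_self
  have m2 : s₂.x ∈ X := hl.mem _ (List.mem_cons_of_mem _ List.mem_cons_self)
  have n1 := hX.ne_zero _ m1
  have n2 := hX.ne_zero _ m2
  have hne : s₁.x ≠ s₂.x := by
    have := (List.nodup_cons.mp hl.nodup).1
    rw [List.map_cons, List.mem_cons, not_or] at this
    exact this.1
  obtain ⟨Q, hQ, hQ'⟩ := exists_rsumBy_zpow_sum (div_ne_zero n2 n1)
    (fun m hm => hX.pow_ne_one m1 m2 hne hm) (s₁.next k)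
  let N := s₂.next (s₁.next k)
  -- The middle row becomes the inner variable and all lower rows the outer one, so that it is
  -- summed first.
  have e1 := (rsum_equiv_iff ((AddEquiv.prodComm).trans
    (sumAddEquiv (Fin (s₁.next k)) (Fin N ⊕ Idx N l)).symm)).mpr (rsum_patternSum hX hl y)
  refine RSum.fubini e1 hQ fun c => ?_
  set w := entries fun i => c (Sum.inl i) with hw
  -- Both neighbouring rows are fixed during the inner sum, so relabellings must fix the entries of
  -- both.
  obtain ⟨m, hm, hb⟩ := exists_abs_bound (y + w)
  obtain ⟨u, hu⟩ := hQ' m (fun z => if Antitone z then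
    rowWeight t s₁.o y (entries z) * rowWeight t s₂.o (entries z) w else 0) hm (by
      intro φ hφ hfix z
      dsimp only
      rw [entries_comp]
      conv_lhs => rw [← map_eq_self_of_bound hfix (y := y)
          (fun e he => hb e (Multiset.mem_add.mpr (Or.inl he))),
        ← map_eq_self_of_bound hfix (y := w)
          (fun e he => hb e (Multiset.mem_add.mpr (Or.inr he))), rowWeight_map t hφ,
          rowWeight_map t hφ]
      simp only [antitone_comp_iff hφ])
  have hu2 : RSumBy Q (fun z => if Antitone z then rowWeight t s₁.o y (entries z) *
      rowWeight t s₂.o (entries z) w * (s₁.x ^ (y.sum - (entries z).sum) *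
        s₂.x ^ ((entries z).sum - w.sum)) else 0) (s₁.x ^ y.sum * s₂.x ^ (-w.sum) * u) := by
    convert hu.smul (s₁.x ^ y.sum * s₂.x ^ (-w.sum)) using 2 with z
    split_ifs
    · rw [div_zpow, zpow_sub₀ n1, zpow_sub₀ n2, zpow_neg, ← sum_entries]
      field_simp
    · ring
  -- The value found with the common regularizer is the prescribed one, by uniqueness.
  have hu3 : s₁.x ^ y.sum * s₂.x ^ (-w.sum) * u = v w :=
    RSum.unique ⟨Q, hQ, hu2⟩ (hv w (card_entries _))
  rw [hu3] at hu2
  convert hu2.smul ((if Antitone (fun i => c (Sum.inl i)) then 1 else 0) *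
    patternTerm t N l w (fun i => c (Sum.inr i))) using 1
  · ext z
    have h1 : patternTerm t k (s₁ :: s₂ :: l) y
        ((sumAddEquiv (Fin (s₁.next k)) (Fin N ⊕ Idx N l)).symm (z, c)) =
        (if Antitone z then rowWeight t s₁.o y (entries z) * s₁.x ^ (y.sum - (entries z).sum)
          else 0) * patternTerm t (s₁.next k) (s₂ :: l) (entries z) c :=
      patternTerm_cons (t := t) k s₁ (s₂ :: l) y _
    have h2 := patternTerm_cons (t := t) (s₁.next k) s₂ l (entries z) c
    refine h1.trans ?_
    rw [h2, ← hw]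
    split_ifs <;> ring
  · split_ifs <;> ring

theorem Admissible.swap {k : ℕ} {o r : ℕ} {a b : K} {l : List (Step K)} (hk : 1 ≤ k)
    (hl : Admissible X k (⟨o, r, a⟩ :: ⟨0, 0, b⟩ :: l)) :
    Admissible X k (⟨0, 0, b⟩ :: ⟨o, r, a⟩ :: l) := by
  obtain ⟨⟨h1, h2, h3, h4, h5, h6, h7⟩, h8, h9⟩ := hl
  simp only [Step.next] at *
  refine ⟨⟨by simp, by simp, by simpa using hk, h1, h2, ?_, ?_⟩, ?_, ?_⟩
  · simp only [Step.next]; omega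
  · simp only [Step.next]
    convert h7 using 1
    omega
  · rw [List.map_cons, List.map_cons] at *
    exact ((List.Perm.swap _ _ _).nodup_iff).mp h8
  · intro s hs
    apply h9
    simp only [List.mem_cons] at *
    tauto

/-- A shortening step is exchanged with the previous step. -/
theorem patternSum_exchange (hX : Generic t X) {k : ℕ} {o r : ℕ} {a b : K} {l : List (Step K)}
    (hk : 1 ≤ k) (hor : o + r ≠ 0) (hl : Admissible X k (⟨o, r, a⟩ :: ⟨0, 0, b⟩ :: l))
    {y : Multiset ℤ} (hy : y.card = k) :
    patternSum t k (⟨o, r, a⟩ :: ⟨0, 0, b⟩ :: l) y =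
      exchangeFactor t a b o r * patternSum t k (⟨0, 0, b⟩ :: ⟨o, r, a⟩ :: l) y := by
  classical
  have m1 : a ∈ X := hl.mem _ List.mem_cons_self
  have m2 : b ∈ X := hl.mem _ (List.mem_cons_of_mem _ List.mem_cons_self)
  have hne : a ≠ b := by
    have := (List.nodup_cons.mp hl.nodup).1
    rw [List.map_cons, List.mem_cons, not_or] at this
    exact this.1
  have ho : o ≤ 1 := hl.valid.1
  have hr : r ≤ 1 := hl.valid.2.1
  choose v hv1 hv2 using exchange (t := t) (hX.ne_zero _ m1) (hX.ne_zero _ m2) hne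
    (hX.ne_mul _ m1 _ m2 hne) ho hr hor y
  have hk1 : (⟨0, 0, b⟩ : Step K).next ((⟨o, r, a⟩ : Step K).next k) = k + o + r - 2 := by
    simp only [Step.next]; omega
  have hk2 : (⟨o, r, a⟩ : Step K).next ((⟨0, 0, b⟩ : Step K).next k) = k + o + r - 2 := by
    simp only [Step.next]; omega
  have A1 := rsum_patternSum_two_steps hX hl hk1 y (v := fun w => exchangeFactor t a b o r * v w)
    (fun w hw => by
      refine ((hv1 w).fixed (k := (⟨o, r, a⟩ : Step K).next k) fun z hz => ?_).congr fun z hz => ?_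
      · refine if_neg fun h => hz ?_
        simp only [Step.next]; omega
      · refine if_pos ?_
        simp only [Step.next] at hz; omega)
  have A2 := rsum_patternSum_two_steps hX (hl.swap hk) hk2 y (v := v)
    (fun w hw => by
      refine ((hv2 w).fixed (k := (⟨0, 0, b⟩ : Step K).next k) fun z hz => ?_).congr fun z hz => ?_
      · refine if_neg fun h => hz ?_
        simp only [Step.next]; omega
      · refine if_pos ?_
        simp only [Step.next] at hz; omega)
  refine A1.unique ?_
  convert A2.smul (exchangeFactor t a b o r) using 2 with c
  split_ifs <;> ring

/-- Shortening steps with the given variables. -/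
def downSteps (xs : List K) : List (Step K) := xs.map (Step.mk 0 0)

theorem validSteps_downSteps (xs : List K) : ValidSteps xs.length (downSteps xs) := by
  induction xs with
  | nil => rfl
  | cons b xs ih =>
    refine ⟨by simp, by simp, by simp, ?_⟩
    have : (⟨0, 0, b⟩ : Step K).next (b :: xs).length = xs.length := by simp [Step.next]
    rw [this]
    exact ih

theorem map_x_downSteps (xs : List K) : (downSteps xs).map Step.x = xs := by
  rw [downSteps, List.map_map]
  exact List.map_id' xs

theorem admissible_downSteps {xs : List K} (h : xs.Nodup) (hX : ∀ x ∈ xs, x ∈ X) :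
    Admissible X xs.length (downSteps xs) :=
  ⟨validSteps_downSteps xs, by rwa [map_x_downSteps], fun s hs => by
    refine hX _ ?_
    rw [← map_x_downSteps xs]
    exact List.mem_map_of_mem hs⟩

theorem admissible_cons_iff {k : ℕ} {s : Step K} {l : List (Step K)} :
    Admissible X k (s :: l) ↔ s.o ≤ 1 ∧ s.r ≤ 1 ∧ 1 ≤ k + s.o + s.r ∧ s.x ∈ X ∧
      s.x ∉ l.map Step.x ∧ Admissible X (s.next k) l := by
  constructor
  · intro h
    exact ⟨h.valid.1, h.valid.2.1, h.valid.2.2.1, h.mem s List.mem_cons_self,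
      (List.nodup_cons.mp h.nodup).1, h.tail⟩
  · rintro ⟨h1, h2, h3, h4, h5, h6⟩
    exact ⟨⟨h1, h2, h3, h6.valid⟩, List.nodup_cons.mpr ⟨h5, h6.nodup⟩, fun s' hs' => by
      rcases List.mem_cons.mp hs' with rfl | hs'
      · exact h4
      · exact h6.mem s' hs'⟩

theorem patternSum_zero_single (hX : Generic t X) {s : Step K} (hl : Admissible X 0 [s]) :
    patternSum t 0 [s] 0 = 1 := by
  have hn : s.next 0 = 0 := hl.tail.valid
  have h := multisetSum_patternSum_cons hX hl 0
  rw [hn] at h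
  refine h.unique ((multisetSum_singleton 0 1).congr fun z hz => ?_)
  obtain rfl : z = 0 := Multiset.card_eq_zero.mp hz
  rw [if_pos rfl, rowWeight_zero_zero t hl.valid.1, patternSum_nil]
  simp

/-- A step that adds an element at one side is moved past all shortening steps. -/
theorem patternSum_cons_downSteps (hX : Generic t X) {s : Step K} (hs : s.o + s.r = 1)
    {xs : List K} (hl : Admissible X xs.length (s :: downSteps xs)) {y : Multiset ℤ}
    (hy : y.card = xs.length) :
    patternSum t xs.length (s :: downSteps xs) y =
      (xs.map fun b => exchangeFactor t s.x b s.o s.r).prod *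
        patternSum t xs.length (downSteps xs) y := by
  induction xs generalizing y with
  | nil =>
    obtain rfl : y = 0 := Multiset.card_eq_zero.mp hy
    have h1 : patternSum t 0 [s] 0 = 1 := patternSum_zero_single hX hl
    simpa [downSteps, patternSum_nil] using h1
  | cons b xs ih =>
    have h1 := patternSum_exchange hX (o := s.o) (r := s.r) (a := s.x) (b := b)
      (l := downSteps xs) (by simp) (by omega) hl hy
    have h2 : Admissible X (b :: xs).length (⟨0, 0, b⟩ :: ⟨s.o, s.r, s.x⟩ :: downSteps xs) :=
      Admissible.swap (by simp) hl
    have h3 : Admissible X (b :: xs).length (⟨0, 0, b⟩ :: downSteps xs) := by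
      obtain ⟨a1, a2, a3, a4, a5, a6⟩ := admissible_cons_iff.mp hl
      have : s.next (b :: xs).length = (b :: xs).length := by simp only [Step.next]; omega
      rwa [this] at a6
    rw [List.map_cons, List.prod_cons]
    refine h1.trans ?_
    rw [mul_assoc]
    congr 1
    exact patternSum_cons_congr hX h2 h3 (fun z hz => ih h2.tail hz) y

/-- Patterns with a step that adds elements at both sides do not contribute. -/
theorem patternSum_cons_downSteps_eq_zero (hX : Generic t X) {s : Step K} (hs : s.o + s.r = 2)
    {k : ℕ} {xs : List K} (hk : xs.length = k + 1) (hl : Admissible X k (s :: downSteps xs))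
    {y : Multiset ℤ} (hy : y.card = k) :
    patternSum t k (s :: downSteps xs) y = 0 := by
  induction xs generalizing y k with
  | nil => simp at hk
  | cons b xs ih =>
    obtain rfl : xs.length = k := by simpa using hk
    -- Exchanging needs a nonempty current row from which to shorten. With `k = 0` only one
    -- shortening step remains, and the sum is computed directly.
    rcases Nat.eq_zero_or_pos xs.length with h0 | h0
    · obtain rfl : xs = [] := List.length_eq_zero_iff.mp h0
      obtain rfl : y = 0 := Multiset.card_eq_zero.mp hy
      obtain ⟨ho, hr, -, m1, h5, h6⟩ := admissible_cons_iff.mp hl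
      have ho : s.o = 1 := by omega
      have hr : s.r = 1 := by omega
      have hn : s.next 0 = 1 := by simp [Step.next, ho, hr]
      have hn2 : (⟨0, 0, b⟩ : Step K).next 1 = 0 := rfl
      have h := multisetSum_patternSum_cons hX hl 0
      have h6' : Admissible X 1 [⟨0, 0, b⟩] := by
        have := h6
        change Admissible X (s.next 0) [⟨0, 0, b⟩] at this
        rwa [hn] at this
      change MultisetSum (s.next 0) (fun z => rowWeight t s.o 0 z * s.x ^ ((0 : Multiset ℤ).sum - z.sum) *
        patternSum t (s.next 0) [⟨0, 0, b⟩] z) _ at h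
      rw [hn, ho] at h
      have m2 : b ∈ X := h6'.mem _ List.mem_cons_self
      have n1 := hX.ne_zero _ m1
      have n2 := hX.ne_zero _ m2
      have hne : s.x ≠ b := by simpa [downSteps] using h5
      have hq := hX.pow_ne_one m1 m2 hne one_ne_zero
      rw [pow_one] at hq
      refine h.unique ((multisetSum_one ?_).congr (F := fun z => rowWeight t 1 0 z *
        s.x ^ ((0 : Multiset ℤ).sum - z.sum) * b ^ z.sum) fun z hz => ?_)
      -- The only nonempty row has one entry, unrestricted by the empty rows around it, so the sum
      -- is a geometric series over `ℤ`.
      · have := (rsum_geometric_all (div_ne_zero n2 n1) hq).smul (1 - t)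
        rw [mul_zero] at this
        convert this using 2 with i
        rw [rowWeight, if_pos (interlace_one_singleton i)]
        simp only [Multiset.toFinset_singleton, Finset.prod_singleton, Multiset.count_zero,
          Multiset.count_singleton_self, Multiset.sum_zero,
          Multiset.sum_singleton, zero_sub, div_zpow, zpow_neg, siteWeight]
        simp
        field_simp
      · congr 1
        have h7 := multisetSum_patternSum_cons hX h6' z
        rw [hn2] at h7
        refine (multisetSum_singleton 0 _).unique (h7.congr fun u hu => ?_)
        obtain rfl : u = 0 := Multiset.card_eq_zero.mp hu
        obtain ⟨i, rfl⟩ := Multiset.card_eq_one.mp hz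
        rw [if_pos rfl, patternSum_nil, rowWeight, if_pos (interlace_singleton_zero i)]
        simp
    · have h1 := patternSum_exchange hX (o := s.o) (r := s.r) (a := s.x) (b := b)
        (l := downSteps xs) h0 (by omega) hl hy
      have h2 : Admissible X xs.length (⟨0, 0, b⟩ :: ⟨s.o, s.r, s.x⟩ :: downSteps xs) :=
        Admissible.swap h0 hl
      refine h1.trans ?_
      have h3 := patternSum_cons_congr hX (c := 0) h2 h2 (fun z hz => by
        rw [zero_mul]
        refine ih ?_ h2.tail hz
        simp only [Step.next]; omega) y
      rw [h3]; simp

/-- The variables of the shortening steps. -/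
def downVars : List (Step K) → List K
  | [] => []
  | s :: l => if s.o = 0 ∧ s.r = 0 then s.x :: downVars l else downVars l

/-- The product of the exchange factors of all lengthening or length preserving steps with all
later shortening steps. -/
def stepFactor (t : K) : List (Step K) → K
  | [] => 1
  | s :: l => (if s.o = 0 ∧ s.r = 0 then 1 else
      ((downVars l).map fun b => exchangeFactor t s.x b s.o s.r).prod) * stepFactor t l

theorem downVars_sublist (l : List (Step K)) : (downVars l).Sublist (l.map Step.x) := by
  induction l with
  | nil => simp [downVars]
  | cons s l ih =>
    rw [downVars, List.map_cons]
    split_ifs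
    · exact ih.cons_cons _
    · exact ih.cons _

theorem length_downVars {k : ℕ} {l : List (Step K)} (h : ValidSteps k l)
    (hup : ∀ s ∈ l, s.o + s.r ≠ 2) : (downVars l).length = k := by
  induction l generalizing k with
  | nil => simpa [downVars] using h.symm
  | cons s l ih =>
    have h1 := ih h.2.2.2 fun s hs => hup s (List.mem_cons_of_mem _ hs)
    have h2 := hup s List.mem_cons_self
    have h3 := h.1
    have h4 := h.2.1
    have h5 := h.2.2.1
    rw [Step.next] at h1
    rw [downVars]
    split_ifs with h6
    · rw [List.length_cons]; omega
    · omega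

theorem Admissible.downSteps {k : ℕ} {l : List (Step K)} (hl : Admissible X k l)
    (hup : ∀ s ∈ l, s.o + s.r ≠ 2) : Admissible X k (downSteps (downVars l)) := by
  have := admissible_downSteps (X := X) (hl.nodup.sublist (downVars_sublist l)) fun x hx => by
    obtain ⟨s, hs, rfl⟩ := List.mem_map.mp ((downVars_sublist l).subset hx)
    exact hl.mem s hs
  rwa [length_downVars hl.valid hup] at this

/-- Work from the end of the list: the tail is already a list of shortening steps, and a step with
`o + r = 1` in front moves through it, collecting its exchange factors. -/
theorem patternSum_eq_mul (hX : Generic t X) {k : ℕ} {l : List (Step K)} (hl : Admissible X k l)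
    (hup : ∀ s ∈ l, s.o + s.r ≠ 2) {y : Multiset ℤ} (hy : y.card = k) :
    patternSum t k l y = stepFactor t l * patternSum t k (downSteps (downVars l)) y := by
  induction l generalizing k y with
  | nil => rw [stepFactor, one_mul]; rfl
  | cons s l ih =>
    have hup' : ∀ s ∈ l, s.o + s.r ≠ 2 := fun s hs => hup s (List.mem_cons_of_mem _ hs)
    have h2 := hup s List.mem_cons_self
    obtain ⟨a1, a2, a3, a4, a5, a6⟩ := admissible_cons_iff.mp hl
    have b1 : Admissible X k (s :: GTHL.downSteps (downVars l)) :=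
      admissible_cons_iff.mpr ⟨a1, a2, a3, a4, fun h => a5 ((downVars_sublist l).subset
        (by rwa [map_x_downSteps] at h)), a6.downSteps hup'⟩
    rw [patternSum_cons_congr hX hl b1 (fun z hz => ih a6 hup' hz) y, stepFactor, downVars]
    split_ifs with h6
    · rw [one_mul]
      congr 2
      obtain ⟨o, r, x⟩ := s
      obtain ⟨rfl, rfl⟩ := h6
      rfl
    · have h7 : s.o + s.r = 1 := by omega
      have h8 := length_downVars a6.valid hup'
      have h9 : (downVars l).length = k := by rw [h8, Step.next]; omega
      rw [← h9] at b1 hy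
      have := patternSum_cons_downSteps hX h7 b1 hy
      rw [h9] at this
      rw [this]; ring

/-- Behind the last step with `o + r = 2` the tail reduces to shortening steps, so that step gives
0. The steps in front of it preserve the vanishing. -/
theorem patternSum_eq_zero (hX : Generic t X) {k : ℕ} {l : List (Step K)} (hl : Admissible X k l)
    (hup : ∃ s ∈ l, s.o + s.r = 2) {y : Multiset ℤ} (hy : y.card = k) :
    patternSum t k l y = 0 := by
  induction l generalizing k y with
  | nil => simp at hup
  | cons s l ih =>
    obtain ⟨a1, a2, a3, a4, a5, a6⟩ := admissible_cons_iff.mp hl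
    by_cases hup' : ∃ s ∈ l, s.o + s.r = 2
    · have := patternSum_cons_congr hX (c := 0) hl hl (fun z hz => by
        rw [zero_mul]; exact ih a6 hup' hz) y
      rw [this, zero_mul]
    · push Not at hup'
      have hs : s.o + s.r = 2 := by
        obtain ⟨s', hs', h⟩ := hup
        rcases List.mem_cons.mp hs' with rfl | hs'
        · exact h
        · exact absurd h (hup' s' hs')
      have b1 : Admissible X k (s :: GTHL.downSteps (downVars l)) :=
        admissible_cons_iff.mpr ⟨a1, a2, a3, a4, fun h => a5 ((downVars_sublist l).subset
          (by rwa [map_x_downSteps] at h)), a6.downSteps hup'⟩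
      rw [patternSum_cons_congr hX hl b1 (fun z hz => patternSum_eq_mul hX a6 hup' hz) y,
        patternSum_cons_downSteps_eq_zero hX hs ?_ b1 hy, mul_zero]
      rw [length_downVars a6.valid hup', Step.next]; omega

theorem eq_replicate_of_interlace {k : ℕ} {c : ℤ} {z : Multiset ℤ}
    (h : Interlace 0 (Multiset.replicate (k + 1) c) z) (hz : z.card = k) :
    z = Multiset.replicate k c := by
  rw [Multiset.eq_replicate]
  refine ⟨hz, fun e he => ?_⟩
  have h1 := (h (c + 1)).1
  rw [countGE_replicate, if_neg (by omega)] at h1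
  have h2 := (h c).2
  rw [countGE_replicate, if_pos le_rfl] at h2
  have h3 : countGE z c = z.card := le_antisymm (countGE_le_card z c) (by omega)
  rw [countGE, Multiset.countP_eq_card] at h3
  have h4 : ¬ c + 1 ≤ e := by
    intro h5
    have : 0 < countGE z (c + 1) := Multiset.countP_pos.mpr ⟨e, he, h5⟩
    omega
  have := h3 e he
  omega

theorem interlace_replicate (k : ℕ) (c : ℤ) :
    Interlace 0 (Multiset.replicate (k + 1) c) (Multiset.replicate k c) := by
  intro x
  rw [countGE_replicate, countGE_replicate]
  split_ifs <;> omega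

/-- Interlacing forces every row to be constant zero, and multiplicities only decrease, so all site
weights are 1. -/
theorem patternSum_downSteps_replicate (hX : Generic t X) {xs : List K} (h : xs.Nodup)
    (hxs : ∀ x ∈ xs, x ∈ X) :
    patternSum t xs.length (downSteps xs) (Multiset.replicate xs.length 0) = 1 := by
  induction xs with
  | nil => exact patternSum_nil _
  | cons b xs ih =>
    have hl := admissible_downSteps h hxs
    have h1 := multisetSum_patternSum_cons hX hl (Multiset.replicate (b :: xs).length 0)
    have hn : (⟨0, 0, b⟩ : Step K).next (b :: xs).length = xs.length := by simp [Step.next]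
    rw [hn] at h1
    change MultisetSum xs.length (fun z => rowWeight t 0 (Multiset.replicate (xs.length + 1) 0) z *
      b ^ ((Multiset.replicate (xs.length + 1) 0).sum - z.sum) *
        patternSum t xs.length (downSteps xs) z) _ at h1
    have h2 := multisetSum_singleton (Multiset.replicate xs.length 0) (1 : K)
    rw [Multiset.card_replicate] at h2
    refine h1.unique (h2.congr fun z hz => ?_)
    split_ifs with h3
    · rw [h3, ih (List.nodup_cons.mp h).2 fun x hx => hxs x (List.mem_cons_of_mem _ hx),
        rowWeight, if_pos (interlace_replicate _ _), Finset.prod_eq_one]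
      · simp
      · intro x hx
        refine siteWeight_of_le t ?_
        rw [Multiset.count_replicate, Multiset.count_replicate]
        split_ifs <;> omega
    · rw [rowWeight, if_neg fun h4 => h3 (eq_replicate_of_interlace h4 hz)]
      ring

/-- The sum over all patterns with constant top row. -/
theorem patternSum_replicate (hX : Generic t X) {k : ℕ} {l : List (Step K)}
    (hl : Admissible X k l) (hup : ∀ s ∈ l, s.o + s.r ≠ 2) :
    patternSum t k l (Multiset.replicate k 0) = stepFactor t l := by
  rw [patternSum_eq_mul hX hl hup (Multiset.card_replicate _ _)]
  have h1 := patternSum_downSteps_replicate hX (hl.nodup.sublist (downVars_sublist l))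
    (fun x hx => by
      obtain ⟨s, hs, rfl⟩ := List.mem_map.mp ((downVars_sublist l).subset hx)
      exact hl.mem s hs)
  rw [length_downVars hl.valid hup] at h1
  rw [h1, mul_one]

end Rewriting

end

end GTHL

namespace GTHL

noncomputable section

/-! ### Rational functions represented by series and their specializations -/

section Specialization

variable {ι : Type} [Fintype ι] {R : Type} [CommRing R]

/-- A polynomial as a Laurent polynomial. -/
def toLaurent : MvPolynomial ι R →ₐ[R] AddMonoidAlgebra R (ι → ℤ) :=
  open Classical in MvPolynomial.aeval fun i => AddMonoidAlgebra.single (Pi.single i 1) 1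

theorem toLaurent_monomial (b : ι →₀ ℕ) (c : R) :
    toLaurent (MvPolynomial.monomial b c) = AddMonoidAlgebra.single (fun i => (b i : ℤ)) c := by
  classical
  rw [toLaurent, MvPolynomial.aeval_monomial, Finsupp.prod_fintype _ _ (fun i => by simp)]
  have h : ∀ s : Finset ι, ∏ i ∈ s, (AddMonoidAlgebra.single (Pi.single i (1 : ℤ)) (1 : R) :
      AddMonoidAlgebra R (ι → ℤ)) ^ b i = AddMonoidAlgebra.single
        (∑ i ∈ s, b i • (Pi.single i (1 : ℤ) : ι → ℤ)) 1 := by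
    intro s
    induction s using Finset.induction_on with
    | empty => rfl
    | insert i s hi ih =>
      rw [Finset.prod_insert hi, Finset.sum_insert hi, ih, AddMonoidAlgebra.single_pow,
        AddMonoidAlgebra.single_mul_single, one_pow, one_mul]
  convert congrArg (fun z => algebraMap R (AddMonoidAlgebra R (ι → ℤ)) c * z) (h Finset.univ) using 1
  rw [AddMonoidAlgebra.coe_algebraMap, Function.comp, Algebra.algebraMap_self, RingHom.id_apply,
    AddMonoidAlgebra.single_mul_single, zero_add, mul_one]
  congr 1
  ext j
  simp [Finset.sum_apply, Pi.single_apply]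

theorem mulSeries_eq_act (Q : MvPolynomial ι R) (S : (ι → ℤ) → R) :
    mulSeries Q S = act (toLaurent Q) S := by
  ext a
  have h : act (toLaurent Q) S =
      ∑ b ∈ Q.support, act (AddMonoidAlgebra.single (fun i => (b i : ℤ)) (Q.coeff b)) S := by
    conv_lhs => rw [MvPolynomial.as_sum Q, map_sum, map_sum, LinearMap.sum_apply]
    exact Finset.sum_congr rfl fun b _ => by rw [toLaurent_monomial]
  rw [h, Finset.sum_apply]
  exact Finset.sum_congr rfl fun b _ => by rw [act_single]; rfl

theorem exists_toLaurent_eq_killer [DecidableEq ι] (S : Finset ι) :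
    ∃ Q : MvPolynomial ι R, toLaurent Q = killer R S := by
  refine ⟨∏ A ∈ S.powerset.erase ∅, (1 - MvPolynomial.monomial
    (Finsupp.equivFunOnFinite.symm fun i => if i ∈ A then 1 else 0) 1), ?_⟩
  rw [map_prod, killer]
  refine Finset.prod_congr rfl fun A _ => ?_
  rw [map_sub, map_one, toLaurent_monomial]
  congr 2
  ext i
  simp [ind]

variable {K : Type} [Field K] [Algebra R K]

/-- The character `b ↦ ∏ i, y i ^ b i`. -/
def prodChar {y : ι → K} (hy : ∀ i, y i ≠ 0) : Multiplicative (ι → ℤ) →* K where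
  toFun b := ∏ i, y i ^ b.toAdd i
  map_one' := by simp
  map_mul' b b' := by
    rw [← Finset.prod_mul_distrib]
    exact Finset.prod_congr rfl fun i _ => zpow_add₀ (hy i) _ _

theorem prodChar_ofAdd {y : ι → K} (hy : ∀ i, y i ≠ 0) (b : ι → ℤ) :
    prodChar hy (Multiplicative.ofAdd b) = ∏ i, y i ^ b i := rfl

/-- Connects the two languages: evaluating a polynomial at `y` is twisting by the monomials in `y`
and then augmenting. -/
theorem aeval_eq_eps_twist {y : ι → K} (hy : ∀ i, y i ≠ 0) (Q : MvPolynomial ι R) :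
    MvPolynomial.aeval y Q = eps (twist (prodChar hy) (toLaurent Q)) := by
  induction Q using MvPolynomial.induction_on' with
  | monomial b c =>
    rw [toLaurent_monomial, twist_single, eps_single, MvPolynomial.aeval_monomial, prodChar_ofAdd,
      Finsupp.prod_fintype _ _ (fun i => by simp)]
    simp
  | add p q hp hq => rw [map_add, map_add, map_add, map_add, hp, hq]

variable [IsDomain R]

/-- A monomial of large degree in every variable clears the negative exponents, and it does not
vanish under the specialization. -/
theorem exists_laurentToFrac_eq (p : (ι → ℤ) →₀ R) {y : ι → K} (hy : ∀ i, y i ≠ 0) :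
    ∃ P D : MvPolynomial ι R, D ≠ 0 ∧ MvPolynomial.aeval y D ≠ 0 ∧
      laurentToFrac p = algebraMap _ (FractionRing (MvPolynomial ι R)) P / algebraMap _ _ D ∧
      MvPolynomial.aeval y P = (p.sum fun a c => algebraMap R K c * ∏ i, y i ^ a i) *
        MvPolynomial.aeval y D := by
  classical
  set N : ι → ℕ := fun i => ∑ a ∈ p.support, (a i).natAbs with hN
  have hpos : ∀ a ∈ p.support, ∀ i, 0 ≤ a i + N i := by
    intro a ha i
    have : (a i).natAbs ≤ N i :=
      Finset.single_le_sum (f := fun a : ι → ℤ => (a i).natAbs) (fun _ _ => Nat.zero_le _) ha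
    omega
  let L := FractionRing (MvPolynomial ι R)
  let D : MvPolynomial ι R := ∏ i, MvPolynomial.X i ^ N i
  let P : MvPolynomial ι R := p.sum fun a c =>
    MvPolynomial.C c * ∏ i, MvPolynomial.X i ^ (a i + N i).toNat
  have hX : ∀ i, algebraMap (MvPolynomial ι R) L (MvPolynomial.X i) ≠ 0 := fun i => by
    rw [Ne, FaithfulSMul.algebraMap_eq_zero_iff]
    exact MvPolynomial.X_ne_zero i
  have hD : D ≠ 0 := Finset.prod_ne_zero_iff.mpr fun i _ => pow_ne_zero _ (MvPolynomial.X_ne_zero i)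
  have key : ∀ {F : Type} [Field F] (z : ι → F), (∀ i, z i ≠ 0) → ∀ a ∈ p.support,
      ∏ i, z i ^ (a i + N i).toNat = (∏ i, z i ^ a i) * ∏ i, z i ^ N i := by
    intro F _ z hz a ha
    rw [← Finset.prod_mul_distrib]
    refine Finset.prod_congr rfl fun i _ => ?_
    rw [← zpow_natCast, Int.toNat_of_nonneg (hpos a ha i), zpow_add₀ (hz i), zpow_natCast]
  refine ⟨P, D, hD, ?_, ?_, ?_⟩
  · rw [map_prod]
    exact Finset.prod_ne_zero_iff.mpr fun i _ => by
      rw [map_pow, MvPolynomial.aeval_X]; exact pow_ne_zero _ (hy i)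
  · rw [eq_div_iff (by rw [Ne, FaithfulSMul.algebraMap_eq_zero_iff]; exact hD)]
    simp only [laurentToFrac, P, D, Finsupp.sum, map_sum, Finset.sum_mul, map_mul, map_prod, map_pow]
    refine Finset.sum_congr rfl fun a ha => ?_
    rw [key _ hX a ha, mul_assoc]
    rfl
  · simp only [P, D, Finsupp.sum, map_sum, Finset.sum_mul, map_mul, map_prod, map_pow,
      MvPolynomial.aeval_X, MvPolynomial.aeval_C]
    refine Finset.sum_congr rfl fun a ha => ?_
    rw [key _ hy a ha, mul_assoc]

/-- A series which is annihilated up to a Laurent polynomial by a polynomial that does not vanish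
under the specialization represents a rational function. The value of its specialization is the
regularized sum of the specialized series. -/
theorem exists_hasRationalForm_hasSpecialization {S : (ι → ℤ) → R} {Q : MvPolynomial ι R}
    {y : ι → K} (hy : ∀ i, y i ≠ 0) (hQ : MvPolynomial.aeval y Q ≠ 0)
    (hfin : (act (toLaurent Q) S).support.Finite) {r : K}
    (hr : RSum (fun b => algebraMap R K (S b) * ∏ i, y i ^ b i) r) :
    ∃ σ, HasRationalForm S σ ∧ HasSpecialization y σ r := by
  classical
  have hQ0 : Q ≠ 0 := by rintro rfl; simp at hQ
  have hQL : algebraMap (MvPolynomial ι R) (FractionRing (MvPolynomial ι R)) Q ≠ 0 := by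
    rwa [Ne, FaithfulSMul.algebraMap_eq_zero_iff]
  set p : (ι → ℤ) →₀ R := Finsupp.ofSupportFinite _ hfin with hp
  obtain ⟨P, D, hD, hD', h1, h2⟩ := exists_laurentToFrac_eq p hy
  have hDL : algebraMap (MvPolynomial ι R) (FractionRing (MvPolynomial ι R)) D ≠ 0 := by
    rwa [Ne, FaithfulSMul.algebraMap_eq_zero_iff]
  refine ⟨laurentToFrac p / algebraMap _ _ Q, ⟨Q, p, hQ0, fun a => ?_, rfl⟩, P, D * Q, ?_, ?_, ?_⟩
  · rw [mulSeries_eq_act]; rfl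
  · rw [map_mul]; exact mul_ne_zero hD' hQ
  · rw [h1, map_mul, div_div]
  · have e1 := aeval_eq_eps_twist hy Q
    have hQ' := hQ
    rw [e1] at hQ'
    have e2 := act_twist_finite (K := K) (χ := prodChar hy) hfin
    obtain ⟨r', hr'⟩ := rsumBy_exists hQ' e2
    -- The same `Q` that clears the series also regularizes the specialized series, so uniqueness
    -- identifies the quotient with `r`.
    have e3 : r' = r := RSum.unique ⟨_, hQ', hr'⟩ hr
    subst e3
    have e4 := hr'.2
    have e5 : ∑ᶠ a, act (twist (prodChar hy) (toLaurent Q)) (fun b => algebraMap R K (S b) *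
        prodChar hy (Multiplicative.ofAdd b)) a =
        p.sum fun a c => algebraMap R K c * ∏ i, y i ^ a i := by
      rw [finsum_eq_sum_of_support_subset (s := p.support)]
      · refine Finset.sum_congr rfl fun a _ => ?_
        rw [act_twist]; rfl
      · intro a ha
        rw [Finset.mem_coe, Finsupp.mem_support_iff]
        intro h0
        apply ha
        rw [act_twist]
        have : act (toLaurent Q) S a = 0 := h0
        rw [this, map_zero, zero_mul]
    rw [h2, map_mul, ← e5, e4, e1]
    rw [e1] at hQ
    field_simp

end Specialization

end

end GTHL

namespace GTHL

noncomputable section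

open Filter Topology

/-! ### Faces of polyhedra -/

section Halfspaces

variable {ι : Type} [Fintype ι] {I : Type*} [Finite I] {L : I → (ι → ℝ) →L[ℝ] ℝ} {c : I → ℝ}

/-- The polyhedron given by a system of inequalities. -/
def halfspaces (L : I → (ι → ℝ) →L[ℝ] ℝ) (c : I → ℝ) : Set (ι → ℝ) := {s | ∀ i, c i ≤ L i s}

theorem eventually_lt_segment (f : (ι → ℝ) →L[ℝ] ℝ) {v d : ι → ℝ} {a : ℝ} (h : a < f v) :
    ∀ᶠ ε : ℝ in 𝓝[>] 0, a < f (v + ε • d) := by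
  have h1 : Continuous fun ε : ℝ => f (v + ε • d) := by fun_prop
  have h2 : Tendsto (fun ε : ℝ => f (v + ε • d)) (𝓝 0) (𝓝 (f v)) := by
    simpa using h1.tendsto 0
  exact (h2.eventually_const_lt h).filter_mono nhdsWithin_le_nhds

/-- The minimal face of a polyhedron containing a point is described by the inequalities which are
equalities at this point. -/
theorem minFace_halfspaces {x : ι → ℝ} (hx : x ∈ halfspaces L c) :
    minFace (halfspaces L c) x =
      {s | s ∈ halfspaces L c ∧ ∀ i, L i x = c i → L i s = c i} := by
  classical
  have := Fintype.ofFinite I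
  apply Set.Subset.antisymm
  · refine Set.sInter_subset_of_mem ⟨⟨⟨x, hx, fun i h => h⟩, fun _ => ?_⟩, hx, fun i h => h⟩
    -- Over the polyhedron, this functional is maximal exactly where every inequality tight at `x`
    -- is an equality.
    refine ⟨-∑ i with L i x = c i, L i, ?_⟩
    have hsum : ∀ s, (-∑ i with L i x = c i, L i : (ι → ℝ) →L[ℝ] ℝ) s =
        -∑ i with L i x = c i, L i s := fun s => by
      rw [neg_apply, sum_apply]
    ext s
    simp only [Set.mem_ofPred_eq, hsum, neg_le_neg_iff]
    refine and_congr_right fun hs => ⟨fun h y hy => ?_, fun h i hi => ?_⟩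
    · refine Finset.sum_le_sum fun i hi => ?_
      rw [h i (Finset.mem_filter.mp hi).2]
      exact hy i
    · have h1 := h x hx
      have h2 : ∑ i with L i x = c i, L i x = ∑ i with L i x = c i, c i :=
        Finset.sum_congr rfl fun i hi => (Finset.mem_filter.mp hi).2
      rw [h2] at h1
      have h3 := (Finset.sum_eq_sum_iff_of_le fun i _ => hs i).mp
        (le_antisymm (Finset.sum_le_sum fun i (_ : i ∈ Finset.univ.filter fun i => L i x = c i) =>
          hs i) h1)
      exact (h3 i (Finset.mem_filter.mpr ⟨Finset.mem_univ i, hi⟩)).symm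
  · rintro s ⟨hs, hsx⟩ F ⟨⟨hne, hF⟩, hxF⟩
    obtain ⟨f, rfl⟩ := hF hne
    -- The segment from `s` through `x` continues a little beyond `x` inside the polyhedron, so a
    -- functional that is maximal at `x` cannot be smaller at `s`.
    have h1 : ∀ᶠ ε : ℝ in 𝓝[>] 0, ∀ i, c i ≤ L i (x + ε • (x - s)) := by
      refine eventually_all.mpr fun i => ?_
      by_cases hi : L i x = c i
      · refine Eventually.of_forall fun ε => ?_
        rw [map_add, map_smul, map_sub, hi, hsx i hi]
        simp
      · exact (eventually_lt_segment _ (lt_of_le_of_ne (hx i) (Ne.symm hi))).mono fun _ => le_of_lt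
    obtain ⟨ε, h2, h3⟩ := (h1.and self_mem_nhdsWithin).exists
    refine ⟨hs, fun y hy => (hxF.2 y hy).trans ?_⟩
    have h4 := hxF.2 _ h2
    rw [map_add, map_smul, map_sub, smul_eq_mul] at h4
    have h5 : ε * (f x - f s) ≤ 0 := by linarith
    have h6 : f x - f s ≤ 0 := by
      by_contra h
      exact absurd h5 (not_le.mpr (mul_pos h3 (not_le.mp h)))
    linarith

/-- Strict inequalities at `v` persist along a short segment and impose no condition on the cone. -/
theorem tangentCone_halfspaces {v : ι → ℝ} (hv : v ∈ halfspaces L c) :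
    tangentCone (halfspaces L c) v =
      halfspaces (fun i : {i // L i v = c i} => L i) (fun i => c i) := by
  ext y
  constructor
  · rintro ⟨x, hx, a, ha, rfl⟩ ⟨i, hi⟩
    have := mul_nonneg ha (sub_nonneg.mpr (hx i))
    simp only [map_add, map_smul, map_sub, smul_eq_mul, hi]
    linarith
  · intro hy
    have h1 : ∀ᶠ ε : ℝ in 𝓝[>] 0, ∀ i, c i ≤ L i (v + ε • (y - v)) ∧ 0 < ε := by
      refine eventually_all.mpr fun i => ?_
      by_cases hi : L i v = c i
      · filter_upwards [self_mem_nhdsWithin] with ε hε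
        refine ⟨?_, hε⟩
        have := mul_nonneg (le_of_lt hε) (sub_nonneg.mpr (hy ⟨i, hi⟩))
        simp only [map_add, map_smul, map_sub, smul_eq_mul, hi]
        linarith
      · filter_upwards [self_mem_nhdsWithin,
          eventually_lt_segment _ (lt_of_le_of_ne (hv i) (Ne.symm hi))] with ε hε h
        exact ⟨h.le, hε⟩
    obtain ⟨ε, h2, h3⟩ := (h1.and self_mem_nhdsWithin).exists
    refine ⟨_, fun i => (h2 i).1, ε⁻¹, (inv_pos.mpr h3).le, ?_⟩
    rw [add_sub_cancel_left, smul_smul, inv_mul_cancel₀ (ne_of_gt h3), one_smul]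
    abel

/-- Close to the apex, a point of the segment towards `b` lies in the polyhedron, and its tight
inequalities are those tight at both ends. -/
theorem eventually_tight_iff {v b : ι → ℝ} (hv : v ∈ halfspaces L c)
    (hb : b ∈ tangentCone (halfspaces L c) v) :
    ∀ᶠ ε : ℝ in 𝓝[>] 0, v + ε • (b - v) ∈ halfspaces L c ∧
      ∀ i, L i (v + ε • (b - v)) = c i ↔ L i v = c i ∧ L i b = c i := by
  rw [tangentCone_halfspaces hv] at hb
  have h1 : ∀ᶠ ε : ℝ in 𝓝[>] 0, ∀ i, c i ≤ L i (v + ε • (b - v)) ∧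
      (L i (v + ε • (b - v)) = c i ↔ L i v = c i ∧ L i b = c i) := by
    refine eventually_all.mpr fun i => ?_
    by_cases hi : L i v = c i
    · filter_upwards [self_mem_nhdsWithin] with ε hε
      have h0 : 0 < ε := hε
      have := mul_nonneg h0.le (sub_nonneg.mpr (hb ⟨i, hi⟩))
      simp only [map_add, map_smul, map_sub, smul_eq_mul, hi, true_and]
      refine ⟨by linarith, ?_⟩
      rw [add_eq_left, mul_eq_zero, sub_eq_zero]
      exact ⟨fun h => h.resolve_left h0.ne', Or.inr⟩
    · filter_upwards [eventually_lt_segment _ (lt_of_le_of_ne (hv i) (Ne.symm hi))] with ε h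
      exact ⟨h.le, fun h' => absurd h' h.ne', fun h' => absurd h'.1 hi⟩
  exact h1.mono fun ε h => ⟨fun i => (h i).1, fun i => (h i).2⟩

theorem minFace_tangentCone_inter {v b x : ι → ℝ} (hv : v ∈ halfspaces L c)
    (hb : b ∈ tangentCone (halfspaces L c) v) (hx : x ∈ halfspaces L c)
    (h : ∀ i, L i x = c i ↔ L i v = c i ∧ L i b = c i) :
    minFace (tangentCone (halfspaces L c) v) b ∩ halfspaces L c = minFace (halfspaces L c) x := by
  rw [tangentCone_halfspaces hv] at *
  rw [minFace_halfspaces hb, minFace_halfspaces hx]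
  ext s
  constructor
  · rintro ⟨⟨-, h1⟩, h2⟩
    exact ⟨h2, fun i hi => h1 ⟨i, ((h i).mp hi).1⟩ ((h i).mp hi).2⟩
  · rintro ⟨h1, h2⟩
    exact ⟨⟨fun i => h1 i, fun i hi => h2 i ((h i).mpr ⟨i.2, hi⟩)⟩, h1⟩

end Halfspaces

/-! ### Faces of the Gelfand–Tsetlin polytope -/

section GelfandTsetlin

variable {n : ℕ} {l : Fin n → ℤ}

/-- The positions `u` and `w` are adjacent, the entry at `w` being at most the entry at `u`. -/
def Covers (u w : GTIndex n) : Prop :=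
  (w.row = u.row + 1 ∧ w.col = u.col) ∨ (u.row = w.row + 1 ∧ w.col = u.col + 1)

theorem mem_gtPolytope_iff {s : GTIndex n → ℝ} : s ∈ gtPolytope l ↔
    (∀ p : GTIndex n, p.row = 0 → s p = l p.1.2) ∧ ∀ u w, Covers u w → s w ≤ s u := by
  constructor
  · rintro ⟨h1, h2, h3⟩
    refine ⟨h1, fun u w h => ?_⟩
    rcases h with h | h
    · exact h2 u w h.1 h.2
    · exact h3 w u h.1 h.2
  · rintro ⟨h1, h2⟩
    exact ⟨h1, fun p q h h' => h2 p q (Or.inl ⟨h, h'⟩), fun p q h h' => h2 q p (Or.inr ⟨h, h'⟩)⟩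

/-- A coordinate as a linear form. -/
def coord (p : GTIndex n) : (GTIndex n → ℝ) →L[ℝ] ℝ :=
  ContinuousLinearMap.proj (R := ℝ) (φ := fun _ => ℝ) p

@[simp]
theorem coord_apply (p : GTIndex n) (s : GTIndex n → ℝ) : coord p s = s p := rfl

open Classical in
/-- The linear forms of the inequalities of the Gelfand–Tsetlin polytope. -/
def gtForm : GTIndex n ⊕ GTIndex n ⊕ (GTIndex n × GTIndex n) → (GTIndex n → ℝ) →L[ℝ] ℝ
  -- The prescribed top row is encoded by two opposite inequalities; all irrelevant indices carry
  -- the vacuous inequality `0 ≤ 0`.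
  | .inl p => if p.row = 0 then coord p else 0
  | .inr (.inl p) => if p.row = 0 then -coord p else 0
  | .inr (.inr q) => if Covers q.1 q.2 then
      coord q.1 - coord q.2 else 0

/-- The constants of the inequalities of the Gelfand–Tsetlin polytope. -/
def gtConst (l : Fin n → ℤ) : GTIndex n ⊕ GTIndex n ⊕ (GTIndex n × GTIndex n) → ℝ
  | .inl p => if p.row = 0 then (l p.1.2 : ℝ) else 0
  | .inr (.inl p) => if p.row = 0 then -(l p.1.2 : ℝ) else 0
  | .inr (.inr _) => 0

theorem gtForm_pair (u w : GTIndex n) (s : GTIndex n → ℝ) (h : Covers u w) :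
    gtForm (.inr (.inr (u, w))) s = s u - s w := by
  simp [gtForm, h]

theorem gtPolytope_eq_halfspaces : gtPolytope l = halfspaces gtForm (gtConst l) := by
  ext s
  rw [mem_gtPolytope_iff]
  constructor
  · rintro ⟨h1, h2⟩ (p | p | ⟨u, w⟩)
    · by_cases h : p.row = 0
      · simp [gtForm, gtConst, h, h1 p h]
      · simp [gtForm, gtConst, h]
    · by_cases h : p.row = 0
      · simp [gtForm, gtConst, h, h1 p h]
      · simp [gtForm, gtConst, h]
    · by_cases h : Covers u w
      · simp [gtForm, gtConst, h, h2 u w h]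
      · simp [gtForm, gtConst, h]
  · intro h
    refine ⟨fun p hp => ?_, fun u w hp => ?_⟩
    · have h1 := h (.inl p)
      have h2 := h (.inr (.inl p))
      simp only [gtForm, gtConst, hp, if_true, neg_apply,
        coord_apply] at h1 h2
      linarith
    · have := h (.inr (.inr (u, w)))
      rw [gtForm_pair u w s hp] at this
      simp only [gtConst] at this
      linarith

theorem gtForm_tight_iff {x s : GTIndex n → ℝ} (h0 : ∀ p : GTIndex n, p.row = 0 → s p = l p.1.2) :
    (∀ i, gtForm i x = gtConst l i → gtForm i s = gtConst l i) ↔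
      ∀ u w, Covers u w → x u = x w → s u = s w := by
  constructor
  · intro h u w hu hx
    have := h (.inr (.inr (u, w))) (by rw [gtForm_pair u w x hu, hx]; simp [gtConst])
    rw [gtForm_pair u w s hu] at this
    simp only [gtConst] at this
    linarith
  · rintro h (p | p | ⟨u, w⟩) hx
    · by_cases hp : p.row = 0
      · simp [gtForm, gtConst, hp, h0 p hp]
      · simp [gtForm, gtConst, hp]
    · by_cases hp : p.row = 0
      · simp [gtForm, gtConst, hp, h0 p hp]
      · simp [gtForm, gtConst, hp]
    · by_cases hp : Covers u w
      · rw [gtForm_pair u w _ hp] at *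
        simp only [gtConst] at *
        rw [h u w hp (by linarith), sub_self]
      · simp [gtForm, gtConst, hp]

theorem minFace_gtPolytope {x : GTIndex n → ℝ} (hx : x ∈ gtPolytope l) :
    minFace (gtPolytope l) x =
      {s | s ∈ gtPolytope l ∧ ∀ u w, Covers u w → x u = x w → s u = s w} := by
  have hx' := hx
  rw [gtPolytope_eq_halfspaces] at hx'
  have := minFace_halfspaces hx'
  rw [← gtPolytope_eq_halfspaces] at this
  rw [this]
  ext s
  exact and_congr_right fun hs => gtForm_tight_iff (mem_gtPolytope_iff.mp hs).1

theorem mem_tangentCone_gtPolytope {v : GTIndex n → ℝ} (hv : v ∈ gtPolytope l)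
    {b : GTIndex n → ℝ} : b ∈ tangentCone (gtPolytope l) v ↔
      (∀ p : GTIndex n, p.row = 0 → b p = l p.1.2) ∧
        ∀ u w, Covers u w → v u = v w → b w ≤ b u := by
  have hv' := mem_gtPolytope_iff.mp hv
  rw [gtPolytope_eq_halfspaces] at hv ⊢
  rw [tangentCone_halfspaces hv]
  constructor
  · intro h
    refine ⟨fun p hp => ?_, fun u w hu hx => ?_⟩
    · have h1 := h ⟨.inl p, by simp [gtForm, gtConst, hp, hv'.1 p hp]⟩
      have h2 := h ⟨.inr (.inl p), by simp [gtForm, gtConst, hp, hv'.1 p hp]⟩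
      simp only [gtForm, gtConst, hp, if_true, neg_apply,
        coord_apply] at h1 h2
      linarith
    · have := h ⟨.inr (.inr (u, w)), by rw [gtForm_pair u w v hu, hx]; simp [gtConst]⟩
      simp only [gtForm_pair u w b hu] at this
      simp only [gtConst] at this
      linarith
  · rintro ⟨h1, h2⟩ ⟨p | p | ⟨u, w⟩, hx⟩
    · by_cases hp : p.row = 0
      · simp [gtForm, gtConst, hp, h1 p hp]
      · simp [gtForm, gtConst, hp]
    · by_cases hp : p.row = 0
      · simp [gtForm, gtConst, hp, h1 p hp]
      · simp [gtForm, gtConst, hp]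
    · by_cases hp : Covers u w
      · rw [gtForm_pair u w _ hp] at hx
        simp only [gtConst] at hx
        have := h2 u w hp (by linarith)
        simp only [gtForm_pair u w b hp]
        simp only [gtConst]
        linarith
      · simp [gtForm, gtConst, hp]

/-- The faces of the tangent cone correspond to faces of the polytope, and the minimal face
containing a point to the minimal face containing nearby points of the segment from the apex. -/
theorem eventually_minFace_eq {v b : GTIndex n → ℝ} (hv : v ∈ gtPolytope l)
    (hb : b ∈ tangentCone (gtPolytope l) v) :
    ∀ᶠ ε : ℝ in 𝓝[>] 0, v + ε • (b - v) ∈ gtPolytope l ∧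
      minFace (tangentCone (gtPolytope l) v) b ∩ gtPolytope l =
        minFace (gtPolytope l) (v + ε • (b - v)) := by
  rw [gtPolytope_eq_halfspaces] at *
  exact (eventually_tight_iff hv hb).mono fun ε h =>
    ⟨h.1, minFace_tangentCone_inter hv hb h.1 h.2⟩

/-- In a triangle of the polytope the entries of two adjacent rows are ordered zigzag, and
equalities between them follow from equalities of adjacent entries. -/
theorem le_and_eq_of_zigzag {x s : GTIndex n → ℝ} (hx : x ∈ gtPolytope l)
    (h : ∀ u w, Covers u w → x u = x w → s u = s w) (i : ℕ) (δ : ℕ) (p q : GTIndex n)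
    (hp : p.row = i ∨ p.row = i + 1) (hq : q.row = i ∨ q.row = i + 1)
    (hδ : 2 * p.col + p.row + δ = 2 * q.col + q.row) : x q ≤ x p ∧ (x p = x q → s p = s q) := by
  have hmono := (mem_gtPolytope_iff.mp hx).2
  induction δ generalizing p with
  | zero =>
    have : p = q := by
      apply Subtype.ext
      apply Prod.ext <;> apply Fin.ext
      · change p.row = q.row; omega
      · change p.col = q.col; omega
    rw [this]
    exact ⟨le_rfl, fun _ => rfl⟩
  | succ δ ih =>
    have hpn : p.row + p.col < n := p.2
    have hqn : q.row + q.col < n := q.2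
    -- In two adjacent rows `2 * col + row` numbers the entries along the zigzag of decreasing
    -- values, so `p'` is the successor of `p`.
    obtain ⟨p', h1, h2, h3⟩ : ∃ p' : GTIndex n, Covers p p' ∧ (p'.row = i ∨ p'.row = i + 1) ∧
        2 * p'.col + p'.row = 2 * p.col + p.row + 1 := by
      rcases hp with hp | hp
      · refine ⟨⟨(⟨i + 1, by omega⟩, ⟨p.col, by omega⟩), ?_⟩, Or.inl ⟨?_, rfl⟩, Or.inr rfl, ?_⟩
        · change i + 1 + p.col < n
          omega
        · change i + 1 = _; omega
        · change 2 * p.col + (i + 1) = _; omega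
      · refine ⟨⟨(⟨i, by omega⟩, ⟨p.col + 1, by omega⟩), ?_⟩, Or.inr ⟨?_, rfl⟩, Or.inl rfl, ?_⟩
        · change i + (p.col + 1) < n
          omega
        · change _ = i + 1; omega
        · change 2 * (p.col + 1) + i = _; omega
    have h4 := ih p' h2 (by omega)
    have h5 := hmono p p' h1
    refine ⟨h4.1.trans h5, fun h6 => ?_⟩
    have h7 : x p = x p' := le_antisymm (h6.le.trans h4.1) h5
    exact (h p p' h1 h7).trans (h4.2 (h7.symm.trans h6))

theorem eq_of_adjacent_rows {x s : GTIndex n → ℝ} (hx : x ∈ gtPolytope l)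
    (h : ∀ u w, Covers u w → x u = x w → s u = s w) {i : ℕ} {p q : GTIndex n}
    (hp : p.row = i ∨ p.row = i + 1) (hq : q.row = i ∨ q.row = i + 1) (hpq : x p = x q) :
    s p = s q := by
  rcases le_total (2 * p.col + p.row) (2 * q.col + q.row) with hle | hle
  · obtain ⟨δ, hδ⟩ := Nat.exists_eq_add_of_le hle
    exact (le_and_eq_of_zigzag hx h i δ p q hp hq hδ.symm).2 hpq
  · obtain ⟨δ, hδ⟩ := Nat.exists_eq_add_of_le hle
    exact ((le_and_eq_of_zigzag hx h i δ q p hq hp hδ.symm).2 hpq.symm).symm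

end GelfandTsetlin

end

end GTHL

namespace GTHL

noncomputable section

open Filter Topology

/-! ### The weight of a triangle as a product over pairs of rows -/

section RowProducts

variable {n : ℕ} {β γ : Type*}

open Classical in
/-- The multiplicity of `x` in row `i` of the triangle `s`. -/
def rowCount (s : GTIndex n → β) (i : ℕ) (x : β) : ℕ :=
  Finset.card {p : GTIndex n | p.row = i ∧ s p = x}

open Classical in
/-- The contribution of the rows `i` and `i + 1` to the weight of the triangle `s`. -/
def rowProd (s : GTIndex n → β) (i : ℕ) : Polynomial ℤ :=
  ∏ x ∈ (Finset.univ.filter fun p : GTIndex n => p.row = i + 1).image s,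
    siteWeight Polynomial.X (rowCount s i x) (rowCount s (i + 1) x)

theorem rowProd_eq [DecidableEq β] (s : GTIndex n → β) (i : ℕ) : rowProd s i =
    ∏ x ∈ (Finset.univ.filter fun p : GTIndex n => p.row = i + 1).image s,
      siteWeight Polynomial.X (rowCount s i x) (rowCount s (i + 1) x) := by
  unfold rowProd
  congr!

theorem rowMult_eq_rowCount (s : GTIndex n → ℝ) (i : ℕ) (x : ℝ) : rowMult s i x = rowCount s i x := by
  classical
  rw [rowMult, rowCount, Set.ncard_eq_toFinset_card', Set.toFinset_ofPred]

theorem rowCount_le (s : GTIndex n → β) (i : ℕ) (x : β) : rowCount s i x ≤ n - i := by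
  classical
  rw [rowCount, ← Finset.card_range (n - i)]
  refine Finset.card_le_card_of_injOn GTIndex.col (fun p hp => ?_) fun p hp q hq h => ?_
  · have h1 : p.row = i := (Finset.mem_filter.mp hp).2.1
    have h2 : p.row + p.col < n := p.2
    rw [Finset.coe_range, Set.mem_Iio]; omega
  · have h1 : p.row = i := (Finset.mem_filter.mp hp).2.1
    have h2 : q.row = i := (Finset.mem_filter.mp hq).2.1
    exact Subtype.ext (Prod.ext (Fin.ext (h1.trans h2.symm)) (Fin.ext h))

theorem rowCount_pos_iff (s : GTIndex n → β) (i : ℕ) (x : β) :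
    0 < rowCount s i x ↔ ∃ p : GTIndex n, p.row = i ∧ s p = x := by
  classical
  rw [rowCount, Finset.card_pos]
  exact ⟨fun ⟨p, hp⟩ => ⟨p, (Finset.mem_filter.mp hp).2⟩,
    fun ⟨p, hp⟩ => ⟨p, Finset.mem_filter.mpr ⟨Finset.mem_univ p, hp⟩⟩⟩

/-- Only pairs whose multiplicity rises by one contribute a factor different from 1. Grouping them
by the new multiplicity gives the exponents `dStat`; rows below the top have at most `n - 1`
entries. -/
theorem pWeight_eq_prod (s : GTIndex n → ℝ) : pWeight s = ∏ i ∈ Finset.range n, rowProd s i := by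
  classical
  set T : Finset (Σ _ : ℕ, ℝ) := (Finset.range n).sigma fun i =>
    (Finset.univ.filter fun p : GTIndex n => p.row = i + 1).image s with hT
  have hmem : ∀ q : Σ _ : ℕ, ℝ, q ∈ T ↔ 0 < rowCount s (q.1 + 1) q.2 := by
    rintro ⟨i, x⟩
    rw [rowCount_pos_iff, hT, Finset.mem_sigma, Finset.mem_range, Finset.mem_image]
    constructor
    · rintro ⟨-, p, hp, h⟩
      exact ⟨p, (Finset.mem_filter.mp hp).2, h⟩
    · rintro ⟨p, hp, h⟩
      refine ⟨?_, p, Finset.mem_filter.mpr ⟨Finset.mem_univ p, hp⟩, h⟩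
      have h2 : p.row + p.col < n := p.2
      change p.row = i + 1 at hp
      change i < n
      omega
  have h1 : ∏ i ∈ Finset.range n, rowProd s i =
      ∏ q ∈ T, siteWeight Polynomial.X (rowCount s q.1 q.2) (rowCount s (q.1 + 1) q.2) := by
    rw [hT, Finset.prod_sigma]; rfl
  set T' := T.filter fun q => rowCount s (q.1 + 1) q.2 = rowCount s q.1 q.2 + 1 with hT'
  have h2 : ∏ q ∈ T, siteWeight Polynomial.X (rowCount s q.1 q.2) (rowCount s (q.1 + 1) q.2) =
      ∏ q ∈ T', (1 - (Polynomial.X : Polynomial ℤ) ^ rowCount s (q.1 + 1) q.2) := by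
    rw [hT', Finset.prod_filter]; rfl
  rw [h1, h2, pWeight, ← Finset.prod_fiberwise_of_maps_to (s := T')
    (t := Finset.Icc 1 (n - 1)) (g := fun q => rowCount s (q.1 + 1) q.2)]
  · refine Finset.prod_congr rfl fun m hm => ?_
    have hm1 := (Finset.mem_Icc.mp hm).1
    rw [Finset.prod_congr rfl (g := fun _ => 1 - (Polynomial.X : Polynomial ℤ) ^ m)
      (fun q hq => by rw [(Finset.mem_filter.mp hq).2]), Finset.prod_const]
    congr 1
    have hinj : Function.Injective fun q : Σ _ : ℕ, ℝ => (q.1 + 1, q.2) := by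
      rintro ⟨i, x⟩ ⟨j, y⟩ h
      simp only [Prod.mk.injEq, add_left_inj] at h
      obtain ⟨rfl, rfl⟩ := h
      rfl
    rw [dStat, ← Set.ncard_coe_finset, ← Set.ncard_image_of_injective _ hinj]
    congr 1
    ext ⟨j, x⟩
    simp only [Set.mem_ofPred_eq, Set.mem_image, Finset.mem_coe, Finset.mem_filter, hT', hmem,
      rowMult_eq_rowCount]
    constructor
    · rintro ⟨h3, h4, h5, h6⟩
      refine ⟨⟨j - 1, x⟩, ?_, ?_⟩
      · change ((0 < rowCount s (j - 1 + 1) x) ∧ rowCount s (j - 1 + 1) x = rowCount s (j - 1) x + 1) ∧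
          rowCount s (j - 1 + 1) x = m
        rw [Nat.sub_add_cancel h3]
        omega
      · simp only [Prod.mk.injEq, and_true]
        omega
    · rintro ⟨⟨i, y⟩, ⟨⟨h3, h4⟩, h5⟩, h6⟩
      simp only [Prod.mk.injEq] at h6 h3 h4 h5
      obtain ⟨rfl, rfl⟩ := h6
      have := rowCount_le s (i + 1) y
      rw [Nat.add_sub_cancel]
      omega
  · intro q hq
    have h3 := (hmem q).mp (Finset.mem_filter.mp hq).1
    have h4 := rowCount_le s (q.1 + 1) q.2
    rw [Finset.mem_Icc]
    omega

/-- Multiplicities depend only on which entries of the two rows coincide, so the values may be of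
any type; later they are pairs. -/
theorem rowProd_congr {s : GTIndex n → β} {s' : GTIndex n → γ} {i : ℕ}
    (h : ∀ p q : GTIndex n, (p.row = i ∨ p.row = i + 1) → (q.row = i ∨ q.row = i + 1) →
      (s p = s q ↔ s' p = s' q)) : rowProd s i = rowProd s' i := by
  classical
  have hc : ∀ p : GTIndex n, p.row = i + 1 → ∀ j, (j = i ∨ j = i + 1) →
      rowCount s j (s p) = rowCount s' j (s' p) := by
    intro p hp j hj
    unfold rowCount
    congr 1
    ext q
    simp only [Finset.mem_filter, Finset.mem_univ, true_and]
    exact and_congr_right fun hq => h q p (by omega) (Or.inr hp)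
  have hr : ∀ x ∈ (Finset.univ.filter fun p : GTIndex n => p.row = i + 1).image s,
      ∃ p : GTIndex n, p.row = i + 1 ∧ s p = x := by
    intro x hx
    obtain ⟨p, hp, rfl⟩ := Finset.mem_image.mp hx
    exact ⟨p, (Finset.mem_filter.mp hp).2, rfl⟩
  choose f hf1 hf2 using hr
  unfold rowProd
  refine Finset.prod_bij (fun x hx => s' (f x hx)) (fun x hx => ?_) (fun x hx y hy hxy => ?_)
    (fun y hy => ?_) (fun x hx => ?_)
  · exact Finset.mem_image_of_mem _ (Finset.mem_filter.mpr ⟨Finset.mem_univ _, hf1 x hx⟩)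
  · rw [← hf2 x hx, ← hf2 y hy]
    exact (h _ _ (Or.inr (hf1 x hx)) (Or.inr (hf1 y hy))).mpr hxy
  · obtain ⟨p, hp, rfl⟩ := Finset.mem_image.mp hy
    have hx : s p ∈ (Finset.univ.filter fun p : GTIndex n => p.row = i + 1).image s :=
      Finset.mem_image_of_mem _ hp
    exact ⟨s p, hx, (h _ _ (Or.inr (hf1 _ hx)) (Or.inr (Finset.mem_filter.mp hp).2)).mp (hf2 _ hx)⟩
  · rw [← hc (f x hx) (hf1 x hx) i (Or.inl rfl), ← hc (f x hx) (hf1 x hx) (i + 1) (Or.inr rfl), hf2 x hx]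

/-- The multiset of the values of `d` at those positions of row `i` where the value of `V` is
`c`. -/
def valueRow (V d : GTIndex n → ℤ) (c : ℤ) (i : ℕ) : Multiset ℤ :=
  (Finset.univ.filter fun p : GTIndex n => p.row = i ∧ V p = c).val.map d

theorem count_valueRow (V d : GTIndex n → ℤ) (c : ℤ) (i : ℕ) (e : ℤ) :
    (valueRow V d c i).count e = rowCount (fun p => (V p, d p)) i (c, e) := by
  classical
  rw [valueRow, Multiset.count_map, rowCount]
  have := Finset.filter_val (p := fun p => e = d p)
    (Finset.univ.filter fun p : GTIndex n => p.row = i ∧ V p = c)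
  rw [← this, Finset.card_val, Finset.filter_filter]
  congr 1
  ext p
  simp only [Finset.mem_filter, Finset.mem_univ, true_and, Prod.mk.injEq, and_assoc, eq_comm]

theorem rowProd_pair (V d : GTIndex n → ℤ) (i : ℕ) :
    rowProd (fun p => (V p, d p)) i = ∏ c ∈ Finset.univ.image V,
      ∏ e ∈ (valueRow V d c (i + 1)).toFinset, siteWeight Polynomial.X
        ((valueRow V d c i).count e) ((valueRow V d c (i + 1)).count e) := by
  rw [rowProd_eq, ← Finset.prod_fiberwise_of_maps_to (t := Finset.univ.image V) (g := Prod.fst)]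
  · refine Finset.prod_congr rfl fun c hc => ?_
    refine Finset.prod_nbij' Prod.snd (fun e => (c, e)) (fun x hx => ?_) (fun e he => ?_)
      (fun x hx => ?_) (fun e he => rfl) (fun x hx => ?_)
    · obtain ⟨h1, h2⟩ := Finset.mem_filter.mp hx
      obtain ⟨p, hp, rfl⟩ := Finset.mem_image.mp h1
      rw [Multiset.mem_toFinset, valueRow]
      exact Multiset.mem_map_of_mem d (Finset.mem_filter.mpr
        ⟨Finset.mem_univ p, (Finset.mem_filter.mp hp).2, h2⟩)
    · rw [Multiset.mem_toFinset, valueRow] at he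
      obtain ⟨p, hp, rfl⟩ := Multiset.mem_map.mp he
      obtain ⟨-, h1, rfl⟩ := Finset.mem_filter.mp hp
      exact Finset.mem_filter.mpr ⟨Finset.mem_image_of_mem (fun p => (V p, d p))
        (Finset.mem_filter.mpr ⟨Finset.mem_univ p, h1⟩), rfl⟩
    · obtain ⟨-, rfl⟩ := Finset.mem_filter.mp hx
      rfl
    · obtain ⟨-, rfl⟩ := Finset.mem_filter.mp hx
      rw [count_valueRow, count_valueRow]
  · intro x hx
    obtain ⟨p, -, rfl⟩ := Finset.mem_image.mp hx
    exact Finset.mem_image_of_mem V (Finset.mem_univ p)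

end RowProducts

/-! ### The weight function on the faces -/

section FaceWeight

variable {n : ℕ} {l : Fin n → ℤ}

/-- The chosen point and `x` lie in each other's minimal face. Hence they satisfy the same
equalities between adjacent entries, and so between all entries of two consecutive rows. -/
theorem gtPhi_minFace {x : GTIndex n → ℝ} (hx : x ∈ gtPolytope l) :
    gtPhi l (minFace (gtPolytope l) x) = pWeight x := by
  classical
  have h : ∃ s ∈ gtPolytope l, minFace (gtPolytope l) s = minFace (gtPolytope l) x := ⟨x, hx, rfl⟩
  rw [gtPhi, dif_pos h]
  obtain ⟨h1, h2⟩ := h.choose_spec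
  set s := h.choose
  have h3 : s ∈ minFace (gtPolytope l) x := by
    rw [← h2, minFace_gtPolytope h1]; exact ⟨h1, fun _ _ _ h => h⟩
  have h4 : x ∈ minFace (gtPolytope l) s := by
    rw [h2, minFace_gtPolytope hx]; exact ⟨hx, fun _ _ _ h => h⟩
  rw [minFace_gtPolytope hx] at h3
  rw [minFace_gtPolytope h1] at h4
  rw [pWeight_eq_prod, pWeight_eq_prod]
  exact Finset.prod_congr rfl fun i _ => rowProd_congr fun p q hp hq =>
    ⟨eq_of_adjacent_rows h1 h4.2 hp hq, eq_of_adjacent_rows hx h3.2 hp hq⟩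

/-- The triangle with entries `V` as a real triangle. -/
def toReal (V : GTIndex n → ℤ) : GTIndex n → ℝ := fun p => (V p : ℝ)

/-- Membership of `V + d` in the tangent cone at `V`. -/
def ConeCond (V d : GTIndex n → ℤ) : Prop :=
  (∀ p : GTIndex n, p.row = 0 → d p = 0) ∧ ∀ u w, Covers u w → V u = V w → d w ≤ d u

theorem mem_tangentCone_iff_coneCond {V : GTIndex n → ℤ} (hV : toReal V ∈ gtPolytope l)
    (d : GTIndex n → ℤ) :
    toReal (V + d) ∈ tangentCone (gtPolytope l) (toReal V) ↔ ConeCond V d := by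
  rw [mem_tangentCone_gtPolytope hV]
  have h0 := (mem_gtPolytope_iff.mp hV).1
  simp only [toReal] at *
  refine and_congr (forall₂_congr fun p hp => ?_) (forall₃_congr fun u w hu => ?_)
  · rw [← h0 p hp, Pi.add_apply, Int.cast_inj, add_eq_left]
  · rw [Int.cast_inj]
    refine forall_congr' fun h => ?_
    rw [Int.cast_le, Pi.add_apply, Pi.add_apply, h, add_le_add_iff_left]

-- The face of `V + d` in the cone corresponds to the face of `V + ε d` in the polytope for small
-- `ε`. Two entries of `V + ε d` agree exactly when both `V` and `d` agree there, which makes the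
-- weight a weight of pairs.
open Classical in
theorem weightedSeries_tangentCone {V : GTIndex n → ℤ} (hV : toReal V ∈ gtPolytope l)
    (d : GTIndex n → ℤ) :
    weightedSeries (tangentCone (gtPolytope l) (toReal V)) (coneWeight (gtPolytope l) (gtPhi l))
      (V + d) = if ConeCond V d then ∏ i ∈ Finset.range n, rowProd (fun p => (V p, d p)) i else 0 := by
  have hd : toReal (V + d) ∈ tangentCone (gtPolytope l) (toReal V) ↔ ConeCond V d :=
    mem_tangentCone_iff_coneCond hV d
  split_ifs with h
  · have hb := hd.mpr h
    change (tangentCone (gtPolytope l) (toReal V)).indicator _ (toReal (V + d)) = _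
    rw [Set.indicator_of_mem hb]
    have hx : ∀ ε : ℝ, toReal V + ε • (toReal (V + d) - toReal V) =
        fun p => (V p : ℝ) + ε * d p := by
      intro ε
      ext p
      simp [toReal]
    have h1 : ∀ᶠ ε : ℝ in 𝓝[>] 0, ∀ p q : GTIndex n,
        ((V p : ℝ) + ε * d p = V q + ε * d q ↔ V p = V q ∧ d p = d q) := by
      refine eventually_all.mpr fun p => eventually_all.mpr fun q => ?_
      by_cases hpq : V p = V q
      · filter_upwards [self_mem_nhdsWithin] with ε hε
        have : ε ≠ 0 := ne_of_gt hε
        simp [hpq, this]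
      · have h2 : Tendsto (fun ε : ℝ => (V p : ℝ) + ε * d p - (V q + ε * d q)) (𝓝[>] 0)
            (𝓝 ((V p : ℝ) - V q)) := by
          have h3 : Continuous fun ε : ℝ => (V p : ℝ) + ε * d p - (V q + ε * d q) := by fun_prop
          have h4 := h3.tendsto 0
          simp only [zero_mul, add_zero] at h4
          exact h4.mono_left nhdsWithin_le_nhds
        have h5 : (V p : ℝ) - V q ≠ 0 := sub_ne_zero.mpr fun h => hpq (Int.cast_inj.mp h)
        filter_upwards [h2.eventually_ne h5] with ε hε
        exact ⟨fun h => absurd (sub_eq_zero.mpr h) hε, fun h => absurd h.1 hpq⟩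
    obtain ⟨ε, h2, h3, h4⟩ := (h1.and (eventually_minFace_eq hV hb)).exists
    rw [coneWeight, h4, gtPhi_minFace h3, pWeight_eq_prod, hx]
    exact Finset.prod_congr rfl fun i _ => rowProd_congr fun p q _ _ => by
      rw [h2 p q, Prod.mk.injEq]
  · exact Set.indicator_of_notMem (fun hb => h (hd.mp hb)) _

end FaceWeight

end

end GTHL

namespace GTHL

noncomputable section

/-! ### The conditions of the tangent cone for each value of the apex -/

section Interlacing

variable {n : ℕ} {β : Type*} [LinearOrder β]

/-- The number of entries of row `i` which are at least `θ`. -/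
def rowGE (s : GTIndex n → β) (i : ℕ) (θ : β) : ℕ :=
  Finset.card {p : GTIndex n | p.row = i ∧ θ ≤ s p}

/-- Row `i` of the triangle `s` is weakly decreasing. -/
def RowAntitone (s : GTIndex n → β) (i : ℕ) : Prop :=
  ∀ p q : GTIndex n, p.row = i → q.row = i → p.col ≤ q.col → s q ≤ s p

theorem row_add_col_lt (p : GTIndex n) : p.row + p.col < n := p.2

/-- The position in row `i` and column `j`. -/
def pos (i j : ℕ) (h : i + j < n) : GTIndex n := ⟨(⟨i, by omega⟩, ⟨j, by omega⟩), h⟩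

@[simp] theorem pos_row (i j : ℕ) (h : i + j < n) : (pos i j h).row = i := rfl

@[simp] theorem pos_col (i j : ℕ) (h : i + j < n) : (pos i j h).col = j := rfl

theorem GTIndex.ext' {p q : GTIndex n} (h1 : p.row = q.row) (h2 : p.col = q.col) : p = q :=
  Subtype.ext (Prod.ext (Fin.ext h1) (Fin.ext h2))

/-- In a decreasing row the entries that are at least `θ` fill an initial segment of columns. This
translates between entries and counts in everything that follows. -/
theorem lt_rowGE_iff {s : GTIndex n → β} {i : ℕ} (hs : RowAntitone s i) (p : GTIndex n)
    (hp : p.row = i) (θ : β) : p.col < rowGE s i θ ↔ θ ≤ s p := by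
  have hpn := row_add_col_lt p
  constructor
  · intro h
    by_contra hθ
    refine absurd h (not_lt.mpr ?_)
    rw [rowGE, ← Finset.card_range p.col]
    refine Finset.card_le_card_of_injOn GTIndex.col (fun q hq => ?_) fun q hq q' hq' h => ?_
    · obtain ⟨h1, h2⟩ := (Finset.mem_filter.mp hq).2
      rw [Finset.coe_range, Set.mem_Iio]
      by_contra h3
      exact hθ (h2.trans (hs p q hp h1 (not_lt.mp h3)))
    · exact GTIndex.ext' ((Finset.mem_filter.mp hq).2.1.trans (Finset.mem_filter.mp hq').2.1.symm) h
  · intro h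
    rw [← Nat.succ_le_iff, ← Finset.card_range p.col.succ, rowGE]
    refine Finset.card_le_card_of_injOn (fun j => if hj : i + j < n then pos i j hj else p)
      (fun j hj => ?_) fun j hj j' hj' h => ?_
    · rw [Finset.coe_range, Set.mem_Iio] at hj
      have : i + j < n := by omega
      simp only
      rw [dif_pos this]
      exact Finset.mem_filter.mpr ⟨Finset.mem_univ _, rfl,
        h.trans (hs _ p rfl hp (by rw [pos_col]; omega))⟩
    · rw [Finset.coe_range, Set.mem_Iio] at hj hj'
      simp only at h
      rw [dif_pos (by omega : i + j < n), dif_pos (by omega : i + j' < n)] at h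
      exact congrArg GTIndex.col h

theorem rowGE_le (s : GTIndex n → β) (i : ℕ) (θ : β) : rowGE s i θ ≤ n - i := by
  rw [rowGE, ← Finset.card_range (n - i)]
  refine Finset.card_le_card_of_injOn GTIndex.col (fun p hp => ?_) fun p hp q hq h => ?_
  · have h1 : p.row = i := (Finset.mem_filter.mp hp).2.1
    have h2 := row_add_col_lt p
    rw [Finset.coe_range, Set.mem_Iio]; omega
  · exact GTIndex.ext' ((Finset.mem_filter.mp hp).2.1.trans (Finset.mem_filter.mp hq).2.1.symm) h

/-- The entries of two consecutive rows interlace. -/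
def RowsInterlace (s : GTIndex n → β) (i : ℕ) : Prop :=
  ∀ θ, rowGE s (i + 1) θ ≤ rowGE s i θ ∧ rowGE s i θ ≤ rowGE s (i + 1) θ + 1

theorem rowsInterlace_of_covers {s : GTIndex n → β} (h : ∀ u w, Covers u w → s w ≤ s u) {i : ℕ}
    (h0 : RowAntitone s i) (h1 : RowAntitone s (i + 1)) : RowsInterlace s i := by
  intro θ
  constructor
  · by_contra! hlt
    have hle := rowGE_le s (i + 1) θ
    have h2 : i + 1 + rowGE s i θ < n := by omega
    have h3 := (lt_rowGE_iff h1 (pos (i + 1) (rowGE s i θ) h2) rfl θ).mp hlt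
    have h4 := h (pos i (rowGE s i θ) (by omega)) (pos (i + 1) (rowGE s i θ) h2) (Or.inl ⟨rfl, rfl⟩)
    have h5 := (lt_rowGE_iff h0 (pos i (rowGE s i θ) (by omega)) rfl θ).mpr (h3.trans h4)
    exact lt_irrefl _ h5
  · by_contra! hlt
    have hle := rowGE_le s i θ
    have h2 : i + (rowGE s (i + 1) θ + 1) < n := by omega
    have h3 := (lt_rowGE_iff h0 (pos i (rowGE s (i + 1) θ + 1) h2) rfl θ).mp hlt
    have h4 := h (pos (i + 1) (rowGE s (i + 1) θ) (by omega)) (pos i (rowGE s (i + 1) θ + 1) h2)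
      (Or.inr ⟨rfl, rfl⟩)
    have h5 := (lt_rowGE_iff h1 (pos (i + 1) (rowGE s (i + 1) θ) (by omega)) rfl θ).mpr
      (h3.trans h4)
    exact lt_irrefl _ h5

/-- Neighbours in a lower row are separated by an entry of the row above. -/
theorem rowAntitone_of_covers {s : GTIndex n → β} (h : ∀ u w, Covers u w → s w ≤ s u) (i : ℕ)
    (h0 : RowAntitone s 0) : RowAntitone s i := by
  rcases Nat.eq_zero_or_pos i with rfl | hi
  · exact h0
  · obtain ⟨j, rfl⟩ := Nat.exists_eq_add_of_le' hi
    have key : ∀ k, ∀ p q : GTIndex n, p.row = j + 1 → q.row = j + 1 → p.col + k = q.col →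
        s q ≤ s p := by
      intro k
      induction k with
      | zero =>
        intro p q hp hq hk
        rw [GTIndex.ext' (hp.trans hq.symm) hk]
      | succ k ih =>
        intro p q hp hq hk
        have hqn := row_add_col_lt q
        refine (ih (pos (j + 1) (p.col + 1) (by omega)) q rfl hq (by rw [pos_col]; omega)).trans ?_
        refine (h (pos j (p.col + 1) (by omega)) (pos (j + 1) (p.col + 1) (by omega))
          (Or.inl ⟨rfl, rfl⟩)).trans ?_
        exact h p _ (Or.inr ⟨hp, rfl⟩)
    intro p q hp hq hpq
    obtain ⟨k, hk⟩ := Nat.exists_eq_add_of_le hpq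
    exact key k p q hp hq hk.symm

theorem covers_iff_rowsInterlace {s : GTIndex n → β} (h0 : RowAntitone s 0) :
    (∀ u w, Covers u w → s w ≤ s u) ↔
      ∀ i ∈ Finset.range n, RowAntitone s (i + 1) ∧ RowsInterlace s i := by
  constructor
  · exact fun h i _ => ⟨rowAntitone_of_covers h _ h0,
      rowsInterlace_of_covers h (rowAntitone_of_covers h _ h0) (rowAntitone_of_covers h _ h0)⟩
  · intro h
    have hanti : ∀ p : GTIndex n, RowAntitone s p.row := by
      intro p
      rcases Nat.eq_zero_or_pos p.row with hi | hi
      · rwa [hi]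
      · have hpn := row_add_col_lt p
        have := (h (p.row - 1) (Finset.mem_range.mpr (by omega))).1
        rwa [Nat.sub_add_cancel hi] at this
    intro u w hu
    have hun := row_add_col_lt u
    have hwn := row_add_col_lt w
    rcases hu with ⟨h1, h2⟩ | ⟨h1, h2⟩
    · have h3 := (h u.row (Finset.mem_range.mpr (by omega))).2 (s w)
      have h4 := (lt_rowGE_iff (hanti w) w rfl (s w)).mpr le_rfl
      rw [h1] at h4
      exact (lt_rowGE_iff (hanti u) u rfl (s w)).mp (by omega)
    · have h3 := (h w.row (Finset.mem_range.mpr (by omega))).2 (s w)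
      have h4 := (lt_rowGE_iff (hanti w) w rfl (s w)).mpr le_rfl
      refine (lt_rowGE_iff (hanti u) u rfl (s w)).mp ?_
      rw [h1]
      omega

end Interlacing

/-! ### Lexicographic comparison of apex and displacement -/

section ValueRows

variable {n : ℕ} {V : GTIndex n → ℤ}

/-- The number of additional elements at the left of the entries `c` in row `i + 1`. -/
def leftStep (V : GTIndex n → ℤ) (c : ℤ) (i : ℕ) : ℕ :=
  rowGE V i (c + 1) - rowGE V (i + 1) (c + 1)

/-- The number of additional elements at the right of the entries `c` in row `i + 1`. -/
def rightStep (V : GTIndex n → ℤ) (c : ℤ) (i : ℕ) : ℕ := rowGE V (i + 1) c + 1 - rowGE V i c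

/-- The entries of `d` in row `i` are weakly decreasing where `V` takes the value `c`. -/
def ValueAntitone (V d : GTIndex n → ℤ) (c : ℤ) (i : ℕ) : Prop :=
  ∀ p q : GTIndex n, p.row = i → q.row = i → V p = c → V q = c → p.col ≤ q.col → d q ≤ d p

/-- An integer triangle satisfying the inequalities of the Gelfand–Tsetlin polytope. -/
def IsTriangle (V : GTIndex n → ℤ) : Prop := RowAntitone V 0 ∧ ∀ u w, Covers u w → V w ≤ V u

theorem IsTriangle.rowAntitone (hV : IsTriangle V) (i : ℕ) : RowAntitone V i :=
  rowAntitone_of_covers hV.2 i hV.1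

theorem IsTriangle.rowsInterlace (hV : IsTriangle V) (i : ℕ) : RowsInterlace V i :=
  rowsInterlace_of_covers hV.2 (hV.rowAntitone i) (hV.rowAntitone (i + 1))

/-- A pair is at least `(c, x)` if its first component exceeds `c`, or equals `c` while the second
is at least `x`. -/
theorem rowGE_lex (V d : GTIndex n → ℤ) (i : ℕ) (c x : ℤ) :
    rowGE (fun p => toLex (V p, d p)) i (toLex (c, x)) =
      rowGE V i (c + 1) + countGE (valueRow V d c i) x := by
  classical
  rw [countGE, valueRow, Multiset.countP_map]
  have h1 := Finset.filter_val (p := fun p => x ≤ d p)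
    (Finset.univ.filter fun p : GTIndex n => p.row = i ∧ V p = c)
  rw [← h1, Finset.card_val, Finset.filter_filter, rowGE, rowGE, ← Finset.card_union_of_disjoint]
  · congr 1
    ext p
    simp only [Finset.mem_filter, Finset.mem_univ, true_and, Finset.mem_union,
      Prod.Lex.toLex_le_toLex, Int.add_one_le_iff]
    tauto
  · rw [Finset.disjoint_filter]
    rintro p - ⟨h1, h2⟩ ⟨⟨h3, h4⟩, h5⟩
    omega

theorem card_valueRow (V d : GTIndex n → ℤ) (c : ℤ) (i : ℕ) :
    (valueRow V d c i).card + rowGE V i (c + 1) = rowGE V i c := by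
  classical
  rw [valueRow, Multiset.card_map, Finset.card_val, rowGE, rowGE, ← Finset.card_union_of_disjoint]
  · congr 1
    ext p
    simp only [Finset.mem_filter, Finset.mem_univ, true_and, Finset.mem_union, Int.add_one_le_iff,
      le_iff_lt_or_eq (a := c)]
    constructor
    · rintro (⟨h1, h2⟩ | ⟨h1, h2⟩)
      · exact ⟨h1, Or.inr h2.symm⟩
      · exact ⟨h1, Or.inl h2⟩
    · rintro ⟨h1, h2 | h2⟩
      · exact Or.inr ⟨h1, h2⟩
      · exact Or.inl ⟨h1, h2.symm⟩
  · rw [Finset.disjoint_filter]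
    rintro p - ⟨h1, h2⟩ ⟨h3, h4⟩
    omega

/-- At `(c, x)` the entries of `V` above `c` enter only through the difference of their numbers in
the two rows, which is the left offset. Values `c` not taken by `V` give no new condition. -/
theorem rowsInterlace_lex_iff (hV : IsTriangle V) (d : GTIndex n → ℤ) (i : ℕ) :
    RowsInterlace (fun p => toLex (V p, d p)) i ↔
      ∀ c ∈ Finset.univ.image V, Interlace (leftStep V c i) (valueRow V d c i)
        (valueRow V d c (i + 1)) := by
  have key : ∀ c x, (rowGE (fun p => toLex (V p, d p)) (i + 1) (toLex (c, x)) ≤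
        rowGE (fun p => toLex (V p, d p)) i (toLex (c, x)) ∧
      rowGE (fun p => toLex (V p, d p)) i (toLex (c, x)) ≤
        rowGE (fun p => toLex (V p, d p)) (i + 1) (toLex (c, x)) + 1) ↔
      (countGE (valueRow V d c (i + 1)) x ≤ countGE (valueRow V d c i) x + leftStep V c i ∧
        countGE (valueRow V d c i) x + leftStep V c i ≤ countGE (valueRow V d c (i + 1)) x + 1) := by
    intro c x
    have := (hV.rowsInterlace i (c + 1)).1
    rw [rowGE_lex, rowGE_lex, leftStep]
    omega
  constructor
  · exact fun h c _ x => (key c x).mp (h (toLex (c, x)))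
  · intro h θ
    obtain ⟨⟨c, x⟩, rfl⟩ := toLex.surjective θ
    rw [key]
    by_cases hc : c ∈ Finset.univ.image V
    · exact h c hc x
    · have h0 : ∀ i, valueRow V d c i = 0 := by
        intro i
        rw [valueRow, Multiset.map_eq_zero, Finset.val_eq_zero, Finset.filter_eq_empty_iff]
        rintro p - ⟨-, rfl⟩
        exact hc (Finset.mem_image_of_mem V (Finset.mem_univ p))
      have := hV.rowsInterlace i (c + 1)
      rw [h0, h0, leftStep]
      simp only [countGE, Multiset.countP_zero]
      omega

theorem rowAntitone_lex_iff (hV : IsTriangle V) (d : GTIndex n → ℤ) (i : ℕ) :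
    RowAntitone (fun p => toLex (V p, d p)) i ↔ ∀ c ∈ Finset.univ.image V, ValueAntitone V d c i := by
  constructor
  · intro h c _ p q hp hq hVp hVq hpq
    have := h p q hp hq hpq
    rw [Prod.Lex.toLex_le_toLex] at this
    simp only at this
    omega
  · intro h p q hp hq hpq
    have h1 := hV.rowAntitone i p q hp hq hpq
    rw [Prod.Lex.toLex_le_toLex]
    simp only
    rcases h1.lt_or_eq with h2 | h2
    · exact Or.inl h2
    · exact Or.inr ⟨h2, h (V p) (Finset.mem_image_of_mem V (Finset.mem_univ p)) p q hp hq rfl h2 hpq⟩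

/-- The cone inequalities say that the pairs `(V, d)`, ordered lexicographically, satisfy the
triangle inequalities. Their counting form separates over the values of `V`. -/
theorem coneCond_iff (hV : IsTriangle V) (d : GTIndex n → ℤ) : ConeCond V d ↔
    (∀ p : GTIndex n, p.row = 0 → d p = 0) ∧ ∀ c ∈ Finset.univ.image V, ∀ i ∈ Finset.range n,
      ValueAntitone V d c (i + 1) ∧
        Interlace (leftStep V c i) (valueRow V d c i) (valueRow V d c (i + 1)) := by
  refine and_congr_right fun h0 => ?_
  have hs0 : RowAntitone (fun p => toLex (V p, d p)) 0 :=
    (rowAntitone_lex_iff hV d 0).mpr fun c _ p q hp hq _ _ _ => by rw [h0 p hp, h0 q hq]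
  have h1 : (∀ u w, Covers u w → V u = V w → d w ≤ d u) ↔
      ∀ u w, Covers u w → toLex (V w, d w) ≤ toLex (V u, d u) := by
    refine forall₃_congr fun u w hu => ?_
    have := hV.2 u w hu
    rw [Prod.Lex.toLex_le_toLex]
    simp only
    omega
  rw [h1, covers_iff_rowsInterlace hs0]
  constructor
  · intro h c hc i hi
    exact ⟨(rowAntitone_lex_iff hV d (i + 1)).mp (h i hi).1 c hc,
      (rowsInterlace_lex_iff hV d i).mp (h i hi).2 c hc⟩
  · intro h i hi
    exact ⟨(rowAntitone_lex_iff hV d (i + 1)).mpr fun c hc => (h c hc i hi).1,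
      (rowsInterlace_lex_iff hV d i).mpr fun c hc => (h c hc i hi).2⟩

open Classical in
/-- The weights of the rows where `V` takes the value `c`. -/
def valueWeight {R : Type*} [CommRing R] (t : R) (V d : GTIndex n → ℤ) (c : ℤ) (i : ℕ) : R :=
  if ValueAntitone V d c (i + 1) then
    rowWeight t (leftStep V c i) (valueRow V d c i) (valueRow V d c (i + 1)) else 0

open Classical in
theorem coneWeight_eq_prod (hV : IsTriangle V) (d : GTIndex n → ℤ) :
    (if ConeCond V d then ∏ i ∈ Finset.range n, rowProd (fun p => (V p, d p)) i else 0) =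
      (if ∀ p : GTIndex n, p.row = 0 → d p = 0 then 1 else 0) *
        ∏ c ∈ Finset.univ.image V, ∏ i ∈ Finset.range n, valueWeight Polynomial.X V d c i := by
  have hc := coneCond_iff hV d
  split_ifs with h1 h2 h2
  · rw [one_mul, Finset.prod_comm]
    refine Finset.prod_congr rfl fun i hi => ?_
    rw [rowProd_pair]
    refine Finset.prod_congr rfl fun c hc' => ?_
    obtain ⟨h3, h4⟩ := (hc.mp h1).2 c hc' i hi
    rw [valueWeight, if_pos h3, rowWeight, if_pos h4]
  · exact absurd (hc.mp h1).1 h2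
  · rw [one_mul]
    have h3 : ¬ ∀ c ∈ Finset.univ.image V, ∀ i ∈ Finset.range n, ValueAntitone V d c (i + 1) ∧
        Interlace (leftStep V c i) (valueRow V d c i) (valueRow V d c (i + 1)) :=
      fun h => h1 (hc.mpr ⟨h2, h⟩)
    push Not at h3
    obtain ⟨c, hc', i, hi, h4⟩ := h3
    symm
    refine Finset.prod_eq_zero hc' (Finset.prod_eq_zero hi ?_)
    rw [valueWeight]
    split_ifs with h5
    · rw [rowWeight, if_neg (h4 h5)]
    · rfl
  · rw [zero_mul]

end ValueRows

end

end GTHL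

namespace GTHL

noncomputable section

/-! ### Decomposition of a triangle according to the values of the apex -/

section Positions

variable {n : ℕ} {V : GTIndex n → ℤ} {K : Type*} [Field K]

/-- The number of entries `c` in row `i`. -/
def valueLen (V : GTIndex n → ℤ) (c : ℤ) (i : ℕ) : ℕ := rowGE V i c - rowGE V i (c + 1)

/-- The steps between the rows of the entries `c`, from row `i` on. -/
def valueSteps (V : GTIndex n → ℤ) (c : ℤ) (x : ℕ → K) (i m : ℕ) : List (Step K) :=
  (List.range' i m).map fun j => ⟨leftStep V c j, rightStep V c j, x (j + 1)⟩

theorem rowGE_anti (V : GTIndex n → ℤ) (c : ℤ) (i : ℕ) : rowGE V i (c + 1) ≤ rowGE V i c := by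
  have := card_valueRow V V c i
  omega

/-- Both offsets are differences of counts at the two ends of the block of entries `c`. The
truncated subtractions are exact because the rows interlace. -/
theorem next_valueLen (hV : IsTriangle V) (c : ℤ) (i : ℕ) (y : K) :
    (⟨leftStep V c i, rightStep V c i, y⟩ : Step K).next (valueLen V c i) =
      valueLen V c (i + 1) := by
  have h1 := hV.rowsInterlace i c
  have h2 := hV.rowsInterlace i (c + 1)
  have h3 := rowGE_anti V c i
  have h4 := rowGE_anti V c (i + 1)
  simp only [Step.next, valueLen, leftStep, rightStep]
  omega

theorem rowGE_self (V : GTIndex n → ℤ) (c : ℤ) : rowGE V n c = 0 := by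
  have := rowGE_le V n c
  omega

theorem validSteps_valueSteps (hV : IsTriangle V) (c : ℤ) (x : ℕ → K) (i m : ℕ) (him : i + m = n) :
    ValidSteps (valueLen V c i) (valueSteps V c x i m) := by
  induction m generalizing i with
  | zero =>
    obtain rfl : i = n := by omega
    change valueLen V c i = 0
    rw [valueLen, rowGE_self, rowGE_self]
  | succ m ih =>
    have h1 := hV.rowsInterlace i c
    have h2 := hV.rowsInterlace i (c + 1)
    have h3 := rowGE_anti V c i
    have h4 := rowGE_anti V c (i + 1)
    have h5 := ih (i + 1) (by omega)
    rw [← next_valueLen hV c i (x (i + 1))] at h5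
    refine ⟨?_, ?_, ?_, h5⟩ <;> simp only [valueLen, leftStep, rightStep] <;> omega

theorem valueRow_eq_replicate {d : GTIndex n → ℤ} (c : ℤ) {i : ℕ}
    (hd : ∀ p : GTIndex n, p.row = i → d p = 0) :
    valueRow V d c i = Multiset.replicate (valueLen V c i) 0 := by
  rw [Multiset.eq_replicate]
  have := card_valueRow V d c i
  refine ⟨by rw [valueLen]; omega, fun e he => ?_⟩
  obtain ⟨p, hp, rfl⟩ := Multiset.mem_map.mp he
  exact hd p (Finset.mem_filter.mp hp).2.1

/-- The positions of the entries `c` in a row, from the left to the right. -/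
theorem exists_rowEquiv (hV : IsTriangle V) (c : ℤ) (i k : ℕ) (hk : k = valueLen V c i) :
    ∃ f : Fin k ≃ {p : GTIndex n // p.row = i ∧ V p = c}, ∀ d : GTIndex n → ℤ,
      (Antitone (fun j => d (f j)) ↔
        ∀ p q : GTIndex n, p.row = i → q.row = i → V p = c → V q = c → p.col ≤ q.col → d q ≤ d p) ∧
      entries (fun j => d (f j)) = valueRow V d c i := by
  subst hk
  have hle := rowGE_le V i c
  have hanti := rowGE_anti V c i
  -- Rows decrease, so the entries `c` occupy an interval of columns.
  have hcol : ∀ p : GTIndex n, p.row = i →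
      (V p = c ↔ rowGE V i (c + 1) ≤ p.col ∧ p.col < rowGE V i c) := by
    intro p hp
    rw [lt_rowGE_iff (hV.rowAntitone i) p hp, ← not_lt, lt_rowGE_iff (hV.rowAntitone i) p hp]
    omega
  have hpos : ∀ j : Fin (valueLen V c i), i + (rowGE V i (c + 1) + j) < n := by
    intro j
    have := j.2
    simp only [valueLen] at this
    omega
  let f : Fin (valueLen V c i) ≃ {p : GTIndex n // p.row = i ∧ V p = c} :=
    { toFun := fun j => ⟨pos i (rowGE V i (c + 1) + j) (hpos j), rfl, (hcol _ rfl).mpr (by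
        have := j.2
        simp only [valueLen] at this
        rw [pos_col]
        omega)⟩
      invFun := fun p => ⟨p.1.col - rowGE V i (c + 1), by
        have := (hcol p.1 p.2.1).mp p.2.2
        rw [valueLen]
        omega⟩
      left_inv := fun j => Fin.ext (by simp)
      right_inv := fun p => by
        have := (hcol p.1 p.2.1).mp p.2.2
        refine Subtype.ext (GTIndex.ext' p.2.1.symm ?_)
        simp only [pos_col]
        omega }
  have hfcol : ∀ j, (f j).1.col = rowGE V i (c + 1) + j := fun j => rfl
  refine ⟨f, fun d => ⟨⟨fun h p q hp hq hVp hVq hpq => ?_, fun h j j' hjj' => ?_⟩, ?_⟩⟩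
  · have h1 := @h (f.symm ⟨p, hp, hVp⟩) (f.symm ⟨q, hq, hVq⟩) (by
      rw [Fin.le_def]
      change p.col - rowGE V i (c + 1) ≤ q.col - rowGE V i (c + 1)
      omega)
    simpa using h1
  · refine h _ _ (f j).2.1 (f j').2.1 (f j).2.2 (f j').2.2 ?_
    rw [hfcol, hfcol]
    have := Fin.le_def.mp hjj'
    omega
  · have hmap : Finset.univ.map ⟨fun j => (f j).1, fun a b h => f.injective (Subtype.ext h)⟩ =
        Finset.univ.filter fun p : GTIndex n => p.row = i ∧ V p = c := by
      ext p
      simp only [Finset.mem_map, Finset.mem_univ, true_and, Finset.mem_filter]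
      constructor
      · rintro ⟨j, rfl⟩
        exact (f j).2
      · intro h
        exact ⟨f.symm ⟨p, h⟩, congrArg Subtype.val (f.apply_symm_apply ⟨p, h⟩)⟩
    rw [valueRow, ← hmap, Finset.map_val, Multiset.map_map]
    rfl

/-- The term of a pattern read off from a triangle. -/
theorem exists_idxEquiv (hV : IsTriangle V) (t : K) (c : ℤ) (x : ℕ → K) (m i k : ℕ)
    (him : i + m = n) (hk : k = valueLen V c i) :
    ∃ e : Idx k (valueSteps V c x i m) ≃ {p : GTIndex n // i < p.row ∧ V p = c},
      ∀ d : GTIndex n → ℤ, patternTerm t k (valueSteps V c x i m) (valueRow V d c i)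
        (fun j => d (e j)) = ∏ j ∈ Finset.Ico i n, (valueWeight t V d c j *
          x (j + 1) ^ ((valueRow V d c j).sum - (valueRow V d c (j + 1)).sum)) := by
  classical
  induction m generalizing i k with
  | zero =>
    obtain rfl : i = n := by omega
    have h1 : IsEmpty {p : GTIndex i // i < p.row ∧ V p = c} := ⟨fun p => by
      have := row_add_col_lt p.1
      have := p.2.1
      omega⟩
    have h2 : IsEmpty (Idx k (valueSteps V c x i 0)) := inferInstanceAs (IsEmpty (Fin 0))
    refine ⟨Equiv.equivOfIsEmpty _ _, fun d => ?_⟩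
    rw [Finset.Ico_self, Finset.prod_empty]
    exact one_mul _
  | succ m ih =>
    let s : Step K := ⟨leftStep V c i, rightStep V c i, x (i + 1)⟩
    have hs : s.next k = valueLen V c (i + 1) := by rw [hk]; exact next_valueLen hV c i _
    obtain ⟨e', he'⟩ := ih (i + 1) (s.next k) (by omega) hs
    obtain ⟨f, hf⟩ := exists_rowEquiv hV c (i + 1) (s.next k) hs
    let e : Fin (s.next k) ⊕ Idx (s.next k) (valueSteps V c x (i + 1) m) ≃
        {p : GTIndex n // i < p.row ∧ V p = c} :=
      Equiv.ofBijective
        (Sum.elim (fun j => ⟨(f j).1, by have := (f j).2.1; omega, (f j).2.2⟩)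
          fun j => ⟨(e' j).1, by have := (e' j).2.1; omega, (e' j).2.2⟩) (by
        constructor
        · rintro (a | a) (b | b) h
          · have h' : (f a).1 = (f b).1 := congrArg (fun p => p.1) h
            exact congrArg Sum.inl (f.injective (Subtype.ext h'))
          · exfalso
            have h1 := congrArg (fun p => p.1.row) h
            have h2 := (f a).2.1
            have h3 := (e' b).2.1
            simp only [Sum.elim_inl, Sum.elim_inr] at h1
            omega
          · exfalso
            have h1 := congrArg (fun p => p.1.row) h
            have h2 := (f b).2.1
            have h3 := (e' a).2.1
            simp only [Sum.elim_inl, Sum.elim_inr] at h1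
            omega
          · have h' : (e' a).1 = (e' b).1 := congrArg (fun p => p.1) h
            exact congrArg Sum.inr (e'.injective (Subtype.ext h'))
        · rintro ⟨p, hp, hVp⟩
          by_cases h : p.row = i + 1
          · exact ⟨Sum.inl (f.symm ⟨p, h, hVp⟩), by simp⟩
          · exact ⟨Sum.inr (e'.symm ⟨p, by omega, hVp⟩), by simp⟩)
    refine ⟨e, fun d => ?_⟩
    rw [Finset.prod_eq_prod_Ico_succ_bot (by omega), ← he' d]
    have h1 := patternTerm_cons (t := t) k s (valueSteps V c x (i + 1) m) (valueRow V d c i)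
      (fun j => d (e j))
    refine h1.trans ?_
    have h2 : (fun j => d (e (Sum.inl j))) = fun j => d (f j) := rfl
    have h3 : (fun j => d (e (Sum.inr j))) = fun j => d (e' j) := rfl
    have h4 := (hf d).2
    have h5 := (hf d).1
    rw [← h2] at h4 h5
    rw [← h3]
    rw [show entries (fun j => d (e (Sum.inl j))) = valueRow V d c (i + 1) from h4]
    congr 1
    rw [valueWeight]
    by_cases h6 : ValueAntitone V d c (i + 1)
    · rw [if_pos h6]; exact if_pos (h5.mpr h6)
    · rw [if_neg h6, zero_mul]; exact if_neg fun h => h6 (h5.mp h)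

end Positions

/-! ### Assembling the cone sum from pattern sums -/

section Assembly

variable {n : ℕ} {V : GTIndex n → ℤ} {K : Type*} [Field K] {t : K} {X : Finset K}

theorem admissible_valueSteps (hV : IsTriangle V) (c : ℤ) {x : ℕ → K}
    (hx : ∀ i < n, x (i + 1) ∈ X) (hinj : ∀ i < n, ∀ j < n, x (i + 1) = x (j + 1) → i = j) :
    Admissible X (valueLen V c 0) (valueSteps V c x 0 n) := by
  refine ⟨validSteps_valueSteps hV c x 0 n (zero_add n), ?_, fun s hs => ?_⟩
  · rw [valueSteps, List.map_map]
    refine List.Nodup.map_on (fun i hi j hj h => ?_) List.nodup_range'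
    rw [List.mem_range'_1] at hi hj
    exact hinj i (by omega) j (by omega) h
  · obtain ⟨j, hj, rfl⟩ := List.mem_map.mp hs
    rw [List.mem_range'_1] at hj
    exact hx j (by omega)

/-- Splitting the coordinates of a dependent sum. -/
def sigmaAddEquiv {C : Type*} (I : C → Type*) : ((Σ c, I c) → ℤ) ≃+ ∀ c, I c → ℤ :=
  { Equiv.piCurry fun _ _ => ℤ with
    map_add' := fun _ _ => rfl }

/-- Renaming the coordinates. -/
def arrowAddEquiv {α β : Type*} (e : α ≃ β) : (α → ℤ) ≃+ (β → ℤ) :=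
  { Equiv.arrowCongr e (Equiv.refl ℤ) with
    map_add' := fun _ _ => rfl }

theorem arrowAddEquiv_apply {α β : Type*} (e : α ≃ β) (d : α → ℤ) (a : α) :
    arrowAddEquiv e d (e a) = d a := by
  change d (e.symm (e a)) = d a
  rw [Equiv.symm_apply_apply]

open Classical in
/-- The sum over all integer points of a tangent cone is a product over the values of the apex. -/
theorem rsum_valueWeight (hV : IsTriangle V) (hX : Generic t X) {x : ℕ → K}
    (hx : ∀ i < n, x (i + 1) ∈ X) (hinj : ∀ i < n, ∀ j < n, x (i + 1) = x (j + 1) → i = j) :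
    RSum (fun d : GTIndex n → ℤ => (if ∀ p : GTIndex n, p.row = 0 → d p = 0 then 1 else 0) *
      ∏ c ∈ Finset.univ.image V, ∏ j ∈ Finset.range n, (valueWeight t V d c j *
          x (j + 1) ^ ((valueRow V d c j).sum - (valueRow V d c (j + 1)).sum)))
      (∏ c ∈ Finset.univ.image V, patternSum t (valueLen V c 0) (valueSteps V c x 0 n)
        (Multiset.replicate (valueLen V c 0) 0)) := by
  choose e he using fun c : {c // c ∈ Finset.univ.image V} =>
    exists_idxEquiv hV t c.1 x n 0 (valueLen V c.1 0) (zero_add n) rfl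
  let I := fun c : {c // c ∈ Finset.univ.image V} => Idx (valueLen V c.1 0) (valueSteps V c.1 x 0 n)
  -- All positions split into the top row, where `d` is pinned to 0, and one block of pattern
  -- positions for each value of `V`.
  let E : {p : GTIndex n // p.row = 0} ⊕ (Σ c, I c) ≃ GTIndex n := Equiv.ofBijective
    (Sum.elim (fun p => p.1) fun q => (e q.1 q.2).1) (by
    constructor
    · rintro (a | ⟨c, a⟩) (b | ⟨c', b⟩) h
      · exact congrArg Sum.inl (Subtype.ext h)
      · exfalso
        have h1 : a.1 = (e c' b).1 := h
        have h2 := (e c' b).2.1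
        rw [← h1, a.2] at h2
        exact lt_irrefl _ h2
      · exfalso
        have h1 : (e c a).1 = b.1 := h
        have h2 := (e c a).2.1
        rw [h1, b.2] at h2
        exact lt_irrefl _ h2
      · have h1 : (e c a).1 = (e c' b).1 := h
        obtain rfl : c = c' := Subtype.ext (by rw [← (e c a).2.2, ← (e c' b).2.2, h1])
        rw [(e c).injective (Subtype.ext h1)]
    · intro p
      by_cases hp : p.row = 0
      · exact ⟨Sum.inl ⟨p, hp⟩, rfl⟩
      · refine ⟨Sum.inr ⟨⟨V p, Finset.mem_image_of_mem V (Finset.mem_univ p)⟩,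
          (e _).symm ⟨p, Nat.pos_of_ne_zero hp, rfl⟩⟩, ?_⟩
        simp)
  let A : ({p : GTIndex n // p.row = 0} → ℤ) × (∀ c, I c → ℤ) ≃+ (GTIndex n → ℤ) :=
    ((AddEquiv.prodCongr (AddEquiv.refl _) (sigmaAddEquiv I).symm).trans
      (sumAddEquiv _ _).symm).trans (arrowAddEquiv E)
  have hA1 : ∀ q p, A q (E (Sum.inl p)) = q.1 p := fun q p => arrowAddEquiv_apply E _ _
  have hA2 : ∀ q c j, A q (E (Sum.inr ⟨c, j⟩)) = q.2 c j := fun q c j => arrowAddEquiv_apply E _ _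
  rw [← Finset.prod_coe_sort, ← rsum_equiv_iff A]
  have h0 : ∀ c : {c // c ∈ Finset.univ.image V}, RSum (fun b : I c → ℤ => patternTerm t
      (valueLen V c.1 0) (valueSteps V c.1 x 0 n) (Multiset.replicate (valueLen V c.1 0) 0) b) _ :=
    fun c => rsum_patternSum hX (admissible_valueSteps hV c.1 hx hinj) _
  have h1 := (rsum_single (0 : {p : GTIndex n // p.row = 0} → ℤ) (1 : K)).prod (RSum.pi h0)
  rw [one_mul] at h1
  convert h1 using 2 with q
  have h2 : (∀ p : GTIndex n, p.row = 0 → A q p = 0) ↔ q.1 = 0 := by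
    constructor
    · intro h
      ext p
      rw [← hA1]
      exact h _ p.2
    · intro h p hp
      have := hA1 q ⟨p, hp⟩
      rw [h] at this
      exact this
  simp only [Function.comp, h2]
  split_ifs with h3
  · rw [one_mul, one_mul, ← Finset.prod_coe_sort]
    refine Finset.prod_congr rfl fun c _ => ?_
    have h4 := he c (A q)
    rw [valueRow_eq_replicate c.1 (h2.mpr h3)] at h4
    rw [Finset.range_eq_Ico, ← h4]
    congr 1
    ext j
    exact hA2 q c j
  · rw [zero_mul, zero_mul]

theorem valueRow_sum (V d : GTIndex n → ℤ) (c : ℤ) (i : ℕ) :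
    (valueRow V d c i).sum = ∑ p : GTIndex n with p.row = i ∧ V p = c, d p := rfl

/-- The monomial of a triangle, by rows. -/
theorem prod_valueRow_zpow {x : ℕ → K} (hx0 : x 0 = 1) (hx : ∀ i, x i ≠ 0) (V d : GTIndex n → ℤ) :
    ∏ c ∈ Finset.univ.image V, ∏ j ∈ Finset.range n,
      x (j + 1) ^ ((valueRow V d c j).sum - (valueRow V d c (j + 1)).sum) =
    ∏ p : GTIndex n, ((x p.row)⁻¹ * x (p.row + 1)) ^ d p := by
  classical
  rw [← Finset.prod_fiberwise_of_maps_to (s := Finset.univ) (t := Finset.univ.image V) (g := V)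
    (fun p _ => Finset.mem_image_of_mem V (Finset.mem_univ p))]
  refine Finset.prod_congr rfl fun c _ => ?_
  rw [← Finset.prod_fiberwise_of_maps_to (t := Finset.range n) (g := GTIndex.row)
    (fun p _ => Finset.mem_range.mpr (by have := row_add_col_lt p; omega))]
  have h1 : ∀ i ∈ Finset.range n,
      ∏ p ∈ (Finset.univ.filter fun p : GTIndex n => V p = c) with p.row = i,
        ((x p.row)⁻¹ * x (p.row + 1)) ^ d p =
      x (i + 1) ^ (valueRow V d c i).sum / x i ^ (valueRow V d c i).sum := by
    intro i _
    rw [valueRow_sum, Finset.filter_filter]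
    have h2 : ∀ (s : Finset (GTIndex n)) (a : K), a ≠ 0 → ∏ p ∈ s, a ^ d p = a ^ ∑ p ∈ s, d p := by
      intro s a ha
      induction s using Finset.induction_on with
      | empty => simp
      | insert p s hp ih => rw [Finset.prod_insert hp, Finset.sum_insert hp, ih, zpow_add₀ ha]
    have h3 : (Finset.univ.filter fun p : GTIndex n => V p = c ∧ p.row = i) =
        Finset.univ.filter fun p : GTIndex n => p.row = i ∧ V p = c := by
      ext p; simp [and_comm]
    rw [h3, ← div_zpow, ← h2 _ _ (div_ne_zero (hx _) (hx _))]
    refine Finset.prod_congr rfl fun p hp => ?_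
    rw [(Finset.mem_filter.mp hp).2.1, inv_mul_eq_div]
  rw [Finset.prod_congr rfl h1, Finset.prod_div_distrib]
  have h4 : ∏ j ∈ Finset.range n, x (j + 1) ^ ((valueRow V d c j).sum - (valueRow V d c (j + 1)).sum) =
      (∏ j ∈ Finset.range n, x (j + 1) ^ (valueRow V d c j).sum) /
        ∏ j ∈ Finset.range n, x (j + 1) ^ (valueRow V d c (j + 1)).sum := by
    rw [← Finset.prod_div_distrib]
    exact Finset.prod_congr rfl fun j _ => zpow_sub₀ (hx _) _ _
  rw [h4]
  congr 1
  -- Summation by parts: the boundary terms are trivial because `x 0 = 1` and row `n` is empty.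
  have h5 := Finset.prod_range_succ (fun j => x j ^ (valueRow V d c j).sum) n
  have h6 := Finset.prod_range_succ' (fun j => x j ^ (valueRow V d c j).sum) n
  have h7 : (valueRow V d c n).sum = 0 := by
    rw [valueRow_sum]
    refine Finset.sum_eq_zero fun p hp => ?_
    have := row_add_col_lt p
    have := (Finset.mem_filter.mp hp).2.1
    omega
  rw [h5] at h6
  simpa [h7, hx0] using h6.symm

end Assembly

end

end GTHL

namespace GTHL

noncomputable section

/-! ### The variables of the specialization -/

section Variables

variable {n : ℕ}

/-- The polynomial `x_k`. -/
def xPoly (n k : ℕ) : MvPolynomial (Fin (n - 1)) (Polynomial ℤ) :=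
  if h : 1 ≤ k ∧ k ≤ n - 1 then MvPolynomial.X ⟨k - 1, by omega⟩ else 1

theorem xVar_eq_algebraMap (n k : ℕ) : xVar n k = algebraMap _ (XField n) (xPoly n k) := by
  rw [xVar, xPoly]
  split_ifs
  · rfl
  · rw [map_one]

theorem eval_xPoly (n k : ℕ) : MvPolynomial.eval (fun _ => 1) (xPoly n k) = 1 := by
  rw [xPoly]
  split_ifs <;> simp

theorem xPoly_ne_zero (n k : ℕ) : xPoly n k ≠ 0 := by
  intro h
  have := eval_xPoly n k
  rw [h, map_zero] at this
  exact zero_ne_one this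

theorem xVar_ne_zero (n k : ℕ) : xVar n k ≠ 0 := by
  rw [xVar_eq_algebraMap, Ne, FaithfulSMul.algebraMap_eq_zero_iff]
  exact xPoly_ne_zero n k

theorem xVar_zero (n : ℕ) : xVar n 0 = 1 := dif_neg (by omega)

theorem xVar_self (n : ℕ) : xVar n n = 1 := dif_neg (by omega)

/-- Setting all `x_i` to 1 would give `1 = t`, which fails at `t = 0`. -/
theorem xVar_ne_tVar_mul (j k : ℕ) : xVar n j ≠ tVar n * xVar n k := by
  intro h
  rw [tVar, xVar_eq_algebraMap, xVar_eq_algebraMap, IsScalarTower.algebraMap_apply (Polynomial ℤ)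
    (MvPolynomial (Fin (n - 1)) (Polynomial ℤ)), ← map_mul] at h
  have h1 := FaithfulSMul.algebraMap_injective _ _ h
  have h2 := congrArg (MvPolynomial.eval fun _ => 1) h1
  rw [map_mul, eval_xPoly, eval_xPoly, MvPolynomial.algebraMap_eq, MvPolynomial.eval_C, mul_one]
    at h2
  have h3 := congrArg (Polynomial.eval 0) h2
  simp at h3

theorem prod_X_zpow_eq_one {σ : Type*} [Fintype σ] {R : Type*} [CommRing R] [IsDomain R]
    {g : σ → ℤ} (h : ∏ i, algebraMap (MvPolynomial σ R) (FractionRing (MvPolynomial σ R))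
      (MvPolynomial.X i) ^ g i = 1) (i : σ) : g i = 0 := by
  have hX : ∀ i, algebraMap (MvPolynomial σ R) (FractionRing (MvPolynomial σ R))
      (MvPolynomial.X i) ≠ 0 := fun i => by
    rw [Ne, FaithfulSMul.algebraMap_eq_zero_iff]
    exact MvPolynomial.X_ne_zero i
  have h1 : ∏ i, algebraMap (MvPolynomial σ R) (FractionRing (MvPolynomial σ R))
      (MvPolynomial.X i) ^ g i = (∏ i, algebraMap (MvPolynomial σ R)
        (FractionRing (MvPolynomial σ R)) (MvPolynomial.X i) ^ (g i).toNat) /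
        ∏ i, algebraMap (MvPolynomial σ R) (FractionRing (MvPolynomial σ R))
          (MvPolynomial.X i) ^ (-g i).toNat := by
    rw [← Finset.prod_div_distrib]
    refine Finset.prod_congr rfl fun i _ => ?_
    rw [eq_div_iff (pow_ne_zero _ (hX i)), ← zpow_natCast, ← zpow_natCast, ← zpow_add₀ (hX i)]
    congr 1
    omega
  rw [h1, div_eq_one_iff_eq (Finset.prod_ne_zero_iff.mpr fun i _ => pow_ne_zero _ (hX i))] at h
  simp only [← map_pow, ← map_prod] at h
  have h2 := FaithfulSMul.algebraMap_injective _ _ h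
  have h3 : ∀ a : σ → ℕ, ∏ i, (MvPolynomial.X i : MvPolynomial σ R) ^ a i =
      MvPolynomial.monomial (Finsupp.equivFunOnFinite.symm a) 1 := fun a => by
    rw [MvPolynomial.monomial_eq, map_one, one_mul, Finsupp.prod_fintype _ _ (by simp)]
    rfl
  rw [h3, h3] at h2
  have h4 := congrFun (congrArg DFunLike.coe
    (MvPolynomial.monomial_left_injective (one_ne_zero (α := R)) h2)) i
  simp only [Finsupp.equivFunOnFinite_symm_apply_apply] at h4
  omega

/-- The variables `x_1, …, x_{n-1}` are independent; the exponent of `x_n = 1` is invisible in the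
product but is recovered from the degree condition. -/
theorem xVar_indep {f : ℕ → ℤ} (h0 : ∑ i ∈ Finset.range n, f i = 0)
    (h1 : ∏ i ∈ Finset.range n, xVar n (i + 1) ^ f i = 1) : ∀ i < n, f i = 0 := by
  rcases Nat.eq_zero_or_pos n with rfl | hn
  · exact fun i hi => absurd hi (Nat.not_lt_zero i)
  obtain ⟨m, rfl⟩ := Nat.exists_eq_add_of_le' hn
  rw [Finset.prod_range_succ, xVar_self, one_zpow, mul_one, Finset.prod_range] at h1
  have h2 : ∀ i : Fin (m + 1 - 1), f i = 0 := by
    refine prod_X_zpow_eq_one (R := Polynomial ℤ) (g := fun i : Fin (m + 1 - 1) => f i) ?_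
    refine Eq.trans (Finset.prod_congr rfl fun i _ => ?_) h1
    rw [xVar, dif_pos ⟨by omega, by have := i.2; omega⟩]
    rfl
  have h3 : ∀ i < m, f i = 0 := fun i hi => h2 ⟨i, hi⟩
  intro i hi
  rcases Nat.lt_succ_iff_lt_or_eq.mp hi with h | rfl
  · exact h3 i h
  · rw [Finset.sum_range_succ, Finset.sum_eq_zero fun i hi => h3 i (Finset.mem_range.mp hi),
      zero_add] at h0
    exact h0

theorem xVar_injOn {i j : ℕ} (hi : i < n) (hj : j < n) (h : xVar n (i + 1) = xVar n (j + 1)) :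
    i = j := by
  by_contra hij
  have := xVar_indep (n := n) (f := fun k => (if k = i then 1 else 0) - if k = j then 1 else 0) ?_ ?_
    i hi
  · simp [hij] at this
  · rw [Finset.sum_sub_distrib]; simp [hi, hj]
  · have h1 : ∀ a < n, ∏ k ∈ Finset.range n, xVar n (k + 1) ^ (if k = a then (1 : ℤ) else 0) =
        xVar n (a + 1) := fun a ha => by
      rw [Finset.prod_eq_single a (fun b _ hb => by rw [if_neg hb, zpow_zero])
        (fun h => absurd (Finset.mem_range.mpr ha) h), if_pos rfl, zpow_one]
    simp only [zpow_sub₀ (xVar_ne_zero n _)]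
    rw [Finset.prod_div_distrib, h1 i hi, h1 j hj, h, div_self (xVar_ne_zero n _)]

open Classical in
/-- The set of the variables `x_1, …, x_n`. -/
def varSet (n : ℕ) : Finset (XField n) := (Finset.range n).image fun i => xVar n (i + 1)

theorem xVar_mem_varSet {i : ℕ} (hi : i < n) : xVar n (i + 1) ∈ varSet n := by
  classical
  exact Finset.mem_image_of_mem (fun i => xVar n (i + 1)) (Finset.mem_range.mpr hi)

theorem generic_varSet (n : ℕ) : Generic (tVar n) (varSet n) := by
  classical
  have hinj : Set.InjOn (fun i => xVar n (i + 1)) (Finset.range n : Set ℕ) :=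
    fun i hi j hj h => xVar_injOn (Finset.mem_range.mp hi) (Finset.mem_range.mp hj) h
  have hmem : ∀ y ∈ varSet n, ∃ i < n, xVar n (i + 1) = y := fun y hy => by
    obtain ⟨i, hi, h⟩ := Finset.mem_image.mp hy
    exact ⟨i, Finset.mem_range.mp hi, h⟩
  refine ⟨fun y hy => ?_, fun y hy z hz _ => ?_, fun e h1 h2 y hy => ?_⟩
  · obtain ⟨i, -, rfl⟩ := hmem y hy
    exact xVar_ne_zero n _
  · obtain ⟨i, -, rfl⟩ := hmem y hy
    obtain ⟨j, -, rfl⟩ := hmem z hz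
    exact xVar_ne_tVar_mul _ _
  · obtain ⟨i, hi, rfl⟩ := hmem y hy
    have e1 : varSet n = (Finset.range n).image fun i => xVar n (i + 1) := by
      unfold varSet; congr!
    rw [e1, Finset.sum_image hinj] at h1
    rw [e1, Finset.prod_image hinj] at h2
    exact xVar_indep (f := fun i => e (xVar n (i + 1))) h1 h2 i hi

theorem specF_ne_zero (p : GTIndex n) : specF n p ≠ 0 :=
  mul_ne_zero (inv_ne_zero (xVar_ne_zero n _)) (xVar_ne_zero n _)

/-- The exponent of `x_{i+1}` is the drop from the number of positions of `A` in row `i` to that in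
row `i + 1`. If the product is 1, these numbers are constant, and they start at 0 since `A` avoids
the top row. -/
theorem prod_specF_ind_ne_one {A : Finset (GTIndex n)} (hA : ∀ p ∈ A, p.row ≠ 0) (hne : A ≠ ∅) :
    ∏ p, specF n p ^ ind A p ≠ 1 := by
  classical
  intro h
  obtain ⟨q, hq⟩ := Finset.nonempty_iff_ne_empty.mpr hne
  -- The zero triangle has a single value, so its value rows are the full rows.
  have h1 := prod_valueRow_zpow (xVar_zero n) (xVar_ne_zero n) (0 : GTIndex n → ℤ) (ind A)
  have h2 : (Finset.univ.image (0 : GTIndex n → ℤ)) = {0} := by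
    ext c
    simp only [Finset.mem_image, Finset.mem_univ, true_and, Finset.mem_singleton, Pi.zero_apply]
    exact ⟨fun ⟨_, h⟩ => h.symm, fun h => ⟨q, h.symm⟩⟩
  rw [h2, Finset.prod_singleton] at h1
  set S : ℕ → ℤ := fun i => (valueRow (0 : GTIndex n → ℤ) (ind A) 0 i).sum with hS
  have hS0 : S 0 = 0 := by
    rw [hS]
    refine (valueRow_sum _ _ _ _).trans (Finset.sum_eq_zero fun p hp => if_neg fun hpA => ?_)
    exact hA p hpA (Finset.mem_filter.mp hp).2.1
  have hSn : S n = 0 := by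
    rw [hS]
    refine (valueRow_sum _ _ _ _).trans (Finset.sum_eq_zero fun p hp => ?_)
    have := row_add_col_lt p
    have := (Finset.mem_filter.mp hp).2.1
    omega
  have h3 := xVar_indep (n := n) (f := fun i => S i - S (i + 1))
    (by rw [Finset.sum_range_sub', hS0, hSn, sub_self]) (h1.trans h)
  have h4 : ∀ i ≤ n, S i = 0 := by
    intro i
    induction i with
    | zero => exact fun _ => hS0
    | succ i ih =>
      intro hi
      have := h3 i (by omega)
      have := ih (by omega)
      omega
  have hqn := row_add_col_lt q
  have h5 : S q.row = ∑ p : GTIndex n with p.row = q.row ∧ (0 : GTIndex n → ℤ) p = 0, ind A p :=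
    valueRow_sum _ _ _ _
  rw [h4 q.row (by omega)] at h5
  have h6 := (Finset.sum_eq_zero_iff_of_nonneg fun p _ => ind_nonneg A p).mp h5.symm q
    (Finset.mem_filter.mpr ⟨Finset.mem_univ q, rfl, rfl⟩)
  simp [ind, hq] at h6

end Variables

/-! ### The contribution of an integer triangle -/

section Contribution

variable {n : ℕ} {l : Fin n → ℤ} {V : GTIndex n → ℤ}

theorem isTriangle_of_mem (hl : Antitone l) (hV : toReal V ∈ gtPolytope l) : IsTriangle V := by
  obtain ⟨h1, h2⟩ := mem_gtPolytope_iff.mp hV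
  refine ⟨fun p q hp hq hpq => ?_, fun u w h => Int.cast_le.mp (h2 u w h)⟩
  have h3 : V p = l p.1.2 := Int.cast_injective (α := ℝ) (h1 p hp)
  have h4 : V q = l q.1.2 := Int.cast_injective (α := ℝ) (h1 q hq)
  rw [h3, h4]
  exact hl hpq

theorem coneCond_comp_iff {φ : ℤ → ℤ} (hφ : StrictMono φ) (h0 : φ 0 = 0) (d : GTIndex n → ℤ) :
    ConeCond V (φ ∘ d) ↔ ConeCond V d := by
  refine and_congr (forall₂_congr fun p _ => ?_) (forall₄_congr fun u w _ _ => hφ.le_iff_le)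
  rw [Function.comp, ← hφ.injective.eq_iff (a := d p), h0]

open Classical in
theorem orderInvariant_coneWeight (V : GTIndex n → ℤ) :
    OrderInvariant 0 fun d : GTIndex n → ℤ => if ConeCond V d then
      ∏ i ∈ Finset.range n, rowProd (fun p => (V p, d p)) i else 0 := by
  intro φ hφ hfix d
  have h0 : φ 0 = 0 := hfix 0 (by simp)
  simp only [coneCond_comp_iff hφ h0]
  congr 1
  refine Finset.prod_congr rfl fun i _ => rowProd_congr fun p q _ _ => ?_
  rw [Prod.mk.injEq, Prod.mk.injEq, Function.comp, Function.comp, hφ.injective.eq_iff]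

theorem algebraMap_siteWeight {R S : Type*} [CommRing R] [CommRing S] (f : R →+* S) (t : R)
    (m r : ℕ) : f (siteWeight t m r) = siteWeight (f t) m r := by
  unfold siteWeight
  split_ifs <;> simp

theorem map_valueWeight {R S : Type*} [CommRing R] [CommRing S] (f : R →+* S) (t : R)
    (V d : GTIndex n → ℤ) (c : ℤ) (i : ℕ) : f (valueWeight t V d c i) = valueWeight (f t) V d c i := by
  classical
  unfold valueWeight rowWeight
  split_ifs
  · rw [map_prod]
    exact Finset.prod_congr rfl fun _ _ => algebraMap_siteWeight f t _ _
  · simp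
  · simp

/-- The contribution of an integer triangle as a product over its values. -/
theorem hasContribution_of_mem (hl : Antitone l) (hV : toReal V ∈ gtPolytope l) :
    HasContribution l (toReal V) ((∏ p, specF n p ^ V p) *
      ∏ c ∈ Finset.univ.image V, patternSum (tVar n) (valueLen V c 0)
        (valueSteps V c (xVar n) 0 n) (Multiset.replicate (valueLen V c 0) 0)) := by
  classical
  have hT := isTriangle_of_mem hl hV
  set S := weightedSeries (tangentCone (gtPolytope l) (toReal V))
    (coneWeight (gtPolytope l) (gtPhi l)) with hS
  set f : (GTIndex n → ℤ) → Polynomial ℤ := fun d => if ConeCond V d then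
      ∏ i ∈ Finset.range n, rowProd (fun p => (V p, d p)) i else 0 with hf
  have hSf : ∀ d, S (V + d) = f d := fun d => weightedSeries_tangentCone hV d
  -- Leaving out the pinned top row is essential: a set with one position in each row specializes to
  -- `x_n / x_0 = 1`, and its factor would vanish.
  obtain ⟨Q, hQ⟩ := exists_toLaurent_eq_killer (R := Polynomial ℤ)
    (Finset.univ.filter fun p : GTIndex n => p.row ≠ 0)
  have hS' : S = act (AddMonoidAlgebra.single V 1) f := by
    ext b
    rw [act_single, one_mul, ← hSf, add_sub_cancel]
  have hfin : (act (toLaurent Q) S).support.Finite := by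
    rw [hS', act_comm, hQ]
    refine (act_finite_finsum _ _ (act_killer_finite le_rfl (orderInvariant_coneWeight V) ?_)).1
    intro d hd i hi
    by_contra h0
    apply hd
    refine if_neg fun hc => h0 (hc.1 i ?_)
    by_contra h1
    exact hi (Finset.mem_filter.mpr ⟨Finset.mem_univ i, h1⟩)
  have hQ0 : MvPolynomial.aeval (specF n) Q ≠ 0 := by
    rw [aeval_eq_eps_twist specF_ne_zero, hQ]
    refine eps_twist_killer_ne_zero fun A hA hne => ?_
    rw [prodChar_ofAdd]
    exact prod_specF_ind_ne_one (fun p hp => (Finset.mem_filter.mp (hA hp)).2) hne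
  refine exists_hasRationalForm_hasSpecialization (y := specF n) specF_ne_zero hQ0 hfin ?_
  have h1 := rsum_valueWeight hT (generic_varSet n) (fun i hi => xVar_mem_varSet hi)
    (fun i hi j hj h => xVar_injOn hi hj h)
  have h2 := rsum_comp_add (-V) (h1.smul (∏ p, specF n p ^ V p))
  convert h2 using 2 with b
  have h3 : S b = f (b + -V) := by rw [← hSf]; congr 1; abel
  have h4 : ∏ p, specF n p ^ b p = (∏ p, specF n p ^ V p) * ∏ p, specF n p ^ (b + -V) p := by
    rw [← Finset.prod_mul_distrib]
    refine Finset.prod_congr rfl fun p _ => ?_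
    rw [← zpow_add₀ (specF_ne_zero p)]
    congr 1
    simp
  rw [h3, h4]
  set d := b + -V
  have h5 : f d = _ := coneWeight_eq_prod hT d
  have h6 := prod_valueRow_zpow (xVar_zero n) (xVar_ne_zero n) V d
  have h7 : ∏ p, specF n p ^ d p = ∏ p : GTIndex n, ((xVar n p.row)⁻¹ * xVar n (p.row + 1)) ^ d p :=
    rfl
  rw [h5, h7, ← h6, map_mul, map_prod]
  simp only [map_prod, map_valueWeight, Finset.prod_mul_distrib]
  have h8 : algebraMap (Polynomial ℤ) (XField n) Polynomial.X = tVar n := rfl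
  rw [h8]
  split_ifs
  · rw [map_one]; ring
  · rw [map_zero]; ring

end Contribution

end

end GTHL

namespace GTHL

noncomputable section

/-! ### Symmetrization -/

section Symmetrization

variable {F : Type*} [Field F]

/-- The factor of a pair of variables in the Hall–Littlewood formula. -/
def hlFactor (t a b : F) : F := (a - t * b) / (a - b)

/-- Interpolate `q = ∏ (X - t y_b) - ∏ (X - y_b)`, of degree less than `B.card`, at the nodes `y_b`
and evaluate at 0. The value at a node is `(1 - t) y_k ∏_{b ≠ k} (y_k - t y_b)`, and `q(0)` is `t ^
B.card - 1` times the product of the `-y_b`. -/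
theorem sum_prod_hlFactor {α : Type*} [DecidableEq α] {t : F} (ht : t ≠ 1) {y : α → F}
    (B : Finset α) (hinj : Set.InjOn y B) (h0 : ∀ b ∈ B, y b ≠ 0) :
    ∑ k ∈ B, ∏ b ∈ B.erase k, hlFactor t (y k) (y b) = ∑ i ∈ Finset.range B.card, t ^ i := by
  rcases B.eq_empty_or_nonempty with rfl | hB
  · simp
  set q : Polynomial F := ∏ b ∈ B, (Polynomial.X - Polynomial.C (t * y b)) -
    ∏ b ∈ B, (Polynomial.X - Polynomial.C (y b)) with hq
  have hdeg : q.degree < B.card := by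
    have d1 : (∏ b ∈ B, (Polynomial.X - Polynomial.C (t * y b))).degree = (B.card : WithBot ℕ) := by
      rw [Polynomial.degree_prod]
      simp only [Polynomial.degree_X_sub_C, Finset.sum_const, nsmul_one]
    have d2 : (∏ b ∈ B, (Polynomial.X - Polynomial.C (y b))).degree = (B.card : WithBot ℕ) := by
      rw [Polynomial.degree_prod]
      simp only [Polynomial.degree_X_sub_C, Finset.sum_const, nsmul_one]
    rw [← d1]
    refine Polynomial.degree_sub_lt_left (by rw [d1, d2]) ?_ ?_
    · exact (Polynomial.monic_prod_of_monic _ _ fun b _ => Polynomial.monic_X_sub_C _).ne_zero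
    · rw [(Polynomial.monic_prod_of_monic _ _ fun b _ => Polynomial.monic_X_sub_C _).leadingCoeff,
        (Polynomial.monic_prod_of_monic _ _ fun b _ => Polynomial.monic_X_sub_C _).leadingCoeff]
  have h1 := congrArg (Polynomial.eval 0) (Lagrange.eq_interpolate hinj hdeg)
  have hqk : ∀ k ∈ B, q.eval (y k) = (1 - t) * y k * ∏ b ∈ B.erase k, (y k - t * y b) := by
    intro k hk
    rw [hq, Polynomial.eval_sub, Polynomial.eval_prod, Polynomial.eval_prod,
      ← Finset.mul_prod_erase B _ hk, Finset.prod_eq_zero (i := k) hk (by simp)]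
    simp only [Polynomial.eval_sub, Polynomial.eval_X, Polynomial.eval_C, sub_zero]
    ring
  have hq0 : q.eval 0 = (t ^ B.card - 1) * ∏ b ∈ B, -y b := by
    rw [hq, Polynomial.eval_sub, Polynomial.eval_prod, Polynomial.eval_prod]
    simp only [Polynomial.eval_sub, Polynomial.eval_X, Polynomial.eval_C, zero_sub]
    rw [sub_mul, one_mul, ← Finset.prod_const, ← Finset.prod_mul_distrib]
    congr 1
    exact Finset.prod_congr rfl fun b _ => by ring
  rw [hq0, Lagrange.interpolate_apply, Polynomial.eval_finsetSum] at h1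
  have hterm : ∀ k ∈ B, Polynomial.eval 0 (Polynomial.C (q.eval (y k)) * Lagrange.basis B y k) =
      (t - 1) * (∏ b ∈ B, -y b) * ∏ b ∈ B.erase k, hlFactor t (y k) (y b) := by
    intro k hk
    rw [Polynomial.eval_mul, Polynomial.eval_C, hqk k hk, Lagrange.basis, Polynomial.eval_prod,
      ← Finset.mul_prod_erase B (fun b => -y b) hk]
    simp only [Lagrange.basisDivisor, Polynomial.eval_mul, Polynomial.eval_C, Polynomial.eval_sub,
      Polynomial.eval_X, zero_sub, hlFactor, Finset.prod_div_distrib, Finset.prod_mul_distrib,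
      Finset.prod_inv_distrib]
    ring
  rw [Finset.sum_congr rfl hterm, ← Finset.mul_sum] at h1
  have h2 : ∏ b ∈ B, -y b ≠ 0 := Finset.prod_ne_zero_iff.mpr fun b hb => neg_ne_zero.mpr (h0 b hb)
  have h3 : t - 1 ≠ 0 := sub_ne_zero.mpr ht
  have h4 := mul_geom_sum t B.card
  rw [← h4] at h1
  have h5 : ((t - 1) * ∏ b ∈ B, -y b) * ∑ i ∈ Finset.range B.card, t ^ i =
      ((t - 1) * ∏ b ∈ B, -y b) * ∑ k ∈ B, ∏ b ∈ B.erase k, hlFactor t (y k) (y b) := by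
    rw [← h1]; ring
  exact (mul_left_cancel₀ (mul_ne_zero h3 h2) h5).symm

/-- The permutation of `Fin (n + 1)` with first value `k` and relative order of the other values
given by `w`. -/
def consPerm {n : ℕ} (k : Fin (n + 1)) (w : Equiv.Perm (Fin n)) : Equiv.Perm (Fin (n + 1)) :=
  ((finSuccEquiv' 0).trans (Equiv.optionCongr w)).trans (finSuccEquiv' k).symm

@[simp] theorem consPerm_zero {n : ℕ} (k : Fin (n + 1)) (w : Equiv.Perm (Fin n)) :
    consPerm k w 0 = k := by
  simp [consPerm]

@[simp] theorem consPerm_succ {n : ℕ} (k : Fin (n + 1)) (w : Equiv.Perm (Fin n)) (j : Fin n) :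
    consPerm k w j.succ = k.succAbove (w j) := by
  have := finSuccEquiv'_succAbove (0 : Fin (n + 1)) j
  rw [Fin.succAbove_zero] at this
  simp [consPerm, this]

theorem consPerm_bijective (n : ℕ) : Function.Bijective
    fun q : Fin (n + 1) × Equiv.Perm (Fin n) => consPerm q.1 q.2 := by
  rw [Fintype.bijective_iff_injective_and_card]
  refine ⟨?_, ?_⟩
  · rintro ⟨k, w⟩ ⟨k', w'⟩ h
    have h : consPerm k w = consPerm k' w' := h
    have h0 := Equiv.congr_fun h 0
    rw [consPerm_zero, consPerm_zero] at h0
    subst h0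
    congr 1
    ext j
    have := Equiv.congr_fun h j.succ
    rw [consPerm_succ, consPerm_succ] at this
    exact congrArg Fin.val (Fin.succAbove_right_injective this)
  · rw [Fintype.card_prod, Fintype.card_perm, Fintype.card_perm, Fintype.card_fin, Fintype.card_fin,
      Nat.factorial_succ]

theorem sum_perm_succ {n : ℕ} {M : Type*} [AddCommMonoid M] (f : Equiv.Perm (Fin (n + 1)) → M) :
    ∑ w, f w = ∑ k, ∑ w', f (consPerm k w') := by
  rw [← Fintype.sum_prod_type']
  exact (Function.Bijective.sum_comp (consPerm_bijective n) f).symm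

variable {n : ℕ}

/-- The product of the factors of all pairs of variables in the same block. -/
def blockProd (t : F) (y : Fin n → F) (l : Fin n → ℤ) (w : Equiv.Perm (Fin n)) : F :=
  ∏ i, ∏ j, if i < j ∧ l i = l j then hlFactor t (y (w i)) (y (w j)) else 1

/-- A power of `t` with the length of a permutation as exponent, as a product. -/
def lengthProd (t : F) (w : Equiv.Perm (Fin n)) : F :=
  ∏ i, ∏ j, if i < j ∧ w j < w i then t else 1

theorem blockProd_consPerm (t : F) (y : Fin (n + 1) → F) (l : Fin (n + 1) → ℤ) (k : Fin (n + 1))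
    (w : Equiv.Perm (Fin n)) : blockProd t y l (consPerm k w) =
      (∏ j, if l 0 = l (Fin.succ j) then hlFactor t (y k) (y (k.succAbove (w j))) else 1) *
        blockProd t (fun j => y (k.succAbove j)) (fun j => l j.succ) w := by
  unfold blockProd
  rw [Fin.prod_univ_succ, Fin.prod_univ_succ]
  simp [Fin.prod_univ_succ, Fin.succ_pos]

/-- The first place is inverted with exactly the `k` smaller values. -/
theorem lengthProd_consPerm (t : F) (k : Fin (n + 1)) (w : Equiv.Perm (Fin n)) :
    lengthProd t (consPerm k w) = t ^ (k : ℕ) * lengthProd t w := by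
  unfold lengthProd
  rw [Fin.prod_univ_succ, Fin.prod_univ_succ]
  simp only [lt_self_iff_false, false_and, if_false, one_mul, consPerm_zero, consPerm_succ,
    Fin.succ_pos, true_and, Fin.prod_univ_succ, Fin.not_lt_zero, Fin.succ_lt_succ_iff,
    Fin.succAbove_lt_succAbove_iff]
  congr 1
  rw [Equiv.prod_comp w fun j => if k.succAbove j < k then t else 1, Finset.prod_ite,
    Finset.prod_const, Finset.prod_const_one, mul_one]
  congr 1
  have : (Finset.univ.filter fun j : Fin n => k.succAbove j < k).map Fin.valEmbedding =
      Finset.range k := by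
    ext a
    simp only [Finset.mem_map, Finset.mem_filter, Finset.mem_univ, true_and, Fin.valEmbedding_apply,
      Finset.mem_range, Fin.succAbove_lt_iff_castSucc_lt]
    constructor
    · rintro ⟨j, hj, rfl⟩
      exact hj
    · intro ha
      exact ⟨⟨a, by have := k.2; omega⟩, ha, rfl⟩
  rw [← Finset.card_map Fin.valEmbedding, this, Finset.card_range]

theorem forall_consPerm_iff {l μ : Fin (n + 1) → ℤ} {k : Fin (n + 1)} {w : Equiv.Perm (Fin n)} :
    (∀ i, μ (consPerm k w i) = l i) ↔ μ k = l 0 ∧ ∀ j, μ (k.succAbove (w j)) = l j.succ := by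
  rw [Fin.forall_fin_succ]
  simp

/-- Since `l` decreases, its first block is an initial segment, so the first value of a stabilizing
permutation runs over `0, …, B - 1` with `B` the size of the block. Deleting any member of the block
leaves the same sequence as deleting the first. -/
theorem sum_lengthProd_succ (t : F) {l : Fin (n + 1) → ℤ} (hl : Antitone l) :
    ∑ w : Equiv.Perm (Fin (n + 1)) with ∀ i, l (w i) = l i, lengthProd t w =
      (∑ i ∈ Finset.range (Finset.univ.filter fun k => l k = l 0).card, t ^ i) *
        ∑ w : Equiv.Perm (Fin n) with ∀ j, l (w j).succ = l j.succ, lengthProd t w := by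
  have hS : (Finset.univ.filter fun k => l k = l 0).map Fin.valEmbedding =
      Finset.range (Finset.univ.filter fun k => l k = l 0).card := by
    refine Finset.eq_of_subset_of_card_le (fun a ha => ?_) (by simp)
    obtain ⟨k, hk, rfl⟩ := Finset.mem_map.mp ha
    have h1 : Finset.Iic k ⊆ Finset.univ.filter fun k => l k = l 0 := fun j hj =>
      Finset.mem_filter.mpr ⟨Finset.mem_univ j, le_antisymm (hl (Fin.zero_le j))
        ((Finset.mem_filter.mp hk).2 ▸ hl (Finset.mem_Iic.mp hj))⟩
    have h2 := Finset.card_le_card h1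
    rw [Fin.card_Iic] at h2
    exact Finset.mem_range.mpr h2
  rw [← hS, Finset.sum_map, Finset.sum_mul, Finset.sum_filter, sum_perm_succ, Finset.sum_filter]
  refine Finset.sum_congr rfl fun k _ => ?_
  simp only [forall_consPerm_iff, Fin.valEmbedding_apply]
  split_ifs with hk
  · have h1 : ∀ j : Fin n, l (k.succAbove j) = l j.succ := by
      intro j
      rcases lt_or_ge j.castSucc k with hjk | hjk
      · rw [Fin.succAbove_of_castSucc_lt _ _ hjk]
        have h2 : l j.castSucc = l 0 := le_antisymm (hl (Fin.zero_le _)) (hk ▸ hl hjk.le)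
        have h3 : l j.succ = l 0 := le_antisymm (hl (Fin.zero_le _))
          (hk ▸ hl (Fin.castSucc_lt_iff_succ_le.mp hjk))
        rw [h2, h3]
      · rw [Fin.succAbove_of_le_castSucc _ _ hjk]
    simp only [hk, true_and, h1]
    rw [Finset.mul_sum, Finset.sum_filter]
    exact Finset.sum_congr rfl fun w _ => by rw [lengthProd_consPerm]
  · exact Finset.sum_eq_zero fun w _ => if_neg fun h => hk h.1

/-- Symmetrization of the product over the blocks gives the Poincaré polynomial. -/
theorem sum_blockProd {t : F} (ht : t ≠ 1) {y : Fin n → F} (hy : Function.Injective y)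
    (h0 : ∀ b, y b ≠ 0) {l μ : Fin n → ℤ} (hl : Antitone l)
    (hμ : ∃ w : Equiv.Perm (Fin n), ∀ i, μ (w i) = l i) :
    ∑ w : Equiv.Perm (Fin n) with ∀ i, μ (w i) = l i, blockProd t y l w =
      ∑ w : Equiv.Perm (Fin n) with ∀ i, l (w i) = l i, lengthProd t w := by
  induction n with
  | zero =>
    refine Finset.sum_congr ?_ fun w _ => by simp [blockProd, lengthProd]
    ext w
    simp only [Finset.mem_filter, Finset.mem_univ, true_and]
    exact ⟨fun _ i => i.elim0, fun _ i => i.elim0⟩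
  | succ n ih =>
    obtain ⟨u, hu⟩ := hμ
    have hcard : (Finset.univ.filter fun k => l k = l 0).card =
        (Finset.univ.filter fun k => μ k = l 0).card := by
      rw [← Finset.card_map u.toEmbedding]
      congr 1
      ext b
      simp only [Finset.mem_map_equiv, Finset.mem_filter, Finset.mem_univ, true_and]
      rw [← hu (u.symm b), Equiv.apply_symm_apply]
    rw [sum_lengthProd_succ t hl, hcard, ← sum_prod_hlFactor ht _ hy.injOn fun b _ => h0 b,
      Finset.sum_mul, Finset.sum_filter, sum_perm_succ, Finset.sum_filter]
    refine Finset.sum_congr rfl fun k _ => ?_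
    simp only [forall_consPerm_iff]
    split_ifs with hk
    · simp only [hk, true_and]
      -- Swapping `u 0` with `k`, where `μ` takes the same value, gives a permutation starting at
      -- `k`; its remainder is the required one.
      have hex : ∃ w : Equiv.Perm (Fin n), ∀ j, μ (k.succAbove (w j)) = l j.succ := by
        obtain ⟨⟨k', w'⟩, h1⟩ := (consPerm_bijective n).2 (Equiv.swap (u 0) k * u)
        have h1 : consPerm k' w' = Equiv.swap (u 0) k * u := h1
        have h2 := Equiv.congr_fun h1 0
        rw [consPerm_zero, Equiv.Perm.mul_apply, Equiv.swap_apply_left] at h2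
        subst h2
        refine ⟨w', fun j => ?_⟩
        rw [← consPerm_succ, h1, Equiv.Perm.mul_apply, ← hu j.succ]
        by_cases hj0 : u j.succ = u 0
        · exact absurd (u.injective hj0) (Fin.succ_ne_zero j)
        · by_cases hjk : u j.succ = k'
          · rw [hjk, Equiv.swap_apply_right, hu 0, hk]
          · rw [Equiv.swap_apply_of_ne_of_ne hj0 hjk]
      have := ih (y := fun j => y (k.succAbove j)) (hy.comp Fin.succAbove_right_injective)
        (fun b => h0 _) (l := fun j => l j.succ) (μ := fun j => μ (k.succAbove j))
        (fun i j hij => hl (Fin.succ_le_succ_iff.mpr hij)) hex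
      rw [← this, Finset.mul_sum, Finset.sum_filter]
      refine Finset.sum_congr rfl fun w _ => ?_
      split_ifs with hw
      · rw [blockProd_consPerm]
        congr 1
        simp only [← hw]
        rw [Equiv.prod_comp w fun j => if l 0 = μ (k.succAbove j) then
          hlFactor t (y k) (y (k.succAbove j)) else 1]
        have h3 := Fin.prod_univ_succAbove (fun b => if l 0 = μ b ∧ b ≠ k then
          hlFactor t (y k) (y b) else 1) k
        simp only [ne_eq, not_true_eq_false, and_false, if_false, one_mul, Fin.succAbove_ne,
          not_false_eq_true, and_true] at h3
        rw [← h3, ← Finset.prod_filter]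
        refine Finset.prod_congr ?_ fun _ _ => rfl
        ext b
        simp only [Finset.mem_filter, Finset.mem_univ, true_and, Finset.mem_erase, eq_comm (a := l 0)]
        exact and_comm
      · rfl
    · exact Finset.sum_eq_zero fun w _ => if_neg fun h => hk h.1

end Symmetrization

end

end GTHL

namespace GTHL

noncomputable section

/-! ### The parts of the Hall–Littlewood formula -/

section HallLittlewood

variable {n : ℕ}

theorem weylAct_eq_iff {w : Equiv.Perm (Fin n)} {l μ : Fin n → ℤ} :
    weylAct w l = μ ↔ ∀ i, μ (w i) = l i := by
  constructor
  · rintro rfl i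
    simp [weylAct]
  · intro h
    ext i
    simp [weylAct, ← h]

theorem mem_weylOrbit_iff {l μ : Fin n → ℤ} :
    μ ∈ weylOrbit l ↔ ∃ w : Equiv.Perm (Fin n), ∀ i, μ (w i) = l i :=
  ⟨fun ⟨w, h⟩ => ⟨w, weylAct_eq_iff.mp h⟩, fun ⟨w, h⟩ => ⟨w, weylAct_eq_iff.mpr h⟩⟩

/-- The variable belonging to the coordinate `i`. -/
def coordVar (n : ℕ) (i : Fin n) : XField n := xVar n (i.val + 1)

theorem coordVar_ne_zero (i : Fin n) : coordVar n i ≠ 0 := xVar_ne_zero n _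

theorem coordVar_injective (n : ℕ) : Function.Injective (coordVar n) := fun i j h =>
  Fin.ext (xVar_injOn i.2 j.2 h)

theorem expW_root (w : Equiv.Perm (Fin n)) (i j : Fin n) :
    expW (-weylAct w (root i j)) = coordVar n (w j) / coordVar n (w i) := by
  have h : -weylAct w (root i j) = Pi.single (w j) 1 + Pi.single (w i) (-1) := by
    ext b
    simp only [Pi.neg_apply, weylAct, root, Pi.sub_apply, Pi.add_apply, Pi.single_apply,
      Equiv.Perm.inv_eq_iff_eq]
    split_ifs <;> simp
  have h1 : ∀ (a : Fin n) (m : ℤ), ∏ b : Fin n, xVar n (b.val + 1) ^ (Pi.single a m : Fin n → ℤ) b =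
      coordVar n a ^ m := by
    intro a m
    rw [Finset.prod_eq_single a (fun b _ hb => by rw [Pi.single_eq_of_ne hb, zpow_zero])
      (fun h => absurd (Finset.mem_univ a) h), Pi.single_eq_same]
    rfl
  rw [expW, h]
  simp only [Pi.add_apply, zpow_add₀ (xVar_ne_zero n _)]
  rw [Finset.prod_mul_distrib, h1, h1, zpow_one, zpow_neg_one, div_eq_mul_inv]

theorem hlTerm_eq (l : Fin n → ℤ) (w : Equiv.Perm (Fin n)) : hlTerm l w = expW (weylAct w l) *
    ∏ p : Fin n × Fin n with p.1 < p.2,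
      hlFactor (tVar n) (coordVar n (w p.1)) (coordVar n (w p.2)) := by
  rw [hlTerm]
  congr 1
  refine Finset.prod_congr rfl fun p _ => ?_
  have hx := coordVar_ne_zero (w p.1)
  rw [expW_root w, hlFactor, ← mul_div_mul_left _ _ hx]
  congr 1 <;> field_simp

theorem lengthProd_eq_pow {F : Type*} [Field F] (t : F) (w : Equiv.Perm (Fin n)) :
    lengthProd t w = t ^ weylLength w := by
  rw [lengthProd, ← Fintype.prod_prod_type'
    (f := fun i j : Fin n => if i < j ∧ w j < w i then t else 1), Finset.prod_ite,
    Finset.prod_const, Finset.prod_const_one, mul_one]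
  rfl

/-- As `l` decreases, `l i > l j` implies `i < j`. Thus `w` carries these pairs onto all pairs with
`μ_p > μ_q`, whatever `w` is; the remaining pairs lie inside the blocks. -/
theorem prod_hlFactor_eq {F : Type*} [Field F] (t : F) (y : Fin n → F) {l μ : Fin n → ℤ}
    (hl : Antitone l) {w : Equiv.Perm (Fin n)} (hw : ∀ i, μ (w i) = l i) :
    ∏ p : Fin n × Fin n with p.1 < p.2, hlFactor t (y (w p.1)) (y (w p.2)) =
      (∏ p : Fin n × Fin n with μ p.2 < μ p.1, hlFactor t (y p.1) (y p.2)) * blockProd t y l w := by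
  rw [← Finset.prod_filter_mul_prod_filter_not _ fun p : Fin n × Fin n => l p.2 < l p.1]
  congr 1
  · refine Finset.prod_equiv (Equiv.prodCongr w w) (fun p => ?_) fun p _ => rfl
    simp only [Finset.mem_filter, Finset.mem_univ, true_and, Equiv.prodCongr_apply, Prod.map, hw]
    refine ⟨fun h => h.2, fun h => ⟨?_, h⟩⟩
    by_contra hp
    exact absurd (hl (not_lt.mp hp)) (not_le.mpr h)
  · rw [blockProd, ← Fintype.prod_prod_type'
      (f := fun i j : Fin n => if i < j ∧ l i = l j then hlFactor t (y (w i)) (y (w j)) else 1),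
      ← Finset.prod_filter, Finset.filter_filter]
    refine Finset.prod_congr ?_ fun _ _ => rfl
    ext p
    simp only [Finset.mem_filter, Finset.mem_univ, true_and]
    refine and_congr_right fun h => ?_
    have := hl h.le
    omega

theorem tVar_ne_one (n : ℕ) : tVar n ≠ 1 := by
  intro h
  have := xVar_ne_tVar_mul (n := n) 0 0
  rw [h, one_mul] at this
  exact this rfl

/-- At `t = 1` it is the order of the stabilizer. -/
theorem stabPoincare_ne_zero (l : Fin n → ℤ) : stabPoincare l ≠ 0 := by
  have h : stabPoincare l = algebraMap (Polynomial ℤ) (XField n)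
      (∑ w : Equiv.Perm (Fin n) with weylAct w l = l, Polynomial.X ^ weylLength w) := by
    simp [stabPoincare, tVar]
  rw [h, IsScalarTower.algebraMap_apply (Polynomial ℤ) (MvPolynomial (Fin (n - 1)) (Polynomial ℤ)),
    Ne, FaithfulSMul.algebraMap_eq_zero_iff, FaithfulSMul.algebraMap_eq_zero_iff]
  intro h0
  have h1 := congrArg (Polynomial.eval 1) h0
  simp only [Polynomial.eval_finsetSum, Polynomial.eval_pow, Polynomial.eval_X, one_pow,
    Finset.sum_const, nsmul_one, Polynomial.eval_zero, Nat.cast_eq_zero, Finset.card_eq_zero] at h1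
  have h2 : (1 : Equiv.Perm (Fin n)) ∈
      Finset.univ.filter fun w : Equiv.Perm (Fin n) => weylAct w l = l :=
    Finset.mem_filter.mpr ⟨Finset.mem_univ _, rfl⟩
  rw [h1] at h2
  exact absurd h2 (Finset.notMem_empty _)

/-- The product formula for the parts of the Hall–Littlewood formula. -/
theorem hlPart_eq {l μ : Fin n → ℤ} (hl : Antitone l) (hμ : μ ∈ weylOrbit l) :
    hlPart l μ = expW μ * ∏ p : Fin n × Fin n with μ p.2 < μ p.1,
      hlFactor (tVar n) (coordVar n p.1) (coordVar n p.2) := by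
  have h1 : ∑ w : Equiv.Perm (Fin n) with weylAct w l = μ, hlTerm l w =
      (expW μ * ∏ p : Fin n × Fin n with μ p.2 < μ p.1,
        hlFactor (tVar n) (coordVar n p.1) (coordVar n p.2)) * stabPoincare l := by
    have h2 := sum_blockProd (tVar_ne_one n) (coordVar_injective n) coordVar_ne_zero hl
      (mem_weylOrbit_iff.mp hμ)
    rw [stabPoincare]
    simp only [weylAct_eq_iff]
    simp only [lengthProd_eq_pow] at h2
    rw [← h2, Finset.mul_sum]
    refine Finset.sum_congr rfl fun w hw => ?_
    have hw' := (Finset.mem_filter.mp hw).2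
    rw [hlTerm_eq, weylAct_eq_iff.mpr hw', prod_hlFactor_eq _ _ hl hw', mul_assoc]
  rw [hlPart, h1, mul_comm, mul_assoc, mul_inv_cancel₀ (stabPoincare_ne_zero l), mul_one]

end HallLittlewood

end

end GTHL

namespace GTHL

noncomputable section

open Filter Topology

/-! ### Triangles each of whose rows is obtained by removing an element from the previous one -/

section Removes

variable {n : ℕ} {V : GTIndex n → ℤ} {m : ℕ → ℤ}

/-- For every `i`, row `i + 1` is obtained from row `i` by removing the number `m i`. -/
def Removes (V : GTIndex n → ℤ) (m : ℕ → ℤ) : Prop :=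
  ∀ i < n, ∀ θ, rowGE V i θ = rowGE V (i + 1) θ + if θ ≤ m i then 1 else 0

/-- The number of elements of the sequence `m` at places from `i` to `n - 1` which are at least
`θ`. -/
def tailCount (n : ℕ) (m : ℕ → ℤ) (i : ℕ) (θ : ℤ) : ℕ := ∑ b ∈ Finset.Ico i n, if θ ≤ m b then 1 else 0

theorem tailCount_succ {i : ℕ} (hi : i < n) (θ : ℤ) :
    tailCount n m i θ = tailCount n m (i + 1) θ + if θ ≤ m i then 1 else 0 := by
  rw [tailCount, tailCount, Finset.sum_eq_sum_Ico_succ_bot hi, add_comm]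

theorem tailCount_of_le {i : ℕ} (hi : n ≤ i) (θ : ℤ) : tailCount n m i θ = 0 := by
  rw [tailCount, Finset.Ico_eq_empty_of_le hi, Finset.sum_empty]

theorem tailCount_le (i : ℕ) (θ : ℤ) : tailCount n m i θ ≤ n - i := by
  rw [← Nat.card_Ico, Finset.card_eq_sum_ones, tailCount]
  exact Finset.sum_le_sum fun b _ => by split_ifs <;> simp

theorem tailCount_anti (i : ℕ) {θ θ' : ℤ} (h : θ ≤ θ') : tailCount n m i θ' ≤ tailCount n m i θ := by
  refine Finset.sum_le_sum fun b _ => ?_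
  split_ifs with h1 h2
  · exact le_rfl
  · exact absurd (h.trans h1) h2
  · simp
  · exact le_rfl

theorem rowGE_of_le (V : GTIndex n → ℤ) {i : ℕ} (hi : n ≤ i) (θ : ℤ) : rowGE V i θ = 0 := by
  have := rowGE_le V i θ
  omega

/-- Rows from `n` on are empty, so upward induction rebuilds row `i` from the numbers deleted at
rows `i, …, n - 1`. -/
theorem removes_iff : Removes V m ↔ ∀ i θ, rowGE V i θ = tailCount n m i θ := by
  constructor
  · intro h
    have key : ∀ k i, n ≤ i + k → ∀ θ, rowGE V i θ = tailCount n m i θ := by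
      intro k
      induction k with
      | zero =>
        intro i hi θ
        rw [add_zero] at hi
        rw [rowGE_of_le V hi, tailCount_of_le hi]
      | succ k ih =>
        intro i hi θ
        rcases lt_or_ge i n with hin | hin
        · rw [h i hin θ, tailCount_succ hin, ih (i + 1) (by omega)]
        · rw [rowGE_of_le V hin, tailCount_of_le hin]
    exact fun i => key n i (by omega)
  · intro h i hi θ
    rw [h, h, tailCount_succ hi]

/-- The existence of triangles with prescribed removed elements. -/
theorem exists_removes (n : ℕ) (m : ℕ → ℤ) : ∃ V : GTIndex n → ℤ, IsTriangle V ∧ Removes V m := by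
  -- Row `i` is to be the sorted list of `m i, …, m (n - 1)`; its entry in column `j` is the largest
  -- `θ` reached by more than `j` of these numbers.
  have hex : ∀ p : GTIndex n, ∃ c : ℤ, ∀ θ, θ ≤ c ↔ p.col < tailCount n m p.row θ := by
    intro p
    have hp := row_add_col_lt p
    obtain ⟨lo, hlo⟩ : ∃ lo : ℤ, ∀ b ∈ Finset.range n, lo ≤ m b := by
      obtain ⟨lo, hlo⟩ := (Finset.finite_toSet ((Finset.range n).image m)).bddBelow
      exact ⟨lo, fun b hb => hlo (Finset.mem_coe.mpr (Finset.mem_image_of_mem m hb))⟩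
    obtain ⟨hi, hhi⟩ : ∃ hi : ℤ, ∀ b ∈ Finset.range n, m b ≤ hi := by
      obtain ⟨hi, hhi⟩ := (Finset.finite_toSet ((Finset.range n).image m)).bddAbove
      exact ⟨hi, fun b hb => hhi (Finset.mem_coe.mpr (Finset.mem_image_of_mem m hb))⟩
    obtain ⟨c, hc1, hc2⟩ := Int.exists_greatest_of_bdd
      (P := fun θ => p.col < tailCount n m p.row θ)
      ⟨hi, fun θ hθ => by
        by_contra hlt
        have : tailCount n m p.row θ = 0 := Finset.sum_eq_zero fun b hb => if_neg fun hle => by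
          have := hhi b (Finset.mem_range.mpr (Finset.mem_Ico.mp hb).2)
          omega
        omega⟩
      ⟨lo, by
        have : tailCount n m p.row lo = n - p.row := by
          rw [tailCount, Finset.sum_congr rfl fun b hb => if_pos
            (hlo b (Finset.mem_range.mpr (Finset.mem_Ico.mp hb).2)), Finset.sum_const,
            smul_eq_mul, mul_one, Nat.card_Ico]
        omega⟩
    exact ⟨c, fun θ => ⟨fun h => lt_of_lt_of_le hc1 (tailCount_anti _ h), hc2 θ⟩⟩
  choose V hV using hex
  have hanti : ∀ i, RowAntitone V i := fun i p q hp hq hpq => by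
    have := (hV q (V q)).mp le_rfl
    rw [hV p, hp]
    rw [hq] at this
    omega
  have hGE : ∀ i θ, rowGE V i θ = tailCount n m i θ := by
    intro i θ
    have h1 := rowGE_le V i θ
    have h2 := tailCount_le (n := n) (m := m) i θ
    by_contra hne
    rcases lt_or_gt_of_ne hne with h | h
    · have h3 := lt_rowGE_iff (hanti i) (pos i (rowGE V i θ) (by omega)) rfl θ
      rw [hV, pos_col, pos_row] at h3
      omega
    · have h3 := lt_rowGE_iff (hanti i) (pos i (tailCount n m i θ) (by omega)) rfl θ
      rw [hV, pos_col, pos_row] at h3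
      omega
  refine ⟨V, ⟨hanti 0, (covers_iff_rowsInterlace (hanti 0)).mpr fun i hi =>
    ⟨hanti (i + 1), fun θ => ?_⟩⟩, removes_iff.mpr hGE⟩
  rw [hGE, hGE, tailCount_succ (Finset.mem_range.mp hi)]
  split_ifs <;> omega

theorem eq_of_rowGE_eq {V V' : GTIndex n → ℤ} (h : ∀ i, RowAntitone V i) (h' : ∀ i, RowAntitone V' i)
    (hGE : ∀ i θ, rowGE V i θ = rowGE V' i θ) : V = V' := by
  have key : ∀ p θ, θ ≤ V p ↔ θ ≤ V' p := fun p θ => by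
    rw [← lt_rowGE_iff (h p.row) p rfl, ← lt_rowGE_iff (h' p.row) p rfl, hGE]
  ext p
  exact le_antisymm ((key p _).mp le_rfl) ((key p _).mpr le_rfl)

theorem Removes.unique {m' : ℕ → ℤ} (h : Removes V m) (h' : Removes V m') {i : ℕ} (hi : i < n) :
    m i = m' i := by
  have key : ∀ θ, θ ≤ m i ↔ θ ≤ m' i := by
    intro θ
    have h1 := h i hi θ
    rw [h' i hi θ] at h1
    by_cases h2 : θ ≤ m i <;> by_cases h3 : θ ≤ m' i <;> simp [h2, h3] at h1 ⊢
  exact le_antisymm ((key _).mp le_rfl) ((key _).mpr le_rfl)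

/-- The multiplicities of the entries do not increase from a row to the next one. -/
def LenAntitone (V : GTIndex n → ℤ) : Prop := ∀ c i, valueLen V c (i + 1) ≤ valueLen V c i

theorem Removes.valueLen_eq (h : Removes V m) {i : ℕ} (hi : i < n) (c : ℤ) :
    valueLen V c i = valueLen V c (i + 1) + if m i = c then 1 else 0 := by
  have h1 := rowGE_anti V c i
  have h2 := rowGE_anti V c (i + 1)
  have h3 := h i hi c
  have h4 := h i hi (c + 1)
  rw [valueLen, valueLen]
  rcases lt_trichotomy (m i) c with h5 | h5 | h5
  · rw [if_neg (by omega)] at h3 h4 ⊢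
    omega
  · rw [if_pos (by omega)] at h3 ⊢
    rw [if_neg (by omega)] at h4
    omega
  · rw [if_pos (by omega)] at h3 h4
    rw [if_neg (by omega)]
    omega

theorem Removes.lenAntitone (h : Removes V m) : LenAntitone V := by
  intro c i
  rcases lt_or_ge i n with hi | hi
  · rw [h.valueLen_eq hi]; omega
  · rw [valueLen, rowGE_of_le V (by omega)]; omega

theorem exists_le_entries (V : GTIndex n → ℤ) : ∃ lo, ∀ p, lo ≤ V p := by
  obtain ⟨lo, hlo⟩ := (Finset.finite_toSet (Finset.univ.image V)).bddBelow
  exact ⟨lo, fun p => hlo (Finset.mem_coe.mpr (Finset.mem_image_of_mem V (Finset.mem_univ p)))⟩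

theorem exists_entries_lt (V : GTIndex n → ℤ) : ∃ hi, ∀ p, V p < hi := by
  obtain ⟨hi, hhi⟩ := (Finset.finite_toSet (Finset.univ.image V)).bddAbove
  exact ⟨hi + 1, fun p => Int.lt_add_one_of_le
    (hhi (Finset.mem_coe.mpr (Finset.mem_image_of_mem V (Finset.mem_univ p))))⟩

/-- By interlacing the counts of two consecutive rows differ by 0 or 1. Nonincreasing multiplicities
make this difference nonincreasing in `θ`; it is 1 far below and 0 far above, and the place where it
drops is the deleted number. -/
theorem IsTriangle.exists_removes (hV : IsTriangle V) (h : LenAntitone V) : ∃ m, Removes V m := by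
  have hex : ∀ i, ∃ c : ℤ, i < n → ∀ θ, rowGE V i θ = rowGE V (i + 1) θ + if θ ≤ c then 1 else 0 := by
    intro i
    by_cases hi : i < n
    swap
    · exact ⟨0, fun h => absurd h hi⟩
    have hstep : ∀ θ, rowGE V i (θ + 1) = rowGE V (i + 1) (θ + 1) + 1 →
        rowGE V i θ = rowGE V (i + 1) θ + 1 := by
      intro θ hθ
      have h1 := h θ i
      have h2 := hV.rowsInterlace i θ
      have h3 := rowGE_anti V θ i
      have h4 := rowGE_anti V θ (i + 1)
      rw [valueLen, valueLen] at h1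
      omega
    have hdown : ∀ (k : ℕ) (θ : ℤ), rowGE V i (θ + k) = rowGE V (i + 1) (θ + k) + 1 →
        rowGE V i θ = rowGE V (i + 1) θ + 1 := by
      intro k
      induction k with
      | zero => intro θ hθ; simpa using hθ
      | succ k ih =>
        intro θ hθ
        refine ih θ (hstep _ ?_)
        rw [Nat.cast_succ, ← add_assoc] at hθ
        exact hθ
    obtain ⟨lo, hlo⟩ := exists_le_entries V
    obtain ⟨hi', hhi⟩ := exists_entries_lt V
    have hfull : ∀ j, j ≤ n → rowGE V j lo = n - j := by
      intro j hj
      refine le_antisymm (rowGE_le V j lo) ?_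
      by_contra hlt
      have h3 := (lt_rowGE_iff (hV.rowAntitone j) (pos j (rowGE V j lo) (by omega)) rfl lo).mpr (hlo _)
      exact lt_irrefl _ h3
    obtain ⟨c, hc1, hc2⟩ := Int.exists_greatest_of_bdd
      (P := fun θ => rowGE V i θ = rowGE V (i + 1) θ + 1)
      ⟨hi', fun θ hθ => by
        by_contra hlt
        have : rowGE V i θ = 0 := by
          rw [rowGE, Finset.card_eq_zero, Finset.filter_eq_empty_iff]
          rintro p - ⟨-, hp⟩
          have := hhi p
          omega
        omega⟩
      ⟨lo, by rw [hfull i hi.le, hfull (i + 1) hi]; omega⟩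
    refine ⟨c, fun _ θ => ?_⟩
    split_ifs with hθ
    · obtain ⟨k, hk⟩ := Int.le.dest hθ
      exact hdown k θ (by rw [hk]; exact hc1)
    · have h1 := hV.rowsInterlace i θ
      have h2 : ¬ rowGE V i θ = rowGE V (i + 1) θ + 1 := fun h => hθ (hc2 θ h)
      omega
  choose m hm using hex
  exact ⟨m, fun i hi => hm i hi⟩

end Removes

/-! ### Vertices -/

section Vertices

variable {n : ℕ} {l : Fin n → ℤ} {V : GTIndex n → ℤ}

/-- Vertices of the Gelfand–Tsetlin polytope have integer entries. -/
theorem exists_toReal_eq {u : GTIndex n → ℝ} (hu : u ∈ (gtPolytope l).extremePoints ℝ) :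
    ∃ V : GTIndex n → ℤ, u = toReal V := by
  classical
  obtain ⟨hP, hext⟩ := hu
  suffices ∀ p, ∃ c : ℤ, u p = c by
    choose V hV using this
    exact ⟨V, funext hV⟩
  intro p
  by_contra hp
  push Not at hp
  -- All entries sharing a non-integral value can be moved together by `±ε`: adjacent equalities are
  -- kept and the integral top row is untouched.
  set d : GTIndex n → ℝ := fun q => if u q = u p then 1 else 0 with hd
  have hdir : ∀ a : ℝ, ∀ᶠ ε : ℝ in 𝓝[>] 0, u + ε • (a • d) ∈ gtPolytope l := by
    intro a
    have hb : u + a • d ∈ tangentCone (gtPolytope l) u := by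
      rw [mem_tangentCone_gtPolytope hP]
      have h0 := (mem_gtPolytope_iff.mp hP).1
      refine ⟨fun q hq => ?_, fun q w _ hqw => ?_⟩
      · have h1 : u q ≠ u p := by
          rw [h0 q hq]
          exact fun h => hp _ h.symm
        have h2 : d q = 0 := if_neg h1
        rw [Pi.add_apply, Pi.smul_apply, h2, smul_zero, add_zero, h0 q hq]
      · simp [hd, hqw]
    refine (eventually_minFace_eq hP hb).mono fun ε h => ?_
    have := h.1
    rwa [add_sub_cancel_left] at this
  obtain ⟨ε, ⟨h1, h2⟩, h3⟩ := (((hdir 1).and (hdir (-1))).and self_mem_nhdsWithin).exists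
  have h4 : u ∈ openSegment ℝ (u + ε • ((1 : ℝ) • d)) (u + ε • ((-1 : ℝ) • d)) := by
    refine ⟨1 / 2, 1 / 2, by norm_num, by norm_num, by norm_num, ?_⟩
    ext q
    simp only [Pi.add_apply, Pi.smul_apply, smul_eq_mul]
    ring
  have h5 := congrFun (hext h1 h2 h4) p
  have h6 : ε = 0 := by simpa [hd] using h5
  exact absurd h6 (ne_of_gt h3)

/-- If `V p` lay strictly between its two upper neighbours, its value would be absent from the row
above and its multiplicity would increase. -/
theorem exists_adjacent_eq (hV : IsTriangle V) (h : LenAntitone V) {p : GTIndex n}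
    (hp : p.row ≠ 0) : ∃ q : GTIndex n, q.row + 1 = p.row ∧ (Covers p q ∨ Covers q p) ∧
      V q = V p := by
  have hpn := row_add_col_lt p
  obtain ⟨i, hi⟩ := Nat.exists_eq_succ_of_ne_zero hp
  have hi' : p.row = i + 1 := hi
  have c1 : Covers (pos i p.col (by omega)) p := Or.inl ⟨by rw [pos_row, hi'], rfl⟩
  have c2 : Covers p (pos i (p.col + 1) (by omega)) := Or.inr ⟨by rw [pos_row, hi'], rfl⟩
  by_contra hne
  push Not at hne
  have h1 := hne _ (by rw [pos_row, hi']) (Or.inr c1)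
  have h2 := hne _ (by rw [pos_row, hi']) (Or.inl c2)
  have h3 := hV.2 _ _ c1
  have h4 := hV.2 _ _ c2
  have h5 := lt_rowGE_iff (hV.rowAntitone i) (pos i p.col (by omega)) rfl (V p + 1)
  have h6 := lt_rowGE_iff (hV.rowAntitone i) (pos i (p.col + 1) (by omega)) rfl (V p)
  have h7 := lt_rowGE_iff (hV.rowAntitone (i + 1)) p hi' (V p)
  have h8 := lt_rowGE_iff (hV.rowAntitone (i + 1)) p hi' (V p + 1)
  have h9 := h (V p) i
  rw [valueLen, valueLen] at h9
  rw [pos_col] at h5 h6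
  omega

/-- Going down the rows, each entry equals an upper neighbour already fixed in both points `y` and
`z`. The inequality with this neighbour has the same direction for both, so their convex combination
meets it only with equality. -/
theorem toReal_mem_extremePoints (hV : IsTriangle V) (hP : toReal V ∈ gtPolytope l)
    (h : LenAntitone V) : toReal V ∈ (gtPolytope l).extremePoints ℝ := by
  rw [mem_extremePoints]
  refine ⟨hP, fun y hy z hz hyz => ?_⟩
  obtain ⟨a, b, ha, hb, hab, hsum⟩ := hyz
  have hP' := mem_gtPolytope_iff.mp hP
  have hy' := mem_gtPolytope_iff.mp hy
  have hz' := mem_gtPolytope_iff.mp hz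
  have hs : ∀ p, a * y p + b * z p = toReal V p := fun p => congrFun hsum p
  have key : ∀ i, ∀ p : GTIndex n, p.row = i → y p = toReal V p ∧ z p = toReal V p := by
    intro i
    induction i with
    | zero => exact fun p hp => by rw [hy'.1 p hp, hz'.1 p hp, hP'.1 p hp]; exact ⟨rfl, rfl⟩
    | succ i ih =>
      intro p hp
      obtain ⟨q, hq, hc, hVq⟩ := exists_adjacent_eq hV h (p := p) (by omega)
      obtain ⟨h1, h2⟩ := ih q (by omega)
      have h3 : toReal V q = toReal V p := by rw [toReal, toReal, hVq]
      rw [← h3]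
      have h4 := hs p
      rw [← h3] at h4
      have h5 : toReal V q = a * toReal V q + b * toReal V q := by rw [← add_mul, hab, one_mul]
      rcases hc with hc | hc
      · have h6 := hy'.2 _ _ hc
        have h7 := hz'.2 _ _ hc
        rw [h1] at h6
        rw [h2] at h7
        constructor <;> nlinarith
      · have h6 := hy'.2 _ _ hc
        have h7 := hz'.2 _ _ hc
        rw [h1] at h6
        rw [h2] at h7
        constructor <;> nlinarith
  exact ⟨funext fun p => (key _ p rfl).1, funext fun p => (key _ p rfl).2⟩

end Vertices

end

end GTHL

namespace GTHL

noncomputable section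

/-! ### Vertices given by elements of the orbit -/

section Orbit

variable {n : ℕ} {l : Fin n → ℤ} {V : GTIndex n → ℤ} {m : ℕ → ℤ}

theorem lam_antitone (a : Fin (n - 1) → ℕ) : Antitone (lam a) := by
  intro i j hij
  refine Finset.sum_le_sum fun k _ => ?_
  have : i.val ≤ j.val := hij
  split_ifs with h1 h2
  · exact le_rfl
  · omega
  · exact Int.natCast_nonneg _
  · exact le_rfl

theorem tailCount_zero (θ : ℤ) :
    tailCount n m 0 θ = ∑ b : Fin n, if θ ≤ m b then 1 else 0 := by
  rw [tailCount, ← Finset.range_eq_Ico, Finset.sum_range]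

theorem rowGE_zero (h0 : ∀ p : GTIndex n, p.row = 0 → V p = l p.1.2) (θ : ℤ) :
    rowGE V 0 θ = ∑ b : Fin n, if θ ≤ l b then 1 else 0 := by
  rw [rowGE, ← Finset.card_filter]
  refine Finset.card_bij (fun p _ => p.1.2) (fun p hp => ?_) (fun p hp q hq h => ?_) fun b hb => ?_
  · obtain ⟨h1, h2⟩ := (Finset.mem_filter.mp hp).2
    rw [h0 p h1] at h2
    exact Finset.mem_filter.mpr ⟨Finset.mem_univ _, h2⟩
  · exact GTIndex.ext' ((Finset.mem_filter.mp hp).2.1.trans (Finset.mem_filter.mp hq).2.1.symm)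
      (congrArg Fin.val h)
  · refine ⟨pos 0 b (by omega), Finset.mem_filter.mpr ⟨Finset.mem_univ _, rfl, ?_⟩, rfl⟩
    rw [h0 _ rfl]
    exact (Finset.mem_filter.mp hb).2

/-- The top row contains the numbers `m` in decreasing order, which is `l` when `m` is a
rearrangement of it. -/
theorem toReal_mem_gtPolytope (hl : Antitone l) (hV : IsTriangle V) (h : Removes V m)
    {w : Equiv.Perm (Fin n)} (hw : ∀ i : Fin n, m (w i) = l i) : toReal V ∈ gtPolytope l := by
  refine mem_gtPolytope_iff.mpr ⟨fun p hp => ?_, fun u w h => Int.cast_le.mpr (hV.2 u w h)⟩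
  have hL : RowAntitone (fun p : GTIndex n => l p.1.2) 0 := fun p q _ _ hpq => hl hpq
  have key : ∀ θ, θ ≤ V p ↔ θ ≤ l p.1.2 := fun θ => by
    rw [← lt_rowGE_iff hV.1 p hp, ← lt_rowGE_iff hL p hp, rowGE_zero (V := fun p => l p.1.2)
      (fun _ _ => rfl), removes_iff.mp h, tailCount_zero,
      ← Equiv.sum_comp w fun b => if θ ≤ m b then 1 else 0]
    simp only [hw]
  rw [toReal, le_antisymm ((key _).mp le_rfl) ((key _).mpr le_rfl)]

theorem exists_perm_of_count_eq {f g : Fin n → ℤ}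
    (h : ∀ θ, (∑ b, if θ ≤ f b then 1 else 0) = ∑ b, if θ ≤ g b then 1 else 0) :
    ∃ w : Equiv.Perm (Fin n), ∀ i, g (w i) = f i := by
  have hsplit : ∀ (f : Fin n → ℤ) (c : ℤ), (∑ b, if c ≤ f b then 1 else 0) =
      (∑ b, if c + 1 ≤ f b then 1 else 0) + Fintype.card {b // f b = c} := by
    intro f c
    rw [Fintype.card_subtype, Finset.card_filter, ← Finset.sum_add_distrib]
    refine Finset.sum_congr rfl fun b _ => ?_
    split_ifs <;> omega
  have hcard : ∀ c, Fintype.card {b // f b = c} = Fintype.card {b // g b = c} := by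
    intro c
    have h1 := hsplit f c
    rw [h, h, hsplit g] at h1
    omega
  exact ⟨Equiv.ofFiberEquiv fun c => Fintype.equivOfCardEq (hcard c),
    fun i => Equiv.ofFiberEquiv_map _ i⟩

theorem mem_weylOrbit_of_removes (hV : toReal V ∈ gtPolytope l) (h : Removes V m) :
    (fun b : Fin n => m b) ∈ weylOrbit l := by
  rw [mem_weylOrbit_iff]
  refine exists_perm_of_count_eq (f := l) (g := fun b => m b) fun θ => Eq.symm ?_
  rw [← tailCount_zero (m := m), ← removes_iff.mp h, rowGE_zero fun p hp =>
    Int.cast_injective (α := ℝ) ((mem_gtPolytope_iff.mp hV).1 p hp)]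

end Orbit

/-! ### Contributions of vertices -/

section VertexContribution

variable {n : ℕ} {l : Fin n → ℤ} {V : GTIndex n → ℤ} {m : ℕ → ℤ} {K : Type} [Field K]

theorem mem_image_of_valueLen_ne_zero {c : ℤ} {i : ℕ} (h : valueLen V c i ≠ 0) :
    c ∈ Finset.univ.image V := by
  have h1 := card_valueRow V V c i
  rw [valueLen] at h
  have h2 : valueRow V V c i ≠ 0 := by
    intro h0
    rw [h0, Multiset.card_zero] at h1
    omega
  obtain ⟨z, hz⟩ := Multiset.exists_mem_of_ne_zero h2
  obtain ⟨p, hp, -⟩ := Multiset.mem_map.mp hz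
  exact Finset.mem_image.mpr ⟨p, Finset.mem_univ p, (Finset.mem_filter.mp hp).2.2⟩

/-- A value whose multiplicity grows has a step with additional elements at both sides, so its
factor vanishes. -/
theorem hasContribution_zero (hl : Antitone l) (hV : toReal V ∈ gtPolytope l)
    (h : ¬ LenAntitone V) : HasContribution l (toReal V) 0 := by
  have hT := isTriangle_of_mem hl hV
  rw [LenAntitone] at h
  push Not at h
  obtain ⟨c, i, hci⟩ := h
  have hi : i < n := by
    by_contra hi
    rw [valueLen, valueLen, rowGE_of_le V (by omega : n ≤ i + 1)] at hci
    omega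
  convert hasContribution_of_mem hl hV using 1
  rw [Finset.prod_eq_zero (mem_image_of_valueLen_ne_zero (c := c) (i := i + 1) (by omega)), mul_zero]
  refine patternSum_eq_zero (generic_varSet n) (admissible_valueSteps hT c
    (fun i hi => xVar_mem_varSet hi) (fun i hi j hj h => xVar_injOn hi hj h))
    ⟨_, List.mem_map_of_mem (List.mem_range'_1.mpr ⟨Nat.zero_le i, by omega⟩), ?_⟩
    (Multiset.card_replicate _ _)
  have h1 := hT.rowsInterlace i c
  have h2 := hT.rowsInterlace i (c + 1)
  have h3 := rowGE_anti V c i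
  have h4 := rowGE_anti V c (i + 1)
  simp only [valueLen, leftStep, rightStep] at hci ⊢
  omega

theorem Removes.leftStep_eq (h : Removes V m) {i : ℕ} (hi : i < n) (c : ℤ) :
    leftStep V c i = if c < m i then 1 else 0 := by
  have h1 := h i hi (c + 1)
  rw [leftStep]
  split_ifs at h1 ⊢ <;> omega

theorem Removes.rightStep_eq (h : Removes V m) {i : ℕ} (hi : i < n) (c : ℤ) :
    rightStep V c i = if m i < c then 1 else 0 := by
  have h1 := h i hi c
  rw [rightStep]
  split_ifs at h1 ⊢ <;> omega

theorem Removes.step_eq_zero_iff (h : Removes V m) {i : ℕ} (hi : i < n) (c : ℤ) :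
    leftStep V c i = 0 ∧ rightStep V c i = 0 ↔ m i = c := by
  rw [h.leftStep_eq hi, h.rightStep_eq hi]
  rcases lt_trichotomy (m i) c with h1 | h1 | h1 
  · simp [h1, h1.ne]
  · simp [h1]
  · simp [h1, h1.ne']

theorem valueSteps_succ (V : GTIndex n → ℤ) (c : ℤ) (x : ℕ → K) (i k : ℕ) :
    valueSteps V c x i (k + 1) =
      ⟨leftStep V c i, rightStep V c i, x (i + 1)⟩ :: valueSteps V c x (i + 1) k := by
  rw [valueSteps, List.range'_succ, List.map_cons, valueSteps]

theorem Removes.prod_downVars (h : Removes V m) (c : ℤ) (x : ℕ → K) (f : K → K) (i k : ℕ)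
    (hik : i + k = n) : ((downVars (valueSteps V c x i k)).map f).prod =
      ∏ b ∈ Finset.Ico i n, if m b = c then f (x (b + 1)) else 1 := by
  induction k generalizing i with
  | zero =>
    rw [Finset.Ico_eq_empty_of_le (by omega), Finset.prod_empty]
    rfl
  | succ k ih =>
    rw [valueSteps_succ, downVars, Finset.prod_eq_prod_Ico_succ_bot (by omega),
      ← ih (i + 1) (by omega)]
    simp only [h.step_eq_zero_iff (by omega : i < n)]
    split_ifs
    · rw [List.map_cons, List.prod_cons]
    · rw [one_mul]

/-- The factor of the pair of the numbers removed from two rows. -/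
def pairFactor (t : K) (x : ℕ → K) (m : ℕ → ℤ) (a b : ℕ) : K :=
  if m a < m b then hlFactor t (x (b + 1)) (x (a + 1)) else
    if m b < m a then hlFactor t (x (a + 1)) (x (b + 1)) else 1

/-- For the value `c`, the shortening steps are those where `c` itself is deleted. Every other step
`a` adds one element, at the left if `m a > c` and at the right if `m a < c`, and meets the later
deletions of `c`. -/
theorem Removes.stepFactor_eq (h : Removes V m) (t : K) (c : ℤ) (x : ℕ → K) (i k : ℕ)
    (hik : i + k = n) : stepFactor t (valueSteps V c x i k) =
      ∏ a ∈ Finset.Ico i n, ∏ b ∈ Finset.Ico (a + 1) n,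
        if m b = c then pairFactor t x m a b else 1 := by
  induction k generalizing i with
  | zero =>
    rw [Finset.Ico_eq_empty_of_le (by omega), Finset.prod_empty]
    rfl
  | succ k ih =>
    have hi : i < n := by omega
    rw [valueSteps_succ, stepFactor, Finset.prod_eq_prod_Ico_succ_bot hi, ← ih (i + 1) (by omega)]
    congr 1
    simp only [h.step_eq_zero_iff hi]
    split_ifs with hc
    · symm
      refine Finset.prod_eq_one fun b _ => ?_
      split_ifs with hb
      · rw [pairFactor, hb, hc, if_neg (lt_irrefl c), if_neg (lt_irrefl c)]
      · rfl
    · rw [h.prod_downVars c x _ (i + 1) k (by omega)]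
      refine Finset.prod_congr rfl fun b _ => ?_
      split_ifs with hb
      · rw [exchangeFactor, h.leftStep_eq hi, h.rightStep_eq hi, pairFactor, hb]
        rcases lt_or_gt_of_ne hc with h1 | h1
        · rw [if_neg h1.not_gt, if_pos rfl, if_pos h1, hlFactor]
        · rw [if_pos h1, if_neg one_ne_zero, if_neg h1.not_gt, if_pos rfl, if_neg h1.not_gt,
            if_pos h1, hlFactor]
      · rfl

theorem Removes.mem_image (h : Removes V m) {i : ℕ} (hi : i < n) : m i ∈ Finset.univ.image V := by
  refine mem_image_of_valueLen_ne_zero (i := i) ?_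
  rw [h.valueLen_eq hi, if_pos rfl]
  omega

theorem prod_prod_Ico_eq {M : Type*} [CommMonoid M] (P : ℕ → ℕ → M) (n : ℕ) :
    ∏ a ∈ Finset.Ico 0 n, ∏ b ∈ Finset.Ico (a + 1) n, P a b =
      ∏ i : Fin n, ∏ j : Fin n, if i < j then P i j else 1 := by
  rw [← Finset.range_eq_Ico, Finset.prod_range]
  refine Finset.prod_congr rfl fun i _ => ?_
  have h1 : Finset.Ico (i.val + 1) n = (Finset.range n).filter fun b => i.val < b := by
    ext b
    rw [Finset.mem_Ico, Finset.mem_filter, Finset.mem_range]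
    omega
  rw [h1, Finset.prod_filter, Finset.prod_range]
  rfl

theorem prod_prod_eq_prod_lt {M : Type*} [CommMonoid M] (g : Fin n → Fin n → M)
    (hg : ∀ i, g i i = 1) :
    ∏ i, ∏ j, g i j = ∏ i, ∏ j, if i < j then g i j * g j i else 1 := by
  have h1 : ∀ i j, g i j = (if i < j then g i j else 1) * if j < i then g i j else 1 := by
    intro i j
    rcases lt_trichotomy i j with h | rfl | h
    · rw [if_pos h, if_neg h.not_gt, mul_one]
    · rw [if_neg (lt_irrefl i), one_mul, hg]
    · rw [if_neg h.not_gt, if_pos h, one_mul]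
  have h2 : ∀ i j, (if i < j then g i j * g j i else 1) =
      (if i < j then g i j else 1) * if i < j then g j i else 1 := by
    intro i j
    split_ifs
    · rfl
    · rw [one_mul]
  simp only [h2, Finset.prod_mul_distrib]
  rw [Finset.prod_comm (f := fun i j => if i < j then g j i else 1)]
  simp only [← Finset.prod_mul_distrib, ← h1]

/-- Only the value deleted at row `j` has a different sum in the next row, and the drop is `m j`. -/
theorem Removes.prod_specF (h : Removes V m) :
    ∏ p, specF n p ^ V p = expW fun b : Fin n => m b := by
  have h1 := prod_valueRow_zpow (xVar_zero n) (xVar_ne_zero n) V V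
  have h2 : ∏ p, specF n p ^ V p = ∏ p : GTIndex n, ((xVar n p.row)⁻¹ * xVar n (p.row + 1)) ^ V p :=
    rfl
  rw [h2, ← h1, Finset.prod_comm, expW, Finset.prod_range]
  refine Finset.prod_congr rfl fun j _ => ?_
  have hsum : ∀ c i, (valueRow V V c i).sum = valueLen V c i * c := by
    intro c i
    have h3 : valueRow V V c i = Multiset.replicate (valueLen V c i) c := by
      refine Multiset.eq_replicate.mpr ⟨?_, fun z hz => ?_⟩
      · have := card_valueRow V V c i
        rw [valueLen]
        omega
      · obtain ⟨p, hp, rfl⟩ := Multiset.mem_map.mp hz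
        exact (Finset.mem_filter.mp hp).2.2
    rw [h3, Multiset.sum_replicate, nsmul_eq_mul]
  have hterm : ∀ c, xVar n (j.val + 1) ^
      ((valueRow V V c j).sum - (valueRow V V c (j.val + 1)).sum) =
      if m j = c then xVar n (j.val + 1) ^ m j else 1 := by
    intro c
    rw [hsum, hsum, h.valueLen_eq j.2]
    split_ifs with hc
    · rw [hc]; congr 1; push_cast; ring
    · rw [add_zero, sub_self, zpow_zero]
  simp only [hterm]
  rw [Finset.prod_ite_eq, if_pos (h.mem_image j.2)]

/-- Each pair of rows `a < b` enters exactly one factor, that of the value `c = m b`. The product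
over all values is then the product of the pair factors, which is the product form of the
Hall–Littlewood part. -/
theorem Removes.hasContribution (hl : Antitone l) (hV : toReal V ∈ gtPolytope l)
    (h : Removes V m) : HasContribution l (toReal V) (hlPart l fun b : Fin n => m b) := by
  have hT := isTriangle_of_mem hl hV
  convert hasContribution_of_mem hl hV using 1
  rw [hlPart_eq hl (mem_weylOrbit_of_removes hV h), h.prod_specF]
  congr 1
  have h1 : ∀ c ∈ Finset.univ.image V, patternSum (tVar n) (valueLen V c 0)
      (valueSteps V c (xVar n) 0 n) (Multiset.replicate (valueLen V c 0) 0) =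
      ∏ a ∈ Finset.Ico 0 n, ∏ b ∈ Finset.Ico (a + 1) n,
        if m b = c then pairFactor (tVar n) (xVar n) m a b else 1 := by
    intro c _
    rw [← h.stepFactor_eq (tVar n) c (xVar n) 0 n (zero_add n)]
    refine patternSum_replicate (generic_varSet n) (admissible_valueSteps hT c
      (fun i hi => xVar_mem_varSet hi) (fun i hi j hj h => xVar_injOn hi hj h)) fun s hs => ?_
    obtain ⟨i, hi, rfl⟩ := List.mem_map.mp hs
    have hi' : i < n := by
      have := List.mem_range'_1.mp hi
      omega
    simp only [h.leftStep_eq hi', h.rightStep_eq hi']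
    split_ifs <;> omega
  rw [Finset.prod_congr rfl h1, Finset.prod_comm]
  have h2 : ∀ a ∈ Finset.Ico 0 n, (∏ c ∈ Finset.univ.image V, ∏ b ∈ Finset.Ico (a + 1) n,
      if m b = c then pairFactor (tVar n) (xVar n) m a b else 1) =
      ∏ b ∈ Finset.Ico (a + 1) n, pairFactor (tVar n) (xVar n) m a b := by
    intro a _
    rw [Finset.prod_comm]
    refine Finset.prod_congr rfl fun b hb => ?_
    rw [Finset.prod_ite_eq, if_pos (h.mem_image (Finset.mem_Ico.mp hb).2)]
  rw [Finset.prod_congr rfl h2, prod_prod_Ico_eq, Finset.prod_filter, Fintype.prod_prod_type,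
    prod_prod_eq_prod_lt]
  · refine Finset.prod_congr rfl fun i _ => Finset.prod_congr rfl fun j _ => ?_
    refine if_congr Iff.rfl ?_ rfl
    simp only [pairFactor, coordVar]
    rcases lt_trichotomy (m i) (m j) with h3 | h3 | h3
    · rw [if_neg h3.not_gt, if_pos h3, one_mul]
    · rw [h3, if_neg (lt_irrefl _), if_neg (lt_irrefl _), one_mul]
    · rw [if_pos h3, if_neg h3.not_gt, mul_one, if_neg h3.not_gt]
  · exact fun i => if_neg (lt_irrefl _)

end VertexContribution

end

end GTHL

/-! ### The parametrization of the contributing vertices -/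

namespace GTHL

/-- The extension of a weight to all natural numbers. -/
def natExtend {n : ℕ} (μ : Fin n → ℤ) (b : ℕ) : ℤ := if h : b < n then μ ⟨b, h⟩ else 0

theorem natExtend_val {n : ℕ} (μ : Fin n → ℤ) (i : Fin n) : natExtend μ i = μ i := dif_pos i.2

end GTHL

theorem theorem2 (n : ℕ) (a : Fin (n - 1) → ℕ) (ha : a ≠ 0) :
    ∃ v : GTHL.weylOrbit (GTHL.lam a) → (GTHL.gtPolytope (GTHL.lam a)).extremePoints ℝ,
      Function.Injective v ∧
      (∀ μ : GTHL.weylOrbit (GTHL.lam a),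
        GTHL.HasContribution (GTHL.lam a) (v μ).1 (GTHL.hlPart (GTHL.lam a) μ.1)) ∧
      (∀ u : (GTHL.gtPolytope (GTHL.lam a)).extremePoints ℝ, u ∉ Set.range v →
        GTHL.HasContribution (GTHL.lam a) u.1 0) := by
  open GTHL in
  have hl : Antitone (lam a) := lam_antitone a
  -- The vertex of `μ` is the triangle whose rows are obtained by deleting the coordinates of `μ`
  -- one after the other; values of the extension from `n` on play no role.
  choose V hT hV using fun μ : weylOrbit (lam a) => exists_removes n (natExtend μ.1)
  have hP : ∀ μ, toReal (V μ) ∈ gtPolytope (lam a) := by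
    intro μ
    obtain ⟨w, hw⟩ := mem_weylOrbit_iff.mp μ.2
    exact toReal_mem_gtPolytope hl (hT μ) (hV μ) fun i => by rw [natExtend_val, hw]
  refine ⟨fun μ => ⟨toReal (V μ), toReal_mem_extremePoints (hT μ) (hP μ) (hV μ).lenAntitone⟩,
    fun μ ν h => ?_, fun μ => ?_, fun u hu => ?_⟩
  · have h1 : V μ = V ν := funext fun p =>
      Int.cast_injective (α := ℝ) (congrFun (congrArg Subtype.val h) p)
    refine Subtype.ext (funext fun i => ?_)
    rw [← natExtend_val μ.1, ← natExtend_val ν.1]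
    exact (h1 ▸ hV μ).unique (hV ν) i.2
  · convert (hV μ).hasContribution hl (hP μ) using 2
    exact funext fun i => (natExtend_val μ.1 i).symm
  · obtain ⟨U, hU⟩ := exists_toReal_eq u.2
    have hUP : toReal U ∈ gtPolytope (lam a) := hU ▸ u.2.1
    rw [hU]
    -- A vertex with nonincreasing multiplicities deletes some sequence in the orbit, and the
    -- triangle is determined by that sequence, so it lies in the range of `v`.
    refine hasContribution_zero hl hUP fun hlen => hu ?_
    have hUT := isTriangle_of_mem hl hUP
    obtain ⟨m, hm⟩ := hUT.exists_removes hlen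
    refine ⟨⟨_, mem_weylOrbit_of_removes hUP hm⟩, Subtype.ext ?_⟩
    refine Eq.trans (congrArg toReal ?_) hU.symm
    refine eq_of_rowGE_eq (hT _).rowAntitone hUT.rowAntitone fun i θ => ?_
    rw [removes_iff.mp (hV _), removes_iff.mp hm, tailCount, tailCount]
    refine Finset.sum_congr rfl fun b hb => ?_
    rw [natExtend, dif_pos (Finset.mem_Ico.mp hb).2]
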